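/- Let $K$ be a field, $S=K[x_1,\dots,x_n]$, and let $\beta_{i,j}(S/J)=\dim_K \mathrm{Tor}_i^S(S/J,K)_j$ be the graded Betti numbers of $S/J$ for a homogeneous ideal $J$; they form the Betti diagram $\beta(S/J)$, with $\beta_{i,j}$ in column $i$ and row $j-i$. Say that $J$ has a $D$-linear resolution if for all $i\ge 1$ one has $\beta_{i,j}(S/J)=0$ unless $j=D+i-1$. For a degree sequence $\mathbf d=(0=d_0<d_1<\dots<d_p)$ of integers, the normalised pure diagram $\pi_{\mathbf d}$ has the entry $\prod_{r\ne 0,i} d_r/|d_r-d_i|$ at $(i,d_i)$ for $0\le i\le p$ (so the entry at $(0,0)$ is $1$), and all other entries are $0$. A decomposition of a diagram $\beta$ is an expression $\beta=\sum_{\mathbf d} w_{\mathbf d}\,\pi_{\mathbf d}$ with finitely many non-zero weights $w_{\mathbf d}$, all of them non-negative real numbers. A translation of a pure diagram is a family of normalised pure diagrams $\pi(k)$, $k\ge 1$, all of the same length $p$, such that for some integers $a,b$ and some non-negative integers $c_1,\dots,c_p$ independent of $k$ the non-zero position of $\pi(k)$ in column $i$ is in row $l(k)+c_i$ for $1\le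 i\le p$, where $l(k)=ak+b$. Let $I\subseteq S$ be a monomial ideal generated by monomials of one degree $d$, and suppose that for all sufficiently large $k$ the power $I^k$ has a $dk$-linear resolution. Then there are $k_0$, $m$, translations of pure diagrams $\pi_1(k),\dots,\pi_m(k)$, and real rational functions $h_1,\dots,h_m$ such that for all $k>k_0$: 1. $\pi_1(k),\dots,\pi_m(k)$ are pairwise distinct, and they are exactly the pure diagrams that occur with positive weight in some decomposition of $\beta(S/I^k)$; in particular every decomposition of $\beta(S/I^k)$ has the form $w_1\pi_1(k)+\dots+w_m\pi_m(k)$. 2. No $h_s$ has a pole at $k$, and the polytope of Betti diagram decompositions $$P_k=\{w\in\mathbb R_{\ge 0}^m : w_1\pi_1(k)+\dots+w_m\pi_m(k)=\beta(S/I^k)\}$$ is the single point $(h_1(k),\dots,h_m(k))$. -/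

import Mathlib

noncomputable section

namespace BettiPowers

open MvPolynomial

/-- `I` is a monomial ideal all of whose generators have degree `d`. -/
def IsMonomialGeneratedInDegree {K : Type*} [Field K] {n : ℕ}
    (I : Ideal (MvPolynomial (Fin n) K)) (d : ℕ) : Prop :=
  ∃ A : Set (Fin n →₀ ℕ), (∀ a ∈ A, a.degree = d) ∧
    I = Ideal.span ((fun a => monomial a (1 : K)) '' A)

/-! ### Graded Betti numbers

`β_{i,j}(S/J) = dim_K Tor_i^S(S/J, K)_j`, where `S = K[x_1, …, x_n]` and `Tor` is computed with the
Koszul complex, the graded free resolution of `K = S/(x_1, …, x_n)` over `S`, tensored with `S/J`.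
A Koszul chain is `∑_A c(A) e_A`, with `A` running over the subsets of the variables and
`c(A) ∈ S/J`; the basis element `e_A` has homological degree `#A` and internal degree `#A`. -/

/-- The space `⊕_A (S/J) e_A` of all Koszul chains with coefficients in `S/J`. -/
abbrev KoszulChain {K : Type*} [Field K] {n : ℕ} (J : Ideal (MvPolynomial (Fin n) K)) : Type _ :=
  Finset (Fin n) → MvPolynomial (Fin n) K ⧸ J

/-- The Koszul differential `e_A ↦ ∑_{a ∈ A} (-1)^{#{b ∈ A : b < a}} x_a e_{A \ {a}}`, written
through the coefficient of each `e_B` in the image. -/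
def koszulDifferential {K : Type*} [Field K] {n : ℕ} (J : Ideal (MvPolynomial (Fin n) K)) :
    KoszulChain J →ₗ[K] KoszulChain J where
  toFun c B := ∑ a ∈ Bᶜ, (-1) ^ (B.filter (· < a)).card *
    (Ideal.Quotient.mk J (X a) * c (insert a B))
  map_add' c c' := by
    funext B
    simp only [Pi.add_apply, mul_add, Finset.sum_add_distrib]
  map_smul' r c := by
    funext B
    simp only [Pi.smul_apply, mul_smul_comm, Finset.smul_sum, RingHom.id_apply]

/-- The Koszul differential squares to zero. -/
theorem koszulDifferential_comp_self {K : Type*} [Field K] {n : ℕ}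
    (J : Ideal (MvPolynomial (Fin n) K)) (c : KoszulChain J) :
    koszulDifferential J (koszulDifferential J c) = 0 := by
  funext B
  have key : ∀ a b : Fin n, a ∉ B → b ∉ B → a < b →
      ((-1 : MvPolynomial (Fin n) K ⧸ J) ^ (B.filter (· < a)).card *
        (-1) ^ ((insert a B).filter (· < b)).card) =
      - ((-1) ^ (B.filter (· < b)).card * (-1) ^ ((insert b B).filter (· < a)).card) := by
    intro a b ha hb hab
    rw [Finset.filter_insert, Finset.filter_insert, if_pos hab, if_neg (not_lt.mpr hab.le),
      Finset.card_insert_of_notMem (by simp [ha])]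
    ring
  simp only [koszulDifferential, LinearMap.coe_mk, AddHom.coe_mk, Pi.zero_apply, Finset.mul_sum]
  rw [Finset.sum_sigma']
  refine Finset.sum_involution (fun z _ => ⟨z.2, z.1⟩) ?_ ?_ ?_ ?_
  · rintro ⟨a, b⟩ h
    simp only [Finset.mem_sigma, Finset.mem_compl, Finset.mem_insert, not_or] at h
    obtain ⟨ha, hba, hb⟩ := h
    rw [Finset.insert_comm b a B]
    rcases lt_or_gt_of_ne hba with hlt | hlt
    · linear_combination (Ideal.Quotient.mk J (X a) * Ideal.Quotient.mk J (X b) *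
        c (insert a (insert b B))) * key b a hb ha hlt
    · linear_combination (Ideal.Quotient.mk J (X a) * Ideal.Quotient.mk J (X b) *
        c (insert a (insert b B))) * key a b ha hb hlt
  · rintro ⟨a, b⟩ h _ heq
    simp only [Finset.mem_sigma, Finset.mem_compl, Finset.mem_insert, not_or] at h
    simp only [Sigma.mk.injEq] at heq
    exact h.2.1 heq.1
  · rintro ⟨a, b⟩ h
    simp only [Finset.mem_sigma, Finset.mem_compl, Finset.mem_insert, not_or] at h ⊢
    exact ⟨h.2.2, fun e => h.2.1 e.symm, h.1⟩
  · rintro ⟨a, b⟩ h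
    rfl

/-- The degree `e` part `(S/J)_e` of `S/J`. -/
def quotientDegree {K : Type*} [Field K] {n : ℕ} (J : Ideal (MvPolynomial (Fin n) K)) (e : ℕ) :
    Submodule K (MvPolynomial (Fin n) K ⧸ J) :=
  (homogeneousSubmodule (Fin n) K e).map (Ideal.Quotient.mkₐ K J).toLinearMap

/-- The Koszul chains of homological degree `i` and internal degree `j`:
combinations of the `e_A` with `#A = i` and coefficients in `(S/J)_{j-i}` (zero if `j < i`). -/
def koszulChains {K : Type*} [Field K] {n : ℕ} (J : Ideal (MvPolynomial (Fin n) K)) (i j : ℕ) :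
    Submodule K (KoszulChain J) :=
  Submodule.pi Set.univ fun A =>
    if A.card = i ∧ i ≤ j then quotientDegree J (j - i) else ⊥

/-- Koszul cycles of homological degree `i` and internal degree `j`. -/
def koszulCycles {K : Type*} [Field K] {n : ℕ} (J : Ideal (MvPolynomial (Fin n) K)) (i j : ℕ) :
    Submodule K (KoszulChain J) :=
  koszulChains J i j ⊓ LinearMap.ker (koszulDifferential J)

/-- Koszul boundaries of homological degree `i` and internal degree `j`. -/
def koszulBoundaries {K : Type*} [Field K] {n : ℕ} (J : Ideal (MvPolynomial (Fin n) K)) (i j : ℕ) :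
    Submodule K (KoszulChain J) :=
  (koszulChains J (i + 1) j).map (koszulDifferential J)

/-- Boundaries are cycles, so that the quotient below is the Koszul homology. -/
theorem koszulBoundaries_le_koszulCycles {K : Type*} [Field K] {n : ℕ}
    (J : Ideal (MvPolynomial (Fin n) K)) (i j : ℕ) :
    koszulBoundaries J i j ≤ koszulCycles J i j := by
  rintro _ ⟨c, hc, rfl⟩
  refine ⟨?_, koszulDifferential_comp_self J c⟩
  simp only [koszulChains, SetLike.mem_coe, Submodule.mem_pi, Set.mem_univ, true_implies] at hc ⊢
  intro B
  refine Submodule.sum_mem _ fun a ha => ?_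
  have haB : a ∉ B := Finset.mem_compl.mp ha
  have h := hc (insert a B)
  rw [Finset.card_insert_of_notMem haB] at h
  by_cases hB : B.card = i ∧ i + 1 ≤ j
  · rw [if_pos ⟨by omega, hB.2⟩] at h
    rw [if_pos ⟨hB.1, by omega⟩]
    obtain ⟨f, hf, hfc⟩ := h
    refine ⟨(-1) ^ (B.filter (· < a)).card * (X a * f), ?_, ?_⟩
    · have h1 : (X a * f : MvPolynomial (Fin n) K).IsHomogeneous (j - i) := by
        have := (isHomogeneous_X K a).mul ((mem_homogeneousSubmodule _ _).mp hf)
        rwa [show 1 + (j - (i + 1)) = j - i by omega] at this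
      rcases neg_one_pow_eq_or (MvPolynomial (Fin n) K) (B.filter (· < a)).card with e | e <;> rw [e]
      · simpa using h1
      · simpa using h1
    · rw [← hfc]
      simp
  · rw [if_neg (by omega), Submodule.mem_bot] at h
    rw [h, mul_zero, mul_zero]
    exact Submodule.zero_mem _

/-- The graded Betti number `β_{i,j}(S/J) = dim_K Tor_i^S(S/J, K)_j`. -/
def betti {K : Type*} [Field K] {n : ℕ} (J : Ideal (MvPolynomial (Fin n) K)) (i j : ℕ) : ℕ :=
  Module.finrank K (koszulCycles J i j ⧸ (koszulBoundaries J i j).submoduleOf (koszulCycles J i j))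

/-- The Betti diagram of `S/J`, with `β_{i,j}` at `(i, j)`, i.e. in column `i` and row `j - i`. -/
def bettiDiagram {K : Type*} [Field K] {n : ℕ} (J : Ideal (MvPolynomial (Fin n) K)) :
    ℕ → ℕ → ℝ :=
  fun i j => betti J i j

/-- `J` has a `D`-linear resolution: for `i ≥ 1` the `i`-th module in the minimal graded free
resolution of `S/J` is generated in degree `D + i - 1`. -/
def HasLinearResolution {K : Type*} [Field K] {n : ℕ} (J : Ideal (MvPolynomial (Fin n) K))
    (D : ℕ) : Prop :=
  ∀ i j, 1 ≤ i → betti J i j ≠ 0 → j + 1 = D + i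

/-! ### Pure diagrams and decompositions -/

/-- A degree sequence `0 = d_0 < d_1 < ⋯ < d_p`, with `p = length`: the non-zero positions
`(i, d_i)` of a pure diagram whose top left corner is non-zero. -/
@[ext]
structure DegreeSequence where
  length : ℕ
  deg : Fin (length + 1) → ℕ
  strictMono : StrictMono deg
  deg_zero : deg 0 = 0

/-- The pure diagram of a degree sequence, normalised to have `1` in the top left corner; its entry
at `(i, d_i)` is `∏_{r ≠ 0, i} d_r / |d_r - d_i|`. -/
def DegreeSequence.pureDiagram (d : DegreeSequence) (i j : ℕ) : ℝ :=
  if h : i < d.length + 1 then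
    if j = d.deg ⟨i, h⟩ then
      ∏ r ∈ Finset.univ.filter (fun r => r ≠ 0 ∧ r ≠ ⟨i, h⟩),
        (d.deg r : ℝ) / |(d.deg r : ℝ) - (d.deg ⟨i, h⟩ : ℝ)|
    else 0
  else 0

/-- The decompositions of a diagram `β` as a finite sum `∑ w_d π_d` of normalised pure diagrams
with non-negative real weights. -/
def decompositions (β : ℕ → ℕ → ℝ) : Set (DegreeSequence →₀ ℝ) :=
  {w | (∀ d, 0 ≤ w d) ∧ ∀ i j, (w.sum fun d c => c * d.pureDiagram i j) = β i j}

/-- The pure diagrams that occur with positive weight in some decomposition of `β`. -/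
def occurringPure (β : ℕ → ℕ → ℝ) : Set DegreeSequence :=
  {d | ∃ w ∈ decompositions β, 0 < w d}

/-- The polytope in `ℝ^m` of weight vectors of the decompositions of `β` into the pure diagrams
`π_1, …, π_m`. -/
def decompositionPolytope {m : ℕ} (β : ℕ → ℕ → ℝ) (π : Fin m → DegreeSequence) :
    Set (Fin m → ℝ) :=
  {v | (∀ s, 0 ≤ v s) ∧ ∀ i j, ∑ s, v s * (π s).pureDiagram i j = β i j}

/-- A translation of a pure diagram: apart from the top left corner, the non-zero positions of
`π(k)` have a fixed shape (in column `i ≥ 1` the row `shape i`, counted from row `l(k)`) that is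
moved down to the row `l(k) = a k + b`. The row of the position `(i, d_i)` is `d_i - i`. -/
def IsTranslation (π : ℕ → DegreeSequence) : Prop :=
  ∃ (p : ℕ) (a b : ℤ) (shape : ℕ → ℕ), ∀ k : ℕ, 1 ≤ k →
    (π k).length = p ∧
    ∀ i : Fin ((π k).length + 1), i ≠ 0 →
      ((π k).deg i : ℤ) - (i : ℕ) = (a * k + b) + shape i

end BettiPowers

end

open BettiPowers

/-! Write D = dk and let k be large. The weights of a decomposition are non-negative, so nothing
cancels, and only pure diagrams supported inside the support of β(S/I^k) can occur: those of the
sequences 0 < D < D+1 < ⋯ < D+p-1. They are linearly independent (triangular in the length p), so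
there is at most one decomposition. It remains to show that its weights are non-negative, that they
are rational in k, and that each is eventually zero or eventually non-zero.

The pure diagram of length q+1 has the entry M_q·C(q,s)/(D+s) in column s+1, with M_q =
`linearFactor`. Writing (D+s)·β_{s+1} = ∑_q Γ_q·C(q,s), the weight of length q+1 is Γ_q/M_q, and
binomial inversion expresses Γ_q through the Betti numbers. The weight of length 0 is 1 + ∑
(-1)^{s+1} β_{s+1}; a partial fraction identity shows that the weights add up to 1.

Non-negativity of Γ_q (`exists_betti_eq_sum_choose`): the factor D+s is produced by t·d/dt acting on
the Hilbert numerator of the ideal J = I^k. A count of monomials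
(`sum_hilbSeries_diff_generatedBelow`) writes this derivative as (1-t)^n times the sum of the
Hilbert series of the quotients J/J_{v,c}, where J_{v,c} is generated by the monomials of J of
degree < c in x_v. Each quotient again has a linear resolution generated in degree D
(`KoszulExactFrom.isLinear_diff`), and the Hilbert series of such a module is a non-negative
combination of t^D/(1-t)^j (`IsLinear.exists_hilbertSeries`), as one sees by cutting with generic
linear forms. The weight of length 0 is the Hilbert numerator of S/J at t = 1, which is non-negative
by the same result applied to a truncation of S/J.

Rationality: Betti numbers of a linear resolution are alternating sums of Hilbert function values.
Each monomial of degree dk+e in I^k has a unique lexicographically least factorisation into k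
generators and a cofactor of degree e. For a fixed cofactor the admissible factorisations form the
complement of an upper set in ℕ^r, and its Hilbert function is eventually polynomial. Hence so are
the Betti numbers in k, the weights are rational functions, and a non-zero numerator has no large
roots. -/

namespace BettiPowers

/-! ### Exterior operators and Koszul differentials -/

section ExteriorOperators

variable {ι : Type*} [LinearOrder ι] {R : Type*} [CommRing R]
  {W W' W'' : Type*} [AddCommGroup W] [Module R W] [AddCommGroup W'] [Module R W']
  [AddCommGroup W''] [Module R W'']

/-- The Koszul sign of inserting `v` into `B`. -/
def koszulSign (B : Finset ι) (v : ι) : ℤ := (-1) ^ (B.filter (· < v)).card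

theorem koszulSign_mul_self (B : Finset ι) (v : ι) : koszulSign B v * koszulSign B v = 1 := by
  rw [koszulSign, ← mul_pow]; simp

theorem koszulSign_insert {B : Finset ι} {v w : ι} (hw : w ∉ B) :
    koszulSign (insert w B) v = if w < v then -koszulSign B v else koszulSign B v := by
  unfold koszulSign
  rw [Finset.filter_insert]
  split_ifs with h
  · rw [Finset.card_insert_of_notMem (by simp [hw]), pow_succ]; ring
  · rfl

variable (R) in
/-- Contraction of exterior chains with the dual of the basis vector `v`. -/
def contract (v : ι) : (Finset ι → W) →ₗ[R] (Finset ι → W) where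
  toFun c B := if v ∈ B then 0 else koszulSign B v • c (insert v B)
  map_add' c c' := by funext B; by_cases h : v ∈ B <;> simp [h]
  map_smul' r c := by funext B; by_cases h : v ∈ B <;> simp [h, smul_comm r]

variable (R) in
/-- Exterior multiplication with the basis vector `v`. -/
def wedge (v : ι) : (Finset ι → W) →ₗ[R] (Finset ι → W) where
  toFun c B := if v ∈ B then koszulSign (B.erase v) v • c (B.erase v) else 0
  map_add' c c' := by funext B; by_cases h : v ∈ B <;> simp [h]
  map_smul' r c := by funext B; by_cases h : v ∈ B <;> simp [h, smul_comm r]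

theorem contract_apply_of_mem {v : ι} {B : Finset ι} (h : v ∈ B) (c : Finset ι → W) :
    contract R v c B = 0 := if_pos h

theorem contract_apply_of_notMem {v : ι} {B : Finset ι} (h : v ∉ B) (c : Finset ι → W) :
    contract R v c B = koszulSign B v • c (insert v B) := if_neg h

theorem wedge_apply_of_notMem {v : ι} {B : Finset ι} (h : v ∉ B) (c : Finset ι → W) :
    wedge R v c B = 0 := if_neg h

theorem wedge_apply_of_mem {v : ι} {B : Finset ι} (h : v ∈ B) (c : Finset ι → W) :
    wedge R v c B = koszulSign (B.erase v) v • c (B.erase v) := if_pos h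

theorem wedge_apply_insert {v : ι} {B : Finset ι} (h : v ∉ B) (c : Finset ι → W) :
    wedge R v c (insert v B) = koszulSign B v • c B := by
  rw [wedge_apply_of_mem (Finset.mem_insert_self v B), Finset.erase_insert h]

theorem contract_contract_self (v : ι) (c : Finset ι → W) :
    contract R v (contract R v c) = 0 := by
  funext B
  by_cases h : v ∈ B
  · simp [contract_apply_of_mem h]
  · simp [contract_apply_of_notMem h, contract_apply_of_mem]

theorem contract_contract (v w : ι) (c : Finset ι → W) :
    contract R v (contract R w c) = -contract R w (contract R v c) := by
  rcases eq_or_ne v w with rfl | hvw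
  · simp [contract_contract_self]
  funext B
  simp only [Pi.neg_apply]
  by_cases hv : v ∈ B
  · by_cases hw : w ∈ B
    · simp [contract_apply_of_mem hv, contract_apply_of_mem hw]
    · rw [contract_apply_of_mem hv, contract_apply_of_notMem hw,
        contract_apply_of_mem (Finset.mem_insert_of_mem hv)]; simp
  by_cases hw : w ∈ B
  · rw [contract_apply_of_mem hw, contract_apply_of_notMem hv,
        contract_apply_of_mem (Finset.mem_insert_of_mem hw)]; simp
  rw [contract_apply_of_notMem hv, contract_apply_of_notMem hw,
    contract_apply_of_notMem (by simp [hw, hvw.symm]),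
    contract_apply_of_notMem (by simp [hv, hvw]), koszulSign_insert hv, koszulSign_insert hw,
    Finset.insert_comm w v]
  rcases lt_or_gt_of_ne hvw with h | h
  · rw [if_pos h, if_neg h.not_gt, smul_smul, smul_smul, ← neg_smul]; congr 1; ring
  · rw [if_pos h, if_neg h.not_gt, smul_smul, smul_smul, ← neg_smul]; congr 1; ring

/-- With `contract_wedge_of_ne` these are the Clifford relations. They split every chain into a part
with `v` and a part without it. -/
theorem contract_wedge_self (v : ι) (c : Finset ι → W) :
    contract R v (wedge R v c) + wedge R v (contract R v c) = c := by
  funext B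
  simp only [Pi.add_apply]
  by_cases hv : v ∈ B
  · rw [contract_apply_of_mem hv, wedge_apply_of_mem hv,
      contract_apply_of_notMem (Finset.notMem_erase v B), Finset.insert_erase hv, smul_smul,
      koszulSign_mul_self, one_smul, zero_add]
  · rw [contract_apply_of_notMem hv, wedge_apply_of_notMem hv, wedge_apply_insert hv, smul_smul,
      koszulSign_mul_self, one_smul, add_zero]

theorem contract_wedge_of_ne {v w : ι} (hvw : v ≠ w) (c : Finset ι → W) :
    contract R v (wedge R w c) = -wedge R w (contract R v c) := by
  funext B
  simp only [Pi.neg_apply]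
  by_cases hw : w ∈ B
  · obtain ⟨B, hw', rfl⟩ : ∃ B', w ∉ B' ∧ B = insert w B' :=
      ⟨B.erase w, Finset.notMem_erase w B, (Finset.insert_erase hw).symm⟩
    rw [wedge_apply_insert hw']
    by_cases hv : v ∈ B
    · rw [contract_apply_of_mem (Finset.mem_insert_of_mem hv), contract_apply_of_mem hv]; simp
    · rw [contract_apply_of_notMem (by simp [hv, hvw]), contract_apply_of_notMem hv,
        Finset.insert_comm v w, wedge_apply_insert (by simp [hw', hvw.symm]),
        koszulSign_insert hw', koszulSign_insert hv]
      rcases lt_or_gt_of_ne hvw with h | h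
      · rw [if_pos h, if_neg h.not_gt, smul_smul, smul_smul, ← neg_smul]; congr 1; ring
      · rw [if_pos h, if_neg h.not_gt, smul_smul, smul_smul, ← neg_smul]; congr 1; ring
  · rw [wedge_apply_of_notMem hw]
    by_cases hv : v ∈ B
    · rw [contract_apply_of_mem hv]; simp
    · rw [contract_apply_of_notMem hv, wedge_apply_of_notMem (by simp [hw, hvw.symm])]; simp

theorem contract_comp (f : W →ₗ[R] W') (v : ι) (c : Finset ι → W) :
    contract R v (f ∘ c) = f ∘ contract R v c := by
  funext B
  by_cases h : v ∈ B
  · simp [contract_apply_of_mem h]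
  · simp [contract_apply_of_notMem h]

theorem wedge_comp (f : W →ₗ[R] W') (v : ι) (c : Finset ι → W) :
    wedge R v (f ∘ c) = f ∘ wedge R v c := by
  funext B
  by_cases h : v ∈ B
  · simp [wedge_apply_of_mem h]
  · simp [wedge_apply_of_notMem h]

/-- The Koszul differential of the operators `x v`, `v ∈ S`. -/
def bdry (S : Finset ι) (x : ι → W →ₗ[R] W') : (Finset ι → W) →ₗ[R] (Finset ι → W') :=
  ∑ v ∈ S, ((x v).compLeft (Finset ι)) ∘ₗ contract R v

theorem bdry_apply (S : Finset ι) (x : ι → W →ₗ[R] W') (c : Finset ι → W) :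
    bdry S x c = ∑ v ∈ S, (x v) ∘ contract R v c := by
  simp only [bdry, LinearMap.sum_apply]; rfl

theorem bdry_apply_apply (S : Finset ι) (x : ι → W →ₗ[R] W') (c : Finset ι → W) (B : Finset ι) :
    bdry S x c B = ∑ v ∈ S, x v (contract R v c B) := by
  rw [bdry_apply, Finset.sum_apply]; rfl

theorem bdry_comp {S : Finset ι} {x : ι → W →ₗ[R] W'} {Z Z' : Type*} [AddCommGroup Z] [Module R Z]
    [AddCommGroup Z'] [Module R Z'] {x' : ι → Z →ₗ[R] Z'} (f : W →ₗ[R] Z) (f' : W' →ₗ[R] Z')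
    (h : ∀ v ∈ S, ∀ a, x' v (f a) = f' (x v a)) (c : Finset ι → W) :
    bdry S x' (f ∘ c) = f' ∘ bdry S x c := by
  funext B
  rw [bdry_apply_apply, Function.comp_apply, bdry_apply_apply, map_sum]
  refine Finset.sum_congr rfl fun v hv => ?_
  rw [contract_comp, Function.comp_apply, h v hv]

theorem contract_bdry (S : Finset ι) (x : ι → W →ₗ[R] W') (w : ι) (c : Finset ι → W) :
    contract R w (bdry S x c) = -bdry S x (contract R w c) := by
  rw [bdry_apply, bdry_apply, map_sum, ← Finset.sum_neg_distrib]
  refine Finset.sum_congr rfl fun v _ => ?_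
  rw [contract_comp, contract_contract]
  funext B
  simp

theorem bdry_contract (S : Finset ι) (x : ι → W →ₗ[R] W') (w : ι) (c : Finset ι → W) :
    bdry S x (contract R w c) = -contract R w (bdry S x c) := by
  rw [contract_bdry, neg_neg]

/-- The terms of (v, w) and (w, v) cancel. Source and target of the operators differ because they
are successive graded pieces of a module. -/
theorem bdry_bdry (S : Finset ι) (x : ι → W →ₗ[R] W') (x' : ι → W' →ₗ[R] W'')
    (hx : ∀ v w a, x' v (x w a) = x' w (x v a)) (c : Finset ι → W) :
    bdry S x' (bdry S x c) = 0 := by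
  classical
  have key : ∀ v w, (x' v) ∘ contract R v ((x w) ∘ contract R w c) =
      -((x' w) ∘ contract R w ((x v) ∘ contract R v c)) := by
    intro v w
    rw [contract_comp, contract_comp, contract_contract]
    funext B
    simp [hx v w]
  rw [bdry_apply, bdry_apply]
  have h1 : ∑ v ∈ S, (x' v) ∘ contract R v (∑ w ∈ S, (x w) ∘ contract R w c) =
      ∑ v ∈ S, ∑ w ∈ S, (x' v) ∘ contract R v ((x w) ∘ contract R w c) := by
    refine Finset.sum_congr rfl fun v _ => ?_
    rw [map_sum]
    funext B
    simp [Finset.sum_apply]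
  rw [h1, ← Finset.sum_product']
  refine Finset.sum_involution (fun z _ => (z.2, z.1)) ?_ ?_ ?_ ?_
  · rintro ⟨v, w⟩ _
    dsimp only
    rw [key v w, neg_add_cancel]
  · rintro ⟨v, w⟩ _ hne heq
    simp only [Prod.mk.injEq] at heq
    obtain rfl := heq.1
    apply hne
    dsimp only
    rw [contract_comp, contract_contract_self]
    funext B
    simp
  · rintro ⟨v, w⟩ h
    simpa [and_comm] using h
  · rintro ⟨v, w⟩ _
    rfl

/-- The homotopy formula: exterior multiplication with `w ∈ S` makes multiplication by x_w
null-homotopic on the Koszul complex. -/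
theorem bdry_wedge (S : Finset ι) (x : ι → W →ₗ[R] W') (w : ι) (c : Finset ι → W) :
    bdry S x (wedge R w c) = (if w ∈ S then (x w) ∘ c else 0) - wedge R w (bdry S x c) := by
  rw [bdry_apply, bdry_apply, map_sum]
  have h : ∀ v ∈ S, (x v) ∘ contract R v (wedge R w c) =
      (if w = v then (x w) ∘ c else 0) - wedge R w ((x v) ∘ contract R v c) := by
    intro v _
    rw [wedge_comp]
    by_cases hvw : w = v
    · subst hvw
      rw [if_pos rfl, eq_sub_of_add_eq (contract_wedge_self (R := R) w c)]
      funext B; simp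
    · rw [if_neg hvw, contract_wedge_of_ne (Ne.symm hvw)]
      funext B; simp
  rw [Finset.sum_congr rfl h, Finset.sum_sub_distrib, Finset.sum_ite_eq]

theorem bdry_insert {S : Finset ι} {w : ι} (hw : w ∉ S) (x : ι → W →ₗ[R] W') {c : Finset ι → W}
    (hc : contract R w c = 0) : bdry (insert w S) x c = bdry S x c := by
  rw [bdry_apply, bdry_apply, Finset.sum_insert hw, hc]
  funext B; simp

/-- Exterior multiplication with the vector `∑ v ∈ S, a v • v`. -/
def wedgeSum (S : Finset ι) (a : ι → R) : (Finset ι → W) →ₗ[R] (Finset ι → W) :=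
  ∑ v ∈ S, a v • wedge R v

theorem bdry_wedgeSum (S : Finset ι) (a : ι → R) (x : ι → W →ₗ[R] W') (c : Finset ι → W) :
    bdry S x (wedgeSum S a c) =
      ⇑(∑ v ∈ S, a v • x v) ∘ c - wedgeSum S a (bdry S x c) := by
  simp only [wedgeSum, LinearMap.sum_apply, LinearMap.smul_apply, map_sum, map_smul]
  rw [eq_sub_iff_add_eq, ← Finset.sum_add_distrib]
  have : ∀ v ∈ S, a v • bdry S x (wedge R v c) + a v • wedge R v (bdry S x c) =
      a v • ((x v) ∘ c) := by
    intro v hv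
    rw [bdry_wedge, if_pos hv, ← smul_add, sub_add_cancel]
  rw [Finset.sum_congr rfl this]
  funext B
  simp [Finset.sum_apply]

theorem contract_wedgeSum {S : Finset ι} {a : ι → R} {w : ι} (hw : w ∈ S) (haw : a w = 1)
    (c : Finset ι → W) :
    contract R w (wedgeSum S a c) = c - wedgeSum S a (contract R w c) := by
  simp only [wedgeSum, LinearMap.sum_apply, LinearMap.smul_apply, map_sum, map_smul]
  rw [eq_sub_iff_add_eq, ← Finset.sum_add_distrib, Finset.sum_eq_single_of_mem w hw]
  · rw [haw, one_smul, one_smul, contract_wedge_self]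
  · intro v _ hv
    rw [contract_wedge_of_ne hv.symm, smul_neg, neg_add_cancel]

end ExteriorOperators

end BettiPowers

namespace BettiPowers

/-! ### Modules with a linear resolution and their quotients by a linear form -/

section LinearModules

universe u w

variable {ι : Type w} {K : Type u} [Field K] {V : ℕ → Type u}
  [∀ e, AddCommGroup (V e)] [∀ e, Module K (V e)]

/-- The graded submodule `(0 :_{V 0} y) + y V`. -/
def multiplesSubmodule (y : (e : ℕ) → V e →ₗ[K] V (e + 1)) : (e : ℕ) → Submodule K (V e)
  | 0 => LinearMap.ker (y 0)
  | e + 1 => LinearMap.range (y e)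

variable {x : (e : ℕ) → ι → V e →ₗ[K] V (e + 1)} {y : (e : ℕ) → V e →ₗ[K] V (e + 1)}

/-- In degree 0 the form y need not be injective, but what it kills there is killed by every
variable: y is injective in degree 1 and commutes with the variables. So adding the kernel keeps a
submodule. -/
theorem multiplesSubmodule_le_comap
    (hxy : ∀ e v a, x (e + 1) v (y e a) = y (e + 1) (x e v a))
    (hinj : ∀ e, Function.Injective (y (e + 1))) (v : ι) :
    ∀ e, multiplesSubmodule y e ≤ (multiplesSubmodule y (e + 1)).comap (x e v)
  | 0 => by
    intro a ha
    have ha' : y 0 a = 0 := ha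
    have : x 0 v a = 0 := hinj 0 (by rw [← hxy, ha', map_zero, map_zero])
    rw [Submodule.mem_comap, this]
    exact Submodule.zero_mem _
  | e + 1 => by
    rintro _ ⟨a, rfl⟩
    exact ⟨x e v a, (hxy e v a).symm⟩

/-- The operators induced on the quotient by `multiplesSubmodule`. -/
def quotientOperators (hxy : ∀ e v a, x (e + 1) v (y e a) = y (e + 1) (x e v a))
    (hinj : ∀ e, Function.Injective (y (e + 1))) (e : ℕ) (v : ι) :
    (V e ⧸ multiplesSubmodule y e) →ₗ[K] (V (e + 1) ⧸ multiplesSubmodule y (e + 1)) :=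
  Submodule.mapQ _ _ (x e v) (multiplesSubmodule_le_comap hxy hinj v e)

variable [LinearOrder ι]

/-- A graded module `⊕ V e` over the polynomial ring in the variables `S` has a linear resolution:
its Koszul homology is concentrated in chains with coefficients in `V 0`. -/
def IsLinear (S : Finset ι) (x : (e : ℕ) → ι → V e →ₗ[K] V (e + 1)) : Prop :=
  ∀ e (z : Finset ι → V (e + 1)), bdry S (x (e + 1)) z = 0 → ∃ u, bdry S (x e) u = z

/-- A socle element m gives the Koszul cycle m·e_S, but a boundary has no component at e_S. Hence
the socle lives in degree 0, and a generic linear form is injective in positive degrees. -/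
theorem IsLinear.eq_zero_of_forall_mul_eq_zero {S : Finset ι}
    {x : (e : ℕ) → ι → V e →ₗ[K] V (e + 1)} (h : IsLinear S x) {e : ℕ} {m : V (e + 1)}
    (hm : ∀ v ∈ S, x (e + 1) v m = 0) : m = 0 := by
  classical
  let z : Finset ι → V (e + 1) := fun B => if B = S then m else 0
  have hz : bdry S (x (e + 1)) z = 0 := by
    funext B
    rw [bdry_apply_apply, Pi.zero_apply]
    refine Finset.sum_eq_zero fun v hv => ?_
    by_cases hB : v ∈ B
    · rw [contract_apply_of_mem hB, map_zero]
    · rw [contract_apply_of_notMem hB]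
      by_cases h' : insert v B = S
      · simp [z, h', hm v hv]
      · simp [z, h']
  obtain ⟨u, hu⟩ := h e z hz
  have h1 : z S = m := if_pos rfl
  rw [← h1, ← hu, bdry_apply_apply]
  exact Finset.sum_eq_zero fun v hv => by rw [contract_apply_of_mem hv, map_zero]

/-- Let ℓ = ∑ a_v e_v and ∂z = y·z'. Then z - ℓ∧z' is a cycle in all the variables, hence equals ∂u.
Contracting with ω gives ∂(ι_ω u) = z', and u - ℓ∧ι_ω u no longer involves ω; its boundary is z -
y·ι_ω u. -/
theorem IsLinear.exists_lift_of_contract_eq_zero {S : Finset ι} {ω : ι} (hω : ω ∉ S) {a : ι → K}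
    (haω : a ω = 1) (hx : ∀ e v w m, x (e + 1) v (x e w m) = x (e + 1) w (x e v m))
    (hy : ∀ e, y e = ∑ v ∈ insert ω S, a v • x e v)
    (hxy : ∀ e v a, x (e + 1) v (y e a) = y (e + 1) (x e v a))
    (hinj : ∀ e, Function.Injective (y (e + 1))) (h : IsLinear (insert ω S) x) {e : ℕ}
    {z : Finset ι → V (e + 1)} (hzω : contract K ω z = 0)
    (hz : ∀ B, bdry S (x (e + 1)) z B ∈ LinearMap.range (y (e + 1))) :
    ∃ u t, z = bdry S (x e) u + (y e) ∘ t := by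
  have hωS := Finset.mem_insert_self ω S
  choose z' hz' using hz
  have hz'' : (y (e + 1)) ∘ z' = bdry S (x (e + 1)) z := funext hz'
  have hinj' : ∀ {e : ℕ} {c : Finset ι → V (e + 1)}, (y (e + 1)) ∘ c = 0 → c = 0 := by
    intro e c hc
    funext B
    exact hinj e (by simpa using congrFun hc B)
  have hz'ω : contract K ω z' = 0 := by
    apply hinj'
    rw [← contract_comp, hz'', contract_bdry, hzω, map_zero, neg_zero]
  have hz'0 : bdry S (x (e + 1)) z' = 0 := by
    apply hinj'
    rw [← bdry_comp (x' := x (e + 1 + 1)) (y (e + 1)) (y (e + 1 + 1)) (fun v _ m => hxy _ v m), hz'',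
      bdry_bdry _ _ _ (hx _)]
  have hcycle : bdry (insert ω S) (x (e + 1)) (z - wedgeSum (insert ω S) a z') = 0 := by
    rw [map_sub, bdry_wedgeSum, ← hy, bdry_insert hω _ hzω, bdry_insert hω _ hz'ω, hz'0, hz'']
    simp
  obtain ⟨u, hu⟩ := h e _ hcycle
  have hz1 : contract K ω (z - wedgeSum (insert ω S) a z') = -z' := by
    rw [map_sub, hzω, contract_wedgeSum hωS haω, hz'ω]; simp
  refine ⟨u - wedgeSum (insert ω S) a (contract K ω u), contract K ω u, ?_⟩
  rw [← bdry_insert hω, map_sub, bdry_wedgeSum, ← hy, hu]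
  · have : bdry (insert ω S) (x e) (contract K ω u) = z' := by
      rw [bdry_contract, hu, hz1, neg_neg]
    rw [this]
    abel
  · rw [map_sub, contract_wedgeSum hωS haω, contract_contract_self]; simp

/-- Modulo y the variable ω is a combination of the others, so one variable fewer suffices. Chains
are still indexed by sets that may contain ω, on which the differential over `S` acts inertly; hence
a cycle is split into its parts with and without ω, and each is lifted separately. -/
theorem IsLinear.quotient {S : Finset ι} {ω : ι} (hω : ω ∉ S) {a : ι → K}
    (haω : a ω = 1) (hx : ∀ e v w m, x (e + 1) v (x e w m) = x (e + 1) w (x e v m))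
    (hy : ∀ e, y e = ∑ v ∈ insert ω S, a v • x e v)
    (hxy : ∀ e v a, x (e + 1) v (y e a) = y (e + 1) (x e v a))
    (hinj : ∀ e, Function.Injective (y (e + 1))) (h : IsLinear (insert ω S) x) :
    IsLinear S (quotientOperators hxy hinj) := by
  have key : ∀ e (z : Finset ι → V (e + 1)), contract K ω z = 0 →
      (∀ B, bdry S (x (e + 1)) z B ∈ LinearMap.range (y (e + 1))) →
      ∃ u, bdry S (quotientOperators hxy hinj e) u =
        (multiplesSubmodule y (e + 1)).mkQ ∘ z := by
    intro e z hzω hz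
    obtain ⟨u, t, rfl⟩ :=
      h.exists_lift_of_contract_eq_zero hω haω hx hy hxy hinj hzω hz
    refine ⟨(multiplesSubmodule y e).mkQ ∘ u, ?_⟩
    rw [bdry_comp (multiplesSubmodule y e).mkQ (multiplesSubmodule y (e + 1)).mkQ
      (fun v _ m => rfl)]
    funext B
    simp only [Function.comp_apply, Pi.add_apply, map_add, left_eq_add]
    exact (Submodule.Quotient.mk_eq_zero _).mpr ⟨t B, rfl⟩
  intro e z hz
  choose z₁ hz₁ using fun B => (multiplesSubmodule y (e + 1)).mkQ_surjective (z B)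
  obtain rfl : (multiplesSubmodule y (e + 1)).mkQ ∘ z₁ = z := funext hz₁
  rw [bdry_comp (multiplesSubmodule y (e + 1)).mkQ (multiplesSubmodule y (e + 1 + 1)).mkQ
      (fun v _ m => rfl)] at hz
  have hmem : ∀ B, bdry S (x (e + 1)) z₁ B ∈ LinearMap.range (y (e + 1)) := fun B =>
    (Submodule.Quotient.mk_eq_zero (multiplesSubmodule y (e + 1 + 1))).mp (congrFun hz B)
  choose t ht using hmem
  have ht' : bdry S (x (e + 1)) z₁ = (y (e + 1)) ∘ t := (funext ht).symm
  obtain ⟨b, hb⟩ := key e (contract K ω z₁) (contract_contract_self ω z₁) (by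
    intro B
    rw [bdry_contract, ht', contract_comp]
    exact ⟨-contract K ω t B, by simp⟩)
  obtain ⟨c, hc⟩ := key e (contract K ω (wedge K ω z₁)) (contract_contract_self ω _) (by
    intro B
    rw [bdry_contract, bdry_wedge, if_neg hω, ht', wedge_comp,
      zero_sub, map_neg, neg_neg, contract_comp]
    exact ⟨_, rfl⟩)
  refine ⟨c - wedge K ω b, ?_⟩
  rw [map_sub, hc, bdry_wedge, if_neg hω, hb, zero_sub, sub_neg_eq_add, ← contract_comp,
    ← wedge_comp, ← contract_comp, contract_wedge_self]

end LinearModules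

end BettiPowers

noncomputable section

namespace BettiPowers

/-! ### A generic linear form over the rational function field -/

section GenericLinearForm

universe u w

variable {ι : Type w} {K : Type u} [Field K] {V : ℕ → Type u}
  [∀ e, AddCommGroup (V e)] [∀ e, Module K (V e)]

open TensorProduct

/-- The generic linear form `∑ T ^ f v * x v` is a nonzerodivisor on polynomials in `T` with
coefficients in a graded module without elements killed by all `x v` in positive degree. -/
theorem eq_zero_of_generic_mul_eq_zero {S : Finset ι} {x : (e : ℕ) → ι → V e →ₗ[K] V (e + 1)}
    (hx : ∀ e v w m, x (e + 1) v (x e w m) = x (e + 1) w (x e v m)) {f : ι → ℕ}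
    (hf : Function.Injective f)
    (hsoc : ∀ e (m : V (e + 1)), (∀ v ∈ S, x (e + 1) v m = 0) → m = 0) (N : ℕ) :
    ∀ (e : ℕ) (g : ℕ → V (e + 1)), (∀ j, N ≤ j → g j = 0) →
      (∀ j, ∑ v ∈ S, (if f v ≤ j then x (e + 1) v (g (j - f v)) else 0) = 0) → ∀ j, g j = 0 := by
  induction N with
  | zero => intro e g hg _ j; exact hg j (Nat.zero_le j)
  | succ N ih =>
    intro e g hg hfg j
    refine hsoc e _ ?_
    by_contra! hcon
    obtain ⟨v₀, hv₀, hv₀'⟩ := hcon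
    classical
    -- Among the variables acting non-trivially on some coefficient of g, the one with the largest
    -- exponent isolates x_v g_N in the coefficient of T^(f v + N).
    obtain ⟨v, hv, hmax⟩ := Finset.exists_max_image (S.filter fun v => ∃ j, x (e + 1) v (g j) ≠ 0) f
      ⟨v₀, Finset.mem_filter.mpr ⟨hv₀, j, hv₀'⟩⟩
    obtain ⟨hvS, i, hi⟩ := Finset.mem_filter.mp hv
    have hzero : ∀ w ∈ S, f v < f w → ∀ j, x (e + 1) w (g j) = 0 := by
      intro w hw hvw j
      by_contra hne
      exact absurd (hmax w (Finset.mem_filter.mpr ⟨hw, j, hne⟩)) (not_le.mpr hvw)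
    have htop : x (e + 1) v (g N) = 0 := by
      have h := hfg (f v + N)
      rw [Finset.sum_eq_single_of_mem v hvS, if_pos (Nat.le_add_right _ _),
        Nat.add_sub_cancel_left] at h
      · exact h
      · intro w hw hwv
        split_ifs with hle
        · rcases lt_or_gt_of_ne (hf.ne hwv) with hlt | hlt
          · rw [hg _ (by omega), map_zero]
          · exact hzero w hw hlt _
        · rfl
    -- x_v·g is again killed by the generic form and has a smaller degree bound in T, so it vanishes
    -- by induction, against the choice of v.
    refine hi (ih (e + 1) (fun j => x (e + 1) v (g j)) ?_ ?_ i)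
    · intro j hj
      rcases hj.eq_or_lt with rfl | hlt
      · exact htop
      · simp only [hg j hlt, map_zero]
    · intro j
      have := congrArg (x (e + 1 + 1) v) (hfg j)
      rw [map_zero, map_sum] at this
      refine Eq.trans (Finset.sum_congr rfl fun w _ => ?_) this
      split_ifs
      · exact hx _ _ _ _
      · rw [map_zero]

/-- `∑ T ^ j ⊗ g j`, as an element of the base change along `K → K(T)`. -/
def polynomialTensor (K : Type u) [Field K] (W : Type u) [AddCommGroup W] [Module K W] :
    (ℕ →₀ W) →ₗ[K] RatFunc K ⊗[K] W :=
  (Finsupp.linearCombination K fun j : ℕ => (RatFunc.X : RatFunc K) ^ j).rTensor W ∘ₗ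
    (TensorProduct.finsuppScalarLeft K W ℕ).symm.toLinearMap

variable {W W' : Type u} [AddCommGroup W] [Module K W] [AddCommGroup W'] [Module K W']

theorem polynomialTensor_single (j : ℕ) (m : W) :
    polynomialTensor K W (Finsupp.single j m) = ((RatFunc.X : RatFunc K) ^ j) ⊗ₜ m := by
  simp [polynomialTensor, TensorProduct.finsuppScalarLeft_symm_apply_single]

theorem linearIndependent_ratFunc_X_pow :
    LinearIndependent K fun j : ℕ => (RatFunc.X : RatFunc K) ^ j := by
  have h := (Polynomial.basisMonomials K).linearIndependent.map_injOn
    (IsScalarTower.toAlgHom K (Polynomial K) (RatFunc K)).toLinearMap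
    (RatFunc.algebraMap_injective K).injOn
  convert h using 1
  funext j
  simp [← Polynomial.X_pow_eq_monomial]

theorem polynomialTensor_injective : Function.Injective (polynomialTensor K W) := by
  refine (Module.Flat.rTensor_preserves_injective_linearMap _ ?_).comp (LinearEquiv.injective _)
  exact linearIndependent_ratFunc_X_pow

/-- Clear a common denominator of the finitely many coefficients in K(T). -/
theorem exists_smul_mem_range_polynomialTensor (m : RatFunc K ⊗[K] W) :
    ∃ q : RatFunc K, q ≠ 0 ∧ ∃ g, polynomialTensor K W g = q • m := by
  classical
  obtain ⟨s, rfl⟩ := TensorProduct.exists_finset m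
  obtain ⟨q, hq⟩ := IsLocalization.exist_integer_multiples (nonZeroDivisors (Polynomial K)) s
    fun i => i.1
  refine ⟨algebraMap (Polynomial K) (RatFunc K) q,
    RatFunc.algebraMap_ne_zero (nonZeroDivisors.ne_zero q.2), ?_⟩
  rw [Finset.smul_sum]
  refine Submodule.sum_mem (LinearMap.range (polynomialTensor K W)) fun i hi => ?_
  obtain ⟨p, hp⟩ := hq i hi
  rw [TensorProduct.smul_tmul', smul_eq_mul, ← Algebra.smul_def]
  have hp' : algebraMap (Polynomial K) (RatFunc K) p = (q : Polynomial K) • i.1 := hp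
  rw [← hp', Polynomial.as_sum_range_C_mul_X_pow p, map_sum, TensorProduct.sum_tmul]
  refine Submodule.sum_mem _ fun j _ => ⟨Finsupp.single j (p.coeff j • i.2), ?_⟩
  rw [polynomialTensor_single, map_mul, map_pow, RatFunc.algebraMap_C, RatFunc.algebraMap_X,
    TensorProduct.tmul_smul, TensorProduct.smul_tmul']
  congr 1
  rw [← RatFunc.algebraMap_eq_C, Algebra.smul_def]

theorem baseChange_polynomialTensor (φ : W →ₗ[K] W') (i : ℕ) (g : ℕ →₀ W) :
    (RatFunc.X : RatFunc K) ^ i • φ.baseChange (RatFunc K) (polynomialTensor K W g) =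
      polynomialTensor K W' ((g.mapRange φ (map_zero φ)).mapDomain (i + ·)) := by
  induction g using Finsupp.induction_linear with
  | zero => simp
  | add g g' h h' =>
    rw [map_add, map_add, smul_add, h, h', Finsupp.mapRange_add (map_add φ), Finsupp.mapDomain_add,
      map_add]
  | single j m =>
    rw [polynomialTensor_single, LinearMap.baseChange_tmul, Finsupp.mapRange_single,
      Finsupp.mapDomain_single, polynomialTensor_single, TensorProduct.smul_tmul', pow_add,
      smul_eq_mul]

/-- After clearing denominators the claim is the polynomial one, read off coefficient by coefficient
in T. Distinct powers of T as coefficients make the form generic even for finite K. -/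
theorem generic_linearForm_injective {S : Finset ι} {x : (e : ℕ) → ι → V e →ₗ[K] V (e + 1)}
    (hx : ∀ e v w m, x (e + 1) v (x e w m) = x (e + 1) w (x e v m)) {f : ι → ℕ}
    (hf : Function.Injective f)
    (hsoc : ∀ e (m : V (e + 1)), (∀ v ∈ S, x (e + 1) v m = 0) → m = 0) (e : ℕ) :
    Function.Injective
      ⇑(∑ v ∈ S, (RatFunc.X : RatFunc K) ^ f v • (x (e + 1) v).baseChange (RatFunc K)) := by
  rw [injective_iff_map_eq_zero]
  intro m hm
  obtain ⟨q, hq, g, hg⟩ := exists_smul_mem_range_polynomialTensor m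
  have h0 : (∑ v ∈ S, (RatFunc.X : RatFunc K) ^ f v • (x (e + 1) v).baseChange (RatFunc K))
      (polynomialTensor K _ g) = 0 := by
    rw [hg, map_smul, hm, smul_zero]
  rw [LinearMap.sum_apply] at h0
  simp only [LinearMap.smul_apply, baseChange_polynomialTensor] at h0
  rw [← map_sum, map_eq_zero_iff _ polynomialTensor_injective] at h0
  have hg0 : g = 0 := by
    ext j
    refine eq_zero_of_generic_mul_eq_zero hx hf hsoc (g.support.sup id + 1) e g ?_ ?_ j
    · intro j hj
      by_contra hne
      have := Finset.le_sup (f := id) (Finsupp.mem_support_iff.mpr hne)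
      simp only [id] at this
      omega
    · intro j
      have := DFunLike.congr_fun h0 j
      rw [Finsupp.finsetSum_apply] at this
      rw [Finsupp.zero_apply] at this
      refine Eq.trans (Finset.sum_congr rfl fun v _ => ?_) this
      split_ifs with hle
      · obtain ⟨i, rfl⟩ := Nat.exists_eq_add_of_le hle
        rw [Nat.add_sub_cancel_left]
        rw [Finsupp.mapDomain_apply (add_right_injective (f v))]
        simp
      · rw [Finsupp.mapDomain_of_notMem_range]
        rintro ⟨i, hi⟩
        exact hle (hi ▸ Nat.le_add_right _ _)
  rw [hg0, map_zero] at hg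
  exact (smul_eq_zero.mp hg.symm).resolve_left hq

end GenericLinearForm

end BettiPowers

end

noncomputable section

namespace BettiPowers

/-! ### Hilbert series of modules with a linear resolution -/

section HilbertSeries

universe u w

variable {ι : Type w} [LinearOrder ι] [Fintype ι]

open TensorProduct

/-- Field extensions are flat, and tensoring commutes with the finite product over the subsets of
the variables. -/
theorem IsLinear.baseChange {K : Type u} [Field K] {V : ℕ → Type u}
    [∀ e, AddCommGroup (V e)] [∀ e, Module K (V e)] (L : Type u) [Field L] [Algebra K L]
    {S : Finset ι} {x : (e : ℕ) → ι → V e →ₗ[K] V (e + 1)}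
    (hx : ∀ e v w m, x (e + 1) v (x e w m) = x (e + 1) w (x e v m)) (h : IsLinear S x) :
    IsLinear (V := fun e => L ⊗[K] V e) S (fun e v => (x e v).baseChange L) := by
  intro e z hz
  have hexact : Function.Exact (bdry S (x e)) (bdry S (x (e + 1))) := fun c =>
    ⟨h e c, by rintro ⟨u, rfl⟩; exact bdry_bdry S _ _ (hx e) u⟩
  have hL := Module.Flat.lTensor_exact L hexact
  have comm : ∀ e (c : L ⊗[K] (Finset ι → V e)),
      bdry (R := L) S (fun v => (x e v).baseChange L) (piRight K K L (fun _ => V e) c) =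
        piRight K K L (fun _ => V (e + 1)) ((bdry S (x e)).lTensor L c) := by
    intro e c
    induction c using TensorProduct.induction_on with
    | zero => simp
    | add a b ha hb => rw [map_add, map_add, ha, hb, map_add, map_add]
    | tmul l c =>
      funext B
      rw [LinearMap.lTensor_tmul, piRight_apply, piRight_apply, piRightHom_tmul, piRightHom_tmul,
        bdry_apply_apply]
      change _ = l ⊗ₜ[K] bdry S (x e) c B
      rw [bdry_apply_apply, TensorProduct.tmul_sum]
      refine Finset.sum_congr rfl fun v _ => ?_
      by_cases hv : v ∈ B
      · rw [contract_apply_of_mem hv, contract_apply_of_mem hv, map_zero, map_zero,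
          TensorProduct.tmul_zero]
      · rw [contract_apply_of_notMem hv, contract_apply_of_notMem hv, map_zsmul, map_zsmul,
          LinearMap.baseChange_tmul]
        exact (map_zsmul (TensorProduct.mk K L (V (e + 1)) l) _ _).symm
  obtain ⟨c, rfl⟩ := (piRight K K L (fun _ : Finset ι => V (e + 1))).surjective z
  have h0 : (bdry S (x (e + 1))).lTensor L c = 0 := by
    apply (piRight K K L (fun _ : Finset ι => V (e + 1 + 1))).injective
    rw [← comm, map_zero]
    exact hz
  obtain ⟨u, rfl⟩ := (hL c).mp h0
  exact ⟨piRight K K L (fun _ => V e) u, comm e u⟩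

/-- Each dimension drops by the rank of y one degree lower. The only failure of injectivity is in
degree 0: the kernel is lost there and also lowers the rank into degree 1, so it is subtracted
before multiplying by 1 - t. -/
theorem finrank_quotient_multiplesSubmodule {K : Type u} [Field K] {V : ℕ → Type u}
    [∀ e, AddCommGroup (V e)] [∀ e, Module K (V e)] [∀ e, FiniteDimensional K (V e)]
    {y : (e : ℕ) → V e →ₗ[K] V (e + 1)} (hinj : ∀ e, Function.Injective (y (e + 1))) :
    PowerSeries.mk (fun e => (Module.finrank K (V e ⧸ multiplesSubmodule y e) : ℤ)) =
      (1 - PowerSeries.X) * (PowerSeries.mk (fun e => (Module.finrank K (V e) : ℤ)) -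
        (Module.finrank K (LinearMap.ker (y 0)) : PowerSeries ℤ)) := by
  have hC : (Module.finrank K (LinearMap.ker (y 0)) : PowerSeries ℤ) =
      PowerSeries.C (Module.finrank K (LinearMap.ker (y 0)) : ℤ) := by simp
  rw [hC]
  ext e
  have hq := (multiplesSubmodule y e).finrank_quotient_add_finrank
  rw [sub_mul, one_mul, map_sub]
  match e with
  | 0 =>
    have : multiplesSubmodule y 0 = LinearMap.ker (y 0) := rfl
    rw [this] at hq
    simp only [PowerSeries.coeff_mk, PowerSeries.coeff_zero_X_mul, map_sub,
      PowerSeries.coeff_zero_C]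
    rw [this]
    omega
  | e + 1 =>
    have : multiplesSubmodule y (e + 1) = LinearMap.range (y e) := rfl
    rw [this] at hq
    have hr := (y e).finrank_range_add_finrank_ker
    rw [PowerSeries.coeff_succ_X_mul]
    simp only [PowerSeries.coeff_mk, map_sub]
    rw [this]
    match e with
    | 0 =>
      simp only [PowerSeries.coeff_C, zero_add, one_ne_zero, if_false, if_true] at *
      omega
    | e + 1 =>
      rw [LinearMap.ker_eq_bot.mpr (hinj e), finrank_bot] at hr
      simp only [PowerSeries.coeff_C, Nat.add_eq_zero_iff, one_ne_zero, and_false, if_false]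
      omega

/-- The Hilbert series of a module with a linear resolution is a non-negative combination of the
Hilbert series `1 / (1 - t) ^ j` of polynomial rings. -/
theorem IsLinear.exists_hilbertSeries (s : ℕ) :
    ∀ (K : Type u) [Field K] (V : ℕ → Type u) [∀ e, AddCommGroup (V e)] [∀ e, Module K (V e)]
      [∀ e, FiniteDimensional K (V e)] (S : Finset ι) (x : (e : ℕ) → ι → V e →ₗ[K] V (e + 1)),
      S.card = s → (∀ e v w m, x (e + 1) v (x e w m) = x (e + 1) w (x e v m)) → IsLinear S x →
      ∃ γ : ℕ → ℕ, (1 - PowerSeries.X) ^ s *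
          PowerSeries.mk (fun e => (Module.finrank K (V e) : ℤ)) =
        ∑ j ∈ Finset.range (s + 1), (γ j : PowerSeries ℤ) * (1 - PowerSeries.X) ^ (s - j) := by
  induction s with
  | zero =>
    intro K _ V _ _ _ S x hS hx h
    rw [Finset.card_eq_zero] at hS
    subst hS
    have h0 : ∀ e, Module.finrank K (V (e + 1)) = 0 := by
      intro e
      have : Subsingleton (V (e + 1)) := subsingleton_of_forall_eq 0 fun m =>
        h.eq_zero_of_forall_mul_eq_zero (by simp)
      exact Module.finrank_zero_of_subsingleton
    refine ⟨fun _ => Module.finrank K (V 0), ?_⟩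
    simp only [pow_zero, one_mul, zero_add, Finset.range_one, Finset.sum_singleton, Nat.sub_self,
      mul_one]
    have hC : (Module.finrank K (V 0) : PowerSeries ℤ) =
      PowerSeries.C (Module.finrank K (V 0) : ℤ) := by simp
    rw [hC]
    ext e
    match e with
    | 0 => simp
    | e + 1 => rw [PowerSeries.coeff_mk, h0, PowerSeries.coeff_C]; simp
  | succ s ih =>
    intro K _ V _ _ _ S x hS hx h
    classical
    obtain ⟨ω, S', hω, rfl, hS'⟩ := Finset.card_eq_succ.mp hS
    -- The induction quantifies over all fields, so passing to K(T), which leaves the dimensions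
    -- unchanged, is allowed.
    let L := RatFunc K
    let f : ι → ℕ := fun v => (Fintype.equivFin ι v : ℕ)
    have hf : Function.Injective f := Fin.val_injective.comp (Equiv.injective _)
    have hX : (RatFunc.X : L) ≠ 0 := RatFunc.X_ne_zero
    -- The generic form is scaled to have coefficient 1 at the variable ω to be eliminated.
    let a : ι → L := fun v => RatFunc.X ^ f v / RatFunc.X ^ f ω
    let xL : (e : ℕ) → ι → L ⊗[K] V e →ₗ[L] L ⊗[K] V (e + 1) := fun e v => (x e v).baseChange L
    let y : (e : ℕ) → L ⊗[K] V e →ₗ[L] L ⊗[K] V (e + 1) := fun e =>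
      ∑ v ∈ insert ω S', a v • xL e v
    have hxL : ∀ e v w m, xL (e + 1) v (xL e w m) = xL (e + 1) w (xL e v m) := by
      intro e v w m
      induction m using TensorProduct.induction_on with
      | zero => simp
      | add a b ha hb => simp only [map_add, ha, hb]
      | tmul l m => simp only [xL, LinearMap.baseChange_tmul, hx e v w m]
    have hxy : ∀ e v m, xL (e + 1) v (y e m) = y (e + 1) (xL e v m) := by
      intro e v m
      simp only [y, LinearMap.sum_apply, LinearMap.smul_apply, map_sum, map_smul, hxL e v]
    have hinj : ∀ e, Function.Injective (y (e + 1)) := by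
      intro e
      have h1 := generic_linearForm_injective hx hf
        (fun e m hm => h.eq_zero_of_forall_mul_eq_zero (e := e) hm) e
      have h2 : y (e + 1) = (RatFunc.X ^ f ω : L)⁻¹ •
          ∑ v ∈ insert ω S', (RatFunc.X : L) ^ f v • xL (e + 1) v := by
        rw [Finset.smul_sum]
        refine Finset.sum_congr rfl fun v _ => ?_
        rw [smul_smul, inv_mul_eq_div]
      rw [h2]
      intro m m' hm
      apply h1
      exact smul_right_injective _ (inv_ne_zero (pow_ne_zero _ hX)) hm
    have hlin := (h.baseChange L hx).quotient hω (a := a) (div_self (pow_ne_zero _ hX)) hxL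
      (fun _ => rfl) hxy hinj
    obtain ⟨γ, hγ⟩ := ih L (fun e => (L ⊗[K] V e) ⧸ multiplesSubmodule y e) S' _ hS' (by
      intro e v w m
      obtain ⟨m, rfl⟩ := Submodule.mkQ_surjective _ m
      exact congrArg (multiplesSubmodule y (e + 1 + 1)).mkQ (hxL e v w m)) hlin
    rw [finrank_quotient_multiplesSubmodule hinj] at hγ
    simp only [Module.finrank_baseChange] at hγ
    -- With κ the dimension of the kernel of y in degree 0 and Q the quotient, H_V = κ + H_Q/(1-t):
    -- κ is the new coefficient at j = 0 and the others move up by one.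
    refine ⟨fun j => Nat.casesOn j (Module.finrank L (LinearMap.ker (y 0))) γ, ?_⟩
    rw [Finset.sum_range_succ']
    simp only [Nat.add_sub_add_right, Nat.sub_zero]
    rw [← hγ]
    change _ = _ + (Module.finrank L (LinearMap.ker (y 0)) : PowerSeries ℤ) * _
    ring

end HilbertSeries

end BettiPowers

end

noncomputable section

namespace BettiPowers

open MvPolynomial

/-! ### Monomial subquotients of the polynomial ring -/

section MonomialModules

universe u

variable {K : Type u} [Field K] {n : ℕ}

theorem isHomogeneous_iff_degree {p : MvPolynomial (Fin n) K} {e : ℕ} :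
    p.IsHomogeneous e ↔ ∀ u, coeff u p ≠ 0 → u.degree = e := by
  rw [← mem_homogeneousSubmodule, homogeneousSubmodule_eq_finsupp_supported]
  exact ⟨fun h _ hu => h (mem_support_iff.mpr hu), fun h u hu => h u (mem_support_iff.mp hu)⟩

theorem mem_restrictSupport_iff_coeff {Y : Set (Fin n →₀ ℕ)} {p : MvPolynomial (Fin n) K} :
    p ∈ restrictSupport K Y ↔ ∀ u, coeff u p ≠ 0 → u ∈ Y :=
  ⟨fun h _ hu => h (mem_support_iff.mpr hu), fun h u hu => h u (mem_support_iff.mp hu)⟩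

theorem exists_of_coeff_X_mul_ne_zero {v : Fin n} {p : MvPolynomial (Fin n) K} {u : Fin n →₀ ℕ}
    (h : coeff u (X v * p) ≠ 0) : ∃ u₀, u = Finsupp.single v 1 + u₀ ∧ coeff u₀ p ≠ 0 := by
  classical
  rw [coeff_X_mul'] at h
  split_ifs at h with hv
  · refine ⟨u - Finsupp.single v 1, ?_, h⟩
    rw [add_tsub_cancel_of_le]
    rw [Finsupp.single_le_iff]
    exact Nat.one_le_iff_ne_zero.mpr (Finsupp.mem_support_iff.mp hv)
  · exact absurd rfl h

open Classical in
/-- The sum of the terms of a polynomial with exponents in `Y`. -/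
def termsIn (Y : Set (Fin n →₀ ℕ)) : MvPolynomial (Fin n) K →ₗ[K] MvPolynomial (Fin n) K :=
  have hcoeff : ∀ (p : MvPolynomial (Fin n) K) w,
      coeff w (∑ u ∈ p.support with u ∈ Y, monomial u (coeff u p)) =
        if w ∈ Y then coeff w p else 0 := by
    intro p w
    rw [coeff_sum]
    simp only [coeff_monomial, Finset.sum_ite_eq', Finset.mem_filter, mem_support_iff]
    by_cases hw : w ∈ Y <;> by_cases hp : coeff w p = 0 <;> simp [hw, hp]
  { toFun := fun p => ∑ u ∈ p.support with u ∈ Y, monomial u (coeff u p)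
    map_add' := fun p q => by
      ext w
      rw [coeff_add, hcoeff, hcoeff, hcoeff]
      split_ifs <;> simp
    map_smul' := fun r p => by
      ext w
      rw [RingHom.id_apply, coeff_smul, hcoeff, hcoeff]
      split_ifs <;> simp }

open Classical in
theorem coeff_termsIn (Y : Set (Fin n →₀ ℕ)) (p : MvPolynomial (Fin n) K) (w : Fin n →₀ ℕ) :
    coeff w (termsIn Y p) = if w ∈ Y then coeff w p else 0 := by
  change coeff w (∑ u ∈ p.support with u ∈ Y, monomial u (coeff u p)) = _
  rw [coeff_sum]
  simp only [coeff_monomial, Finset.sum_ite_eq', Finset.mem_filter, mem_support_iff]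
  by_cases hw : w ∈ Y <;> by_cases hp : coeff w p = 0 <;> simp [hw, hp]

theorem coeff_termsIn_of_mem {Y : Set (Fin n →₀ ℕ)} (p : MvPolynomial (Fin n) K)
    {w : Fin n →₀ ℕ} (hw : w ∈ Y) : coeff w (termsIn Y p) = coeff w p := by
  rw [coeff_termsIn, if_pos hw]

theorem coeff_termsIn_of_notMem {Y : Set (Fin n →₀ ℕ)} (p : MvPolynomial (Fin n) K)
    {w : Fin n →₀ ℕ} (hw : w ∉ Y) : coeff w (termsIn Y p) = 0 := by
  rw [coeff_termsIn, if_neg hw]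

theorem termsIn_eq_self {Y : Set (Fin n →₀ ℕ)} {p : MvPolynomial (Fin n) K}
    (h : ∀ u, coeff u p ≠ 0 → u ∈ Y) : termsIn Y p = p := by
  ext w
  by_cases hw : w ∈ Y
  · exact coeff_termsIn_of_mem p hw
  · rw [coeff_termsIn_of_notMem p hw]
    by_contra hne
    exact hw (h w (Ne.symm hne))

theorem termsIn_eq_zero_iff {Y : Set (Fin n →₀ ℕ)} {p : MvPolynomial (Fin n) K} :
    termsIn Y p = 0 ↔ ∀ u ∈ Y, coeff u p = 0 := by
  constructor
  · intro h u hu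
    rw [← coeff_termsIn_of_mem p hu, h, coeff_zero]
  · intro h
    ext w
    by_cases hw : w ∈ Y
    · rw [coeff_termsIn_of_mem p hw, h w hw, coeff_zero]
    · rw [coeff_termsIn_of_notMem p hw, coeff_zero]

/-- The exponents of degree `D + e` in `Y`. -/
def exponentsOfDegree (Y : Set (Fin n →₀ ℕ)) (e : ℕ) : Set (Fin n →₀ ℕ) :=
  {u | u ∈ Y ∧ u.degree = e}

theorem exponentsOfDegree_finite (Y : Set (Fin n →₀ ℕ)) (e : ℕ) :
    (exponentsOfDegree Y e).Finite :=
  (Finsupp.finite_of_degree_eq e).subset fun _ hu => hu.2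

/-- The number of exponents of degree `e` in `Y`. -/
def hilb (Y : Set (Fin n →₀ ℕ)) (e : ℕ) : ℕ := (exponentsOfDegree Y e).ncard

instance (Y : Set (Fin n →₀ ℕ)) (e : ℕ) : Finite (exponentsOfDegree Y e) :=
  (exponentsOfDegree_finite Y e).to_subtype

instance (Y : Set (Fin n →₀ ℕ)) (e : ℕ) :
    FiniteDimensional K (restrictSupport K (exponentsOfDegree Y e)) :=
  Module.Finite.of_basis (basisRestrictSupport K (exponentsOfDegree Y e))

theorem finrank_restrictSupport_exponentsOfDegree (Y : Set (Fin n →₀ ℕ)) (e : ℕ) :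
    Module.finrank K (restrictSupport K (exponentsOfDegree Y e)) = hilb Y e := by
  rw [Module.finrank_eq_nat_card_basis (basisRestrictSupport K (exponentsOfDegree Y e))]
  rfl

variable (K) in
/-- The degree `D + e` part of the monomial subquotient of the polynomial ring spanned by the
monomials with exponents in `Y`. -/
abbrev MonomialPart (Y : Set (Fin n →₀ ℕ)) (D e : ℕ) : Type u :=
  restrictSupport K (exponentsOfDegree Y (D + e))

variable (K) in
/-- Multiplication by a variable on the monomial subquotient spanned by `Y`. -/
def monomialOperator (Y : Set (Fin n →₀ ℕ)) (D e : ℕ) (v : Fin n) :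
    MonomialPart K Y D e →ₗ[K] MonomialPart K Y D (e + 1) :=
  LinearMap.codRestrict _
    (termsIn Y ∘ₗ LinearMap.mulLeft K (X v) ∘ₗ Submodule.subtype _) (by
      intro p
      rw [mem_restrictSupport_iff_coeff]
      intro u hu
      by_cases huY : u ∈ Y
      · refine ⟨huY, ?_⟩
        rw [LinearMap.comp_apply, coeff_termsIn_of_mem _ huY] at hu
        obtain ⟨u₀, rfl, hu₀⟩ := exists_of_coeff_X_mul_ne_zero hu
        have := (mem_restrictSupport_iff_coeff.mp p.2 u₀ hu₀).2
        rw [map_add, Finsupp.degree_single, this]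
        omega
      · exact absurd (coeff_termsIn_of_notMem _ huY) hu)

theorem coe_monomialOperator (Y : Set (Fin n →₀ ℕ)) (D e : ℕ) (v : Fin n)
    (p : MonomialPart K Y D e) :
    (monomialOperator K Y D e v p : MvPolynomial (Fin n) K) =
      termsIn Y (X v * (p : MvPolynomial (Fin n) K)) := rfl

/-- A term dropped by the inner truncation lies above an element of `Y`. If its multiple by x_v were
in `Y`, order-convexity would put the term itself into `Y`. This makes the truncated multiplications
commute. -/
theorem termsIn_X_mul_termsIn {Y : Set (Fin n →₀ ℕ)} (hY : Y.OrdConnected) (v : Fin n)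
    {q : MvPolynomial (Fin n) K} (hq : ∀ u, coeff u q ≠ 0 → ∃ u₀ ∈ Y, u₀ ≤ u) :
    termsIn Y (X v * termsIn Y q) = termsIn Y (X v * q) := by
  rw [← sub_eq_zero, ← map_sub, ← mul_sub, termsIn_eq_zero_iff]
  intro u hu
  by_contra hne
  obtain ⟨u₁, rfl, hu₁⟩ := exists_of_coeff_X_mul_ne_zero hne
  rw [coeff_sub] at hu₁
  by_cases h1 : u₁ ∈ Y
  · exact hu₁ (by rw [coeff_termsIn_of_mem _ h1, sub_self])
  · rw [coeff_termsIn_of_notMem _ h1, zero_sub, neg_ne_zero] at hu₁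
    obtain ⟨u₀, hu₀, hle⟩ := hq u₁ hu₁
    exact h1 (hY.out hu₀ hu ⟨hle, le_add_self⟩)

theorem monomialOperator_comm {Y : Set (Fin n →₀ ℕ)} (hY : Y.OrdConnected) (D e : ℕ)
    (v w : Fin n) (p : MonomialPart K Y D e) :
    monomialOperator K Y D (e + 1) v (monomialOperator K Y D e w p) =
      monomialOperator K Y D (e + 1) w (monomialOperator K Y D e v p) := by
  apply Subtype.ext
  have hp : ∀ (w : Fin n) u, coeff u (X w * (p : MvPolynomial (Fin n) K)) ≠ 0 →
      ∃ u₀ ∈ Y, u₀ ≤ u := by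
    intro w u hu
    obtain ⟨u₁, rfl, hu₁⟩ := exists_of_coeff_X_mul_ne_zero hu
    exact ⟨u₁, (mem_restrictSupport_iff_coeff.mp p.2 u₁ hu₁).1, le_add_self⟩
  simp only [coe_monomialOperator]
  rw [termsIn_X_mul_termsIn hY v (hp w), termsIn_X_mul_termsIn hY w (hp v), mul_left_comm]

variable (K n) in
/-- The Koszul differential of the polynomial ring. -/
def polyBdry : (Finset (Fin n) → MvPolynomial (Fin n) K) →ₗ[K]
    (Finset (Fin n) → MvPolynomial (Fin n) K) :=
  bdry Finset.univ fun v => LinearMap.mulLeft K (X v)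

theorem coe_bdry_monomialOperator (Y : Set (Fin n →₀ ℕ)) (D e : ℕ)
    (c : Finset (Fin n) → MonomialPart K Y D e) (B : Finset (Fin n)) :
    (bdry Finset.univ (monomialOperator K Y D e) c B : MvPolynomial (Fin n) K) =
      termsIn Y (polyBdry K n (fun B => (c B : MvPolynomial (Fin n) K)) B) := by
  rw [bdry_apply_apply, polyBdry, bdry_apply_apply, map_sum, AddSubmonoidClass.coe_finsetSum]
  refine Finset.sum_congr rfl fun v _ => ?_
  rw [coe_monomialOperator]
  have := congrFun (contract_comp (Submodule.subtype
    (restrictSupport K (exponentsOfDegree Y (D + e)))) v c) B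
  rw [LinearMap.mulLeft_apply]
  exact congrArg (fun q => termsIn Y (X v * q)) this.symm

theorem exists_of_coeff_polyBdry_ne_zero {c : Finset (Fin n) → MvPolynomial (Fin n) K}
    {B : Finset (Fin n)} {u : Fin n →₀ ℕ} (h : coeff u (polyBdry K n c B) ≠ 0) :
    ∃ v u₀ A, u = Finsupp.single v 1 + u₀ ∧ coeff u₀ (c A) ≠ 0 := by
  rw [polyBdry, bdry_apply_apply, coeff_sum] at h
  obtain ⟨v, _, hv⟩ := Finset.exists_ne_zero_of_sum_ne_zero h
  obtain ⟨u₀, rfl, hu₀⟩ := exists_of_coeff_X_mul_ne_zero hv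
  refine ⟨v, u₀, insert v B, rfl, fun h0 => hu₀ ?_⟩
  by_cases hvB : v ∈ B
  · rw [contract_apply_of_mem hvB, coeff_zero]
  · rw [contract_apply_of_notMem hvB, coeff_smul, h0, smul_zero]

/-- The Koszul homology of `S / J` vanishes for coefficients of degree at least `D`. -/
def KoszulExactFrom (J : Ideal (MvPolynomial (Fin n) K)) (D : ℕ) : Prop :=
  ∀ e, D ≤ e + 1 → ∀ c : Finset (Fin n) → MvPolynomial (Fin n) K,
    (∀ B, (c B).IsHomogeneous (e + 1)) → (∀ B, polyBdry K n c B ∈ J) →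
    ∃ b : Finset (Fin n) → MvPolynomial (Fin n) K,
      (∀ B, (b B).IsHomogeneous e) ∧ ∀ B, c B - polyBdry K n b B ∈ J

/-- `J` is the monomial ideal spanned by the monomials with exponents in `U`. -/
def IsMonomialIdealOf (J : Ideal (MvPolynomial (Fin n) K)) (U : Set (Fin n →₀ ℕ)) : Prop :=
  IsUpperSet U ∧ ∀ p, p ∈ J ↔ ∀ u, coeff u p ≠ 0 → u ∈ U

variable {J : Ideal (MvPolynomial (Fin n) K)} {U : Set (Fin n →₀ ℕ)} {D : ℕ}

theorem polyBdry_mem {c : Finset (Fin n) → MvPolynomial (Fin n) K} (hc : ∀ B, c B ∈ J)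
    (B : Finset (Fin n)) : polyBdry K n c B ∈ J := by
  rw [polyBdry, bdry_apply_apply]
  refine Submodule.sum_mem _ fun v _ => ?_
  rw [LinearMap.mulLeft_apply]
  refine Ideal.mul_mem_left _ _ ?_
  by_cases hvB : v ∈ B
  · rw [contract_apply_of_mem hvB]; exact Submodule.zero_mem _
  · rw [contract_apply_of_notMem hvB]; exact zsmul_mem (hc _) _

theorem sub_termsIn_mem {Y : Set (Fin n →₀ ℕ)} (hJ : IsMonomialIdealOf J U)
    {p : MvPolynomial (Fin n) K} (h : ∀ u, coeff u p ≠ 0 → u ∉ Y → u ∈ U) :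
    p - termsIn Y p ∈ J := by
  rw [hJ.2]
  intro u hu
  rw [coeff_sub] at hu
  by_cases huY : u ∈ Y
  · rw [coeff_termsIn_of_mem _ huY, sub_self] at hu; exact absurd rfl hu
  · rw [coeff_termsIn_of_notMem _ huY, sub_zero] at hu
    exact h u hu huY

/-- The truncation of `S / J` in degrees `≥ D - 1` has a linear resolution. -/
theorem KoszulExactFrom.isLinear_quotient (hJ : IsMonomialIdealOf J U)
    (h : KoszulExactFrom J (D + 1)) :
    IsLinear Finset.univ (monomialOperator K Uᶜ D) := by
  intro e z hz
  have hcoe : ∀ B, (z B : MvPolynomial (Fin n) K).IsHomogeneous (D + e + 1) := fun B =>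
    isHomogeneous_iff_degree.mpr fun u hu => (mem_restrictSupport_iff_coeff.mp (z B).2 u hu).2
  obtain ⟨b, hb, hzb⟩ := h (D + e) (by omega) (fun B => z B) hcoe (by
    intro B
    rw [hJ.2]
    intro u hu
    by_contra huU
    refine hu ((termsIn_eq_zero_iff (Y := Uᶜ)).mp ?_ u huU)
    rw [← coe_bdry_monomialOperator, hz]; rfl)
  -- The terms of b that are discarded lie in `J`, so they do not affect the boundary modulo `J`.
  refine ⟨fun B => ⟨termsIn Uᶜ (b B), ?_⟩, ?_⟩
  · rw [mem_restrictSupport_iff_coeff]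
    intro u hu
    by_cases huU : u ∈ Uᶜ
    · rw [coeff_termsIn_of_mem _ huU] at hu
      exact ⟨huU, isHomogeneous_iff_degree.mp (hb B) u hu⟩
    · exact absurd (coeff_termsIn_of_notMem _ huU) hu
  · funext B
    apply Subtype.ext
    rw [coe_bdry_monomialOperator]
    have hz' : termsIn Uᶜ (z B : MvPolynomial (Fin n) K) = z B :=
      termsIn_eq_self fun u hu => (mem_restrictSupport_iff_coeff.mp (z B).2 u hu).1
    rw [← hz', ← sub_eq_zero, ← map_sub, termsIn_eq_zero_iff]
    intro u hu
    by_contra hne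
    refine hu ((hJ.2 _).mp ?_ u hne)
    have h1 : polyBdry K n (fun B => b B - termsIn Uᶜ (b B)) B ∈ J :=
      polyBdry_mem (fun A => sub_termsIn_mem hJ fun u _ hu' => not_not.mp hu') B
    have h2 : polyBdry K n (fun B => b B - termsIn Uᶜ (b B)) B =
        polyBdry K n b B - polyBdry K n (fun B => termsIn Uᶜ (b B)) B :=
      congrFun (map_sub (polyBdry K n) b fun B => termsIn Uᶜ (b B)) B
    rw [h2] at h1
    have h3 := J.neg_mem (J.add_mem h1 (hzb B))
    convert h3 using 1
    ring

/-- The exponents in the ideal generated by the monomials in `U` of degree `< c` in `v`. -/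
def generatedBelow (U : Set (Fin n →₀ ℕ)) (v : Fin n) (c : ℕ) : Set (Fin n →₀ ℕ) :=
  {u | ∃ u₀ ∈ U, u₀ ≤ u ∧ u₀ v < c}

theorem generatedBelow_subset (hU : IsUpperSet U) (v : Fin n) (c : ℕ) :
    generatedBelow U v c ⊆ U := by
  rintro u ⟨u₀, h₀, hle, -⟩
  exact hU hle h₀

theorem isUpperSet_generatedBelow (v : Fin n) (c : ℕ) : IsUpperSet (generatedBelow U v c) := by
  rintro u u' huu' ⟨u₀, h₀, hle, hc⟩
  exact ⟨u₀, h₀, hle.trans huu', hc⟩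

/-- A witness below x_v·u has degree at most c - 1 ≤ u v in x_v, so it already lies below u.
Division by x_v thus does not leave the ideal in this range. -/
theorem mem_generatedBelow_of_single_add {v : Fin n} {c : ℕ} {u : Fin n →₀ ℕ} (hc : c ≤ u v + 1)
    (h : Finsupp.single v 1 + u ∈ generatedBelow U v c) : u ∈ generatedBelow U v c := by
  obtain ⟨u₀, h₀, hle, hlt⟩ := h
  refine ⟨u₀, h₀, fun w => ?_, hlt⟩
  have := hle w
  rcases eq_or_ne w v with rfl | hwv
  · omega
  · simpa [Finsupp.single_apply, hwv.symm] using this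

theorem le_apply_of_mem_diff_generatedBelow {v : Fin n} {c : ℕ} {u : Fin n →₀ ℕ}
    (hu : u ∈ U \ generatedBelow U v c) : c ≤ u v := by
  by_contra! hlt
  exact hu.2 ⟨u, hu.1, le_rfl, hlt⟩

theorem ordConnected_diff {U' : Set (Fin n →₀ ℕ)} (hU : IsUpperSet U) (hU' : IsUpperSet U') :
    (U \ U').OrdConnected :=
  ⟨fun _ ha _ hb _ hc => ⟨hU hc.1 ha.1, fun h => hb.2 (hU' hc.2 h)⟩⟩

theorem X_dvd_of_forall_one_le {v : Fin n} {p : MvPolynomial (Fin n) K}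
    (h : ∀ u, coeff u p ≠ 0 → 1 ≤ u v) : X v ∣ p := by
  rw [X_dvd_iff_modMonomial_eq_zero]
  ext u
  rw [coeff_zero]
  by_cases hu : Finsupp.single v 1 ≤ u
  · exact coeff_modMonomial_of_le _ hu
  · rw [coeff_modMonomial_of_not_le _ hu]
    by_contra hne
    exact hu (Finsupp.single_le_iff.mpr (h u hne))

/-- The quotient of `J` by the ideal of its monomials of degree `< c` in `v` has a linear
resolution. -/
theorem KoszulExactFrom.isLinear_diff (hJ : IsMonomialIdealOf J U) (hD : 1 ≤ D)
    (h : KoszulExactFrom J D) (v : Fin n) {c : ℕ} (hc : 1 ≤ c) :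
    IsLinear Finset.univ (monomialOperator K (U \ generatedBelow U v c) D) := by
  set U' := generatedBelow U v c with hU'def
  have hU' : IsUpperSet U' := isUpperSet_generatedBelow v c
  let J' : Ideal (MvPolynomial (Fin n) K) := restrictSupportIdeal K U' hU'
  have hJ' : IsMonomialIdealOf J' U' := ⟨hU', fun p => mem_restrictSupport_iff_coeff⟩
  have hJ'J : J' ≤ J := fun p hp => (hJ.2 p).mpr fun u hu =>
    generatedBelow_subset hJ.1 v c ((hJ'.2 p).mp hp u hu)
  intro e z hz
  have hz₁ := fun B => mem_restrictSupport_iff_coeff.mp (z B).2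
  -- The monomials of J outside J' have degree at least c ≥ 1 in x_v, so z = x_v·z'.
  choose z' hz' using fun B => X_dvd_of_forall_one_le (v := v) (p := (z B : MvPolynomial (Fin n) K))
    fun u hu => hc.trans (le_apply_of_mem_diff_generatedBelow (hz₁ B u hu).1)
  have hz'c : ∀ B u, coeff u (z' B) ≠ 0 →
      Finsupp.single v 1 + u ∈ exponentsOfDegree (U \ U') (D + (e + 1)) := by
    intro B u hu
    apply hz₁ B
    rw [hz', coeff_X_mul]
    exact hu
  have hz'deg : ∀ B, (z' B).IsHomogeneous (D + e) := by
    intro B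
    rw [isHomogeneous_iff_degree]
    intro u hu
    have := (hz'c B u hu).2
    rw [map_add, Finsupp.degree_single] at this
    omega
  have hbdry : polyBdry K n (fun B => (z B : MvPolynomial (Fin n) K)) =
      fun B => X v * polyBdry K n z' B := by
    have h1 := bdry_comp (S := (Finset.univ : Finset (Fin n)))
      (x := fun w => LinearMap.mulLeft K (X w : MvPolynomial (Fin n) K))
      (x' := fun w => LinearMap.mulLeft K (X w : MvPolynomial (Fin n) K))
      (LinearMap.mulLeft K (X v)) (LinearMap.mulLeft K (X v))
      (fun w _ a => by simp only [LinearMap.mulLeft_apply]; ring) z'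
    have h2 : (fun B => (z B : MvPolynomial (Fin n) K)) = LinearMap.mulLeft K (X v) ∘ z' :=
      funext hz'
    rw [polyBdry, h2, h1]
    rfl
  -- ∂z = x_v·∂z' has its terms in J', and x_v may be divided out because every term of ∂z' has
  -- degree at least c - 1 in x_v.
  have hz'mem : ∀ B, polyBdry K n z' B ∈ J' := by
    intro B
    rw [hJ'.2]
    intro u hu
    obtain ⟨w, u₀, A, rfl, hu₀⟩ := exists_of_coeff_polyBdry_ne_zero hu
    have hcv := le_apply_of_mem_diff_generatedBelow (hz'c A u₀ hu₀).1
    rw [Finsupp.add_apply, Finsupp.single_eq_same] at hcv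
    refine mem_generatedBelow_of_single_add (by rw [Finsupp.add_apply]; omega) ?_
    have hzero : termsIn (U \ U') (polyBdry K n (fun B => (z B : MvPolynomial (Fin n) K)) B) = 0 := by
      rw [← coe_bdry_monomialOperator, hz]; rfl
    by_contra hnot
    have hmemU : Finsupp.single v 1 + (Finsupp.single w 1 + u₀) ∈ U := by
      refine hJ.1 ?_ (hz'c A u₀ hu₀).1.1
      rw [add_left_comm]
      exact le_add_self
    have := termsIn_eq_zero_iff.mp hzero _ ⟨hmemU, hnot⟩
    rw [hbdry, coeff_X_mul] at this
    exact hu this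
  -- The homotopy formula gives z = ∂(e_v∧z') + e_v∧∂z', and the last term lies in J'.
  have hw : ∀ B, (z B : MvPolynomial (Fin n) K) - polyBdry K n (wedge K v z') B ∈ J' := by
    intro B
    have h1 : polyBdry K n (wedge K v z') B =
        X v * z' B - wedge K v (polyBdry K n z') B := by
      rw [polyBdry, bdry_wedge, if_pos (Finset.mem_univ v)]
      rfl
    rw [h1, ← hz', sub_sub_cancel]
    by_cases hvB : v ∈ B
    · rw [wedge_apply_of_mem hvB]; exact zsmul_mem (hz'mem _) _
    · rw [wedge_apply_of_notMem hvB]; exact J'.zero_mem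
  have hzJ : ∀ B, (z B : MvPolynomial (Fin n) K) ∈ J := fun B =>
    (hJ.2 _).mpr fun u hu => (hz₁ B u hu).1.1
  have hwdeg : ∀ B, (wedge K v z' B).IsHomogeneous (D + e) := by
    intro B
    by_cases hvB : v ∈ B
    · rw [wedge_apply_of_mem hvB]
      exact zsmul_mem (K := homogeneousSubmodule (Fin n) K (D + e)) (hz'deg _) _
    · rw [wedge_apply_of_notMem hvB]; exact isHomogeneous_zero _ _ _
  -- Since z has coefficients in J, so does ∂(e_v∧z'): thus e_v∧z' is a cycle over S/J, with
  -- coefficients of degree D + e ≥ D, where S/J is exact. Hence e_v∧z' = ∂b + q with q in J, and z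
  -- ≡ ∂q modulo J'.
  obtain ⟨E, hE⟩ : ∃ E, D + e = E + 1 := ⟨D + e - 1, by omega⟩
  obtain ⟨b, hb, hwb⟩ := h E (by omega) (wedge K v z') (hE ▸ hwdeg) (fun B => by
    rw [← Ideal.neg_mem_iff]
    convert J.sub_mem (hJ'J (hw B)) (hzJ B) using 1
    ring)
  let q : Finset (Fin n) → MvPolynomial (Fin n) K := wedge K v z' - polyBdry K n b
  have hqJ : ∀ B u, coeff u (q B) ≠ 0 → u ∈ U := fun B => (hJ.2 _).mp (hwb B)
  have hqdeg : ∀ B u, coeff u (q B) ≠ 0 → u.degree = D + e := by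
    intro B
    rw [← isHomogeneous_iff_degree]
    refine (hwdeg B).sub (isHomogeneous_iff_degree.mpr fun u hu => ?_)
    obtain ⟨w, u₀, A, rfl, hu₀⟩ := exists_of_coeff_polyBdry_ne_zero hu
    rw [map_add, Finsupp.degree_single, isHomogeneous_iff_degree.mp (hb A) u₀ hu₀]
    omega
  have hqb : polyBdry K n q = polyBdry K n (wedge K v z') := by
    rw [map_sub, sub_eq_self]
    exact bdry_bdry _ _ _ (fun w w' a => by simp only [LinearMap.mulLeft_apply]; ring) b
  refine ⟨fun B => ⟨termsIn (U \ U') (q B), ?_⟩, ?_⟩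
  · rw [mem_restrictSupport_iff_coeff]
    intro u hu
    by_cases huU : u ∈ U \ U'
    · rw [coeff_termsIn_of_mem _ huU] at hu
      exact ⟨huU, hqdeg B u hu⟩
    · exact absurd (coeff_termsIn_of_notMem _ huU) hu
  · funext B
    apply Subtype.ext
    rw [coe_bdry_monomialOperator]
    have hzz : termsIn (U \ U') (z B : MvPolynomial (Fin n) K) = z B :=
      termsIn_eq_self fun u hu => (hz₁ B u hu).1
    rw [← hzz, ← sub_eq_zero, ← map_sub, termsIn_eq_zero_iff]
    intro u hu
    by_contra hne
    refine hu.2 ((hJ'.2 _).mp ?_ u hne)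
    have h1 : polyBdry K n (fun B => q B - termsIn (U \ U') (q B)) B ∈ J' :=
      polyBdry_mem (fun A => sub_termsIn_mem hJ' fun u hu (hu' : u ∉ U \ U') => by
        by_contra hnot
        exact hu' ⟨hqJ A u hu, hnot⟩) B
    have h2 : polyBdry K n (fun B => q B - termsIn (U \ U') (q B)) B =
        polyBdry K n q B - polyBdry K n (fun B => termsIn (U \ U') (q B)) B :=
      congrFun (map_sub (polyBdry K n) q fun B => termsIn (U \ U') (q B)) B
    rw [h2, hqb] at h1
    have h3 := J'.neg_mem (J'.add_mem h1 (hw B))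
    convert h3 using 1
    ring

end MonomialModules

end BettiPowers

end

noncomputable section

namespace BettiPowers

open MvPolynomial

/-! ### Betti numbers as Koszul homology -/

section KoszulHomology

universe u

variable {K : Type u} [Field K] {n : ℕ} {J : Ideal (MvPolynomial (Fin n) K)}
  {U : Set (Fin n →₀ ℕ)}

theorem koszulDifferential_apply (c : KoszulChain J) (B : Finset (Fin n)) :
    koszulDifferential J c B = ∑ a ∈ Bᶜ, (-1) ^ (B.filter (· < a)).card *
      (Ideal.Quotient.mk J (X a) * c (insert a B)) := rfl

theorem koszulDifferential_mk (c : Finset (Fin n) → MvPolynomial (Fin n) K) (B : Finset (Fin n)) :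
    koszulDifferential J (fun A => Ideal.Quotient.mk J (c A)) B =
      Ideal.Quotient.mk J (polyBdry K n c B) := by
  rw [koszulDifferential_apply, polyBdry, bdry_apply_apply, map_sum]
  rw [← Finset.sum_subset (Finset.subset_univ Bᶜ)]
  · refine Finset.sum_congr rfl fun a ha => ?_
    rw [contract_apply_of_notMem (Finset.mem_compl.mp ha), LinearMap.mulLeft_apply, koszulSign]
    rcases neg_one_pow_eq_or ℤ (B.filter (· < a)).card with h | h
    · have h' : (-1 : MvPolynomial (Fin n) K ⧸ J) ^ (B.filter (· < a)).card = 1 := by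
        have := congrArg (Int.cast : ℤ → MvPolynomial (Fin n) K ⧸ J) h
        simpa using this
      rw [h, h', one_smul, one_mul, map_mul]
    · have h' : (-1 : MvPolynomial (Fin n) K ⧸ J) ^ (B.filter (· < a)).card = -1 := by
        have := congrArg (Int.cast : ℤ → MvPolynomial (Fin n) K ⧸ J) h
        simpa using this
      rw [h, h', neg_smul, one_smul, map_mul, map_neg]; ring
  · intro a _ ha
    rw [contract_apply_of_mem (by simpa using ha), map_zero, map_zero]

theorem homogeneousSubmodule_eq_restrictSupport (e : ℕ) :
    homogeneousSubmodule (Fin n) K e = restrictSupport K (exponentsOfDegree Set.univ e) := by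
  ext p
  rw [mem_homogeneousSubmodule, isHomogeneous_iff_degree, mem_restrictSupport_iff_coeff]
  exact forall₂_congr fun u _ => ⟨fun h => ⟨trivial, h⟩, fun h => h.2⟩

instance (e : ℕ) : FiniteDimensional K (quotientDegree J e) := by
  have : FiniteDimensional K (homogeneousSubmodule (Fin n) K e) := by
    rw [homogeneousSubmodule_eq_restrictSupport]; infer_instance
  unfold quotientDegree
  infer_instance

theorem finrank_quotientDegree (hJ : IsMonomialIdealOf J U) (e : ℕ) :
    Module.finrank K (quotientDegree J e) = hilb Uᶜ e := by
  set W := restrictSupport K (exponentsOfDegree Uᶜ e) with hW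
  let f := (Ideal.Quotient.mkₐ K J).toLinearMap.domRestrict W
  have hinj : Function.Injective f := by
    rw [injective_iff_map_eq_zero]
    intro p hp
    have hp' : (p : MvPolynomial (Fin n) K) ∈ J := Ideal.Quotient.eq_zero_iff_mem.mp hp
    apply Subtype.ext
    ext u
    by_contra hne
    exact (mem_restrictSupport_iff_coeff.mp p.2 u hne).1 ((hJ.2 _).mp hp' u hne)
  have hrange : LinearMap.range f = quotientDegree J e := by
    apply le_antisymm
    · rintro _ ⟨p, rfl⟩
      refine ⟨p, isHomogeneous_iff_degree.mpr fun u hu => ?_, rfl⟩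
      exact (mem_restrictSupport_iff_coeff.mp p.2 u hu).2
    · rintro _ ⟨p, hp, rfl⟩
      refine ⟨⟨termsIn Uᶜ p, ?_⟩, ?_⟩
      · rw [hW, mem_restrictSupport_iff_coeff]
        intro u hu
        by_cases huU : u ∈ Uᶜ
        · rw [coeff_termsIn_of_mem _ huU] at hu
          exact ⟨huU, isHomogeneous_iff_degree.mp hp u hu⟩
        · exact absurd (coeff_termsIn_of_notMem _ huU) hu
      · refine ((Ideal.Quotient.mk_eq_mk_iff_sub_mem p (termsIn Uᶜ p)).mpr ?_).symm
        exact sub_termsIn_mem hJ fun u _ hu => not_not.mp hu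
  rw [← hrange, LinearMap.finrank_range_of_inj hinj, finrank_restrictSupport_exponentsOfDegree]

/-- A product of submodules is the product of the underlying modules. -/
def submodulePiEquiv {R ι M : Type*} [CommRing R] [AddCommGroup M] [Module R M]
    (p : ι → Submodule R M) : Submodule.pi Set.univ p ≃ₗ[R] ((i : ι) → p i) where
  toFun c i := ⟨c.1 i, c.2 i trivial⟩
  invFun c := ⟨fun i => c i, fun i _ => (c i).2⟩
  map_add' _ _ := rfl
  map_smul' _ _ := rfl
  left_inv _ := rfl
  right_inv _ := rfl

instance (i j : ℕ) (A : Finset (Fin n)) : FiniteDimensional K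
    (if A.card = i ∧ i ≤ j then quotientDegree J (j - i) else ⊥ : Submodule K _) := by
  by_cases h : A.card = i ∧ i ≤ j
  · rw [if_pos h]; infer_instance
  · rw [if_neg h]; infer_instance

instance (i j : ℕ) : FiniteDimensional K (koszulChains J i j) :=
  Module.Finite.equiv (submodulePiEquiv _).symm

instance (i j : ℕ) : FiniteDimensional K (koszulCycles J i j) :=
  Submodule.finiteDimensional_of_le inf_le_left

theorem finrank_koszulChains (hJ : IsMonomialIdealOf J U) (i j : ℕ) :
    Module.finrank K (koszulChains J i j) =
      if i ≤ j then n.choose i * hilb Uᶜ (j - i) else 0 := by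
  unfold koszulChains
  rw [(submodulePiEquiv _).finrank_eq, Module.finrank_pi_fintype]
  split_ifs with hij
  · have : ∀ A : Finset (Fin n), Module.finrank K
        (if A.card = i ∧ i ≤ j then quotientDegree J (j - i) else ⊥ : Submodule K _) =
        if A.card = i then hilb Uᶜ (j - i) else 0 := by
      intro A
      by_cases hA : A.card = i
      · rw [if_pos ⟨hA, hij⟩, if_pos hA, finrank_quotientDegree hJ]
      · rw [if_neg (fun h => hA h.1), if_neg hA, finrank_bot]
    simp only [this]
    rw [← Finset.sum_filter, Finset.sum_const, smul_eq_mul]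
    congr 1
    have h2 : (Finset.univ.filter fun A : Finset (Fin n) => A.card = i) =
        Finset.powersetCard i Finset.univ := by
      ext A; simp [Finset.mem_powersetCard]
    rw [h2, Finset.card_powersetCard, Finset.card_univ, Fintype.card_fin]
  · refine Finset.sum_eq_zero fun A _ => ?_
    rw [if_neg (fun h => hij h.2), finrank_bot]

theorem mem_koszulChains {c : KoszulChain J} {i j : ℕ} :
    c ∈ koszulChains J i j ↔
      ∀ A, c A ∈ (if A.card = i ∧ i ≤ j then quotientDegree J (j - i) else ⊥ : Submodule K _) := by
  simp [koszulChains, Submodule.mem_pi]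

theorem koszulChains_apply_eq_zero {c : KoszulChain J} {i j : ℕ} (hc : c ∈ koszulChains J i j)
    {A : Finset (Fin n)} (hA : A.card ≠ i) : c A = 0 := by
  have := mem_koszulChains.mp hc A
  rwa [if_neg (fun h => hA h.1)] at this

theorem koszulChains_eq_bot_of_lt {i j : ℕ} (h : j < i) : koszulChains J i j = ⊥ := by
  rw [eq_bot_iff]
  intro c hc
  rw [Submodule.mem_bot]
  funext A
  have := mem_koszulChains.mp hc A
  rwa [if_neg (fun h' => absurd h'.2 (by omega))] at this

theorem koszulChains_eq_bot_of_card_lt {i : ℕ} (h : n < i) (j : ℕ) : koszulChains J i j = ⊥ := by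
  rw [eq_bot_iff]
  intro c hc
  rw [Submodule.mem_bot]
  funext A
  refine koszulChains_apply_eq_zero hc ?_
  have := A.card_le_univ
  rw [Fintype.card_fin] at this
  omega

theorem map_koszulDifferential_koszulChains_zero (j : ℕ) :
    (koszulChains J 0 j).map (koszulDifferential J) = ⊥ := by
  rw [eq_bot_iff]
  rintro _ ⟨c, hc, rfl⟩
  rw [Submodule.mem_bot]
  funext B
  rw [koszulDifferential_apply]
  refine Finset.sum_eq_zero fun a _ => ?_
  rw [koszulChains_apply_eq_zero hc (by simp), mul_zero, mul_zero]

theorem finrank_map_add_finrank_inf_ker {M M' : Type*} [AddCommGroup M] [Module K M]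
    [AddCommGroup M'] [Module K M'] (f : M →ₗ[K] M') (W : Submodule K M) [FiniteDimensional K W] :
    Module.finrank K (W.map f) + Module.finrank K (W ⊓ LinearMap.ker f : Submodule K M) =
      Module.finrank K W := by
  have h := (f.domRestrict W).finrank_range_add_finrank_ker
  rw [LinearMap.range_domRestrict, LinearMap.ker_domRestrict] at h
  rw [← h]
  congr 1
  have h2 : (LinearMap.ker f).comap W.subtype = (W ⊓ LinearMap.ker f).comap W.subtype := by
    ext p; simp
  rw [h2]
  exact (Submodule.comapSubtypeEquivOfLe inf_le_left).finrank_eq.symm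

theorem betti_add_finrank_koszulBoundaries (i j : ℕ) :
    betti J i j + Module.finrank K (koszulBoundaries J i j) =
      Module.finrank K (koszulCycles J i j) := by
  rw [betti, ← Submodule.finrank_quotient_add_finrank
    ((koszulBoundaries J i j).submoduleOf (koszulCycles J i j))]
  congr 1
  exact (Submodule.comapSubtypeEquivOfLe (koszulBoundaries_le_koszulCycles J i j)).finrank_eq.symm

theorem koszulCycles_le_of_betti_eq_zero {i j : ℕ} (h : betti J i j = 0) :
    koszulCycles J i j ≤ koszulBoundaries J i j := by
  have h1 := betti_add_finrank_koszulBoundaries (J := J) i j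
  rw [h, zero_add] at h1
  exact (Submodule.eq_of_le_of_finrank_eq (koszulBoundaries_le_koszulCycles J i j) h1).ge

theorem betti_eq_zero_of_le {i j : ℕ} (h : koszulCycles J i j ≤ koszulBoundaries J i j) :
    betti J i j = 0 := by
  have h1 := betti_add_finrank_koszulBoundaries (J := J) i j
  rw [le_antisymm h (koszulBoundaries_le_koszulCycles J i j)] at h1
  omega

theorem betti_eq_zero_of_koszulChains_eq_bot {i j : ℕ} (h : koszulChains J i j = ⊥) :
    betti J i j = 0 := by
  refine betti_eq_zero_of_le ?_
  rw [koszulCycles, h, bot_inf_eq]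
  exact bot_le

/-- The Euler characteristic of a strand of the Koszul complex. -/
theorem sum_betti (hJ : IsMonomialIdealOf J U) (j : ℕ) :
    ∑ i ∈ Finset.range (n + 1), (-1 : ℤ) ^ i * betti J i j =
      ∑ i ∈ Finset.range (n + 1),
        (-1 : ℤ) ^ i * (if i ≤ j then n.choose i * hilb Uᶜ (j - i) else 0 : ℕ) := by
  -- Rank-nullity telescopes along the strand. The remaining boundary term disappears at N = n,
  -- where there are no chains of degree n + 1.
  have key : ∀ N, ∑ i ∈ Finset.range (N + 1), (-1 : ℤ) ^ i *
        (Module.finrank K (koszulChains J i j) : ℤ) =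
      ∑ i ∈ Finset.range (N + 1), (-1 : ℤ) ^ i * betti J i j +
        (-1) ^ N * Module.finrank K (koszulBoundaries J N j) := by
    intro N
    induction N with
    | zero =>
      have h1 := finrank_map_add_finrank_inf_ker (koszulDifferential J) (koszulChains J 0 j)
      rw [map_koszulDifferential_koszulChains_zero, finrank_bot, zero_add] at h1
      have h2 := betti_add_finrank_koszulBoundaries (J := J) 0 j
      rw [koszulCycles, h1] at h2
      simp [← h2]
    | succ N ih =>
      rw [Finset.sum_range_succ, ih, Finset.sum_range_succ _ (N + 1)]
      have h1 := finrank_map_add_finrank_inf_ker (koszulDifferential J) (koszulChains J (N + 1) j)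
      have h2 := betti_add_finrank_koszulBoundaries (J := J) (N + 1) j
      rw [← koszulCycles, ← koszulBoundaries, ← h2] at h1
      rw [← h1]
      push_cast
      ring
  have h := key n
  rw [koszulBoundaries, koszulChains_eq_bot_of_card_lt (Nat.lt_succ_self n), Submodule.map_bot,
    finrank_bot, Nat.cast_zero, mul_zero, add_zero] at h
  rw [← h]
  simp only [finrank_koszulChains hJ]

/-- S/J is generated by 1: a monomial x_a·u of positive degree is the boundary of u·e_a. -/
theorem betti_zero_eq_zero {j : ℕ} (hj : 1 ≤ j) : betti J 0 j = 0 := by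
  refine betti_eq_zero_of_le ?_
  have hle : homogeneousSubmodule (Fin n) K j ≤ (koszulBoundaries J 0 j).comap
      (LinearMap.single K (fun _ : Finset (Fin n) => MvPolynomial (Fin n) K ⧸ J) ∅ ∘ₗ
        (Ideal.Quotient.mkₐ K J).toLinearMap) := by
    rw [homogeneousSubmodule_eq_restrictSupport, restrictSupport_eq_span, Submodule.span_le]
    rintro _ ⟨u, ⟨-, hu⟩, rfl⟩
    obtain ⟨a, ha⟩ : ∃ a, u a ≠ 0 := by
      by_contra! h0
      have : u = 0 := Finsupp.ext h0
      rw [this, map_zero] at hu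
      omega
    obtain ⟨u₀, rfl⟩ : ∃ u₀, u = Finsupp.single a 1 + u₀ :=
      ⟨u - Finsupp.single a 1, (add_tsub_cancel_of_le
        (Finsupp.single_le_iff.mpr (Nat.one_le_iff_ne_zero.mpr ha))).symm⟩
    rw [map_add, Finsupp.degree_single] at hu
    refine ⟨Pi.single {a} (Ideal.Quotient.mk J (monomial u₀ 1)), ?_, ?_⟩
    · rw [SetLike.mem_coe, mem_koszulChains]
      intro A
      by_cases hA : A = {a}
      · subst hA
        rw [Pi.single_eq_same, if_pos ⟨by simp, by omega⟩]
        refine ⟨monomial u₀ 1, isHomogeneous_monomial _ ?_, rfl⟩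
        omega
      · rw [Pi.single_eq_of_ne hA]
        exact Submodule.zero_mem _
    · funext B
      rw [koszulDifferential_apply]
      rcases B.eq_empty_or_nonempty with rfl | hB
      · rw [Finset.sum_eq_single_of_mem a (by simp)]
        · simp only [insert_empty_eq, Pi.single_eq_same, LinearMap.comp_apply,
            LinearMap.coe_single]
          simp only [Finset.filter_empty, Finset.card_empty, pow_zero, one_mul]
          rw [← map_mul, X, monomial_mul, one_mul]
          rfl
        · intro b _ hb
          rw [Pi.single_eq_of_ne, mul_zero, mul_zero]
          simpa using hb
      · rw [LinearMap.comp_apply, LinearMap.coe_single, Pi.single_eq_of_ne hB.ne_empty]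
        refine Finset.sum_eq_zero fun b hb => ?_
        rw [Pi.single_eq_of_ne, mul_zero, mul_zero]
        intro h
        have h1 := congrArg Finset.card h
        rw [Finset.card_insert_of_notMem (Finset.mem_compl.mp hb), Finset.card_singleton] at h1
        exact hB.card_pos.ne' (by omega)
  rintro c ⟨hc, -⟩
  have hc0 := mem_koszulChains.mp hc ∅
  rw [if_pos ⟨Finset.card_empty, Nat.zero_le j⟩] at hc0
  obtain ⟨f, hf, hfc⟩ := hc0
  have hcs : c = Pi.single ∅ (Ideal.Quotient.mk J f) := by
    funext A
    rcases A.eq_empty_or_nonempty with rfl | hA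
    · rw [Pi.single_eq_same]; exact hfc.symm
    · rw [Pi.single_eq_of_ne hA.ne_empty]
      exact koszulChains_apply_eq_zero hc hA.card_pos.ne'
  rw [hcs]
  exact hle hf

/-- In homological degree i ≥ 1, non-zero homology has coefficients of degree exactly D - 1, so it
vanishes from degree D on. A chain mixing homological degrees is treated one degree at a time;
degree 0 needs `betti_zero_eq_zero`. -/
theorem HasLinearResolution.koszulExactFrom {D : ℕ} (h : HasLinearResolution J D) :
    KoszulExactFrom J D := by
  classical
  intro e he c hc hcJ
  let ci : ℕ → KoszulChain J := fun i A => if A.card = i then Ideal.Quotient.mk J (c A) else 0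
  have hci : ∀ i, ci i ∈ koszulBoundaries J i (i + (e + 1)) := by
    intro i
    refine koszulCycles_le_of_betti_eq_zero ?_ ⟨?_, ?_⟩
    · rcases Nat.eq_zero_or_pos i with rfl | hi
      · exact betti_zero_eq_zero (by omega)
      · by_contra hne
        have := h i _ hi hne
        omega
    · rw [SetLike.mem_coe, mem_koszulChains]
      intro A
      by_cases hA : A.card = i
      · rw [if_pos ⟨hA, by omega⟩, Nat.add_sub_cancel_left]
        exact ⟨c A, hc A, (if_pos hA).symm⟩
      · simp only [ci, if_neg hA]
        exact Submodule.zero_mem _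
    · rw [SetLike.mem_coe, LinearMap.mem_ker]
      funext B
      by_cases hB : B.card + 1 = i
      · have h1 : koszulDifferential J (ci i) B =
            koszulDifferential J (fun A => Ideal.Quotient.mk J (c A)) B := by
          rw [koszulDifferential_apply, koszulDifferential_apply]
          refine Finset.sum_congr rfl fun a ha => ?_
          simp only [ci]
          rw [if_pos (by rw [Finset.card_insert_of_notMem (Finset.mem_compl.mp ha), hB])]
        rw [h1, koszulDifferential_mk]
        exact Ideal.Quotient.eq_zero_iff_mem.mpr (hcJ B)
      · rw [koszulDifferential_apply]
        refine Finset.sum_eq_zero fun a ha => ?_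
        simp only [ci]
        rw [if_neg (by rwa [Finset.card_insert_of_notMem (Finset.mem_compl.mp ha)]), mul_zero,
          mul_zero]
  choose b hb hbc using hci
  have hlift : ∀ i A, ∃ f : MvPolynomial (Fin n) K, f.IsHomogeneous e ∧
      Ideal.Quotient.mk J f = b i A := by
    intro i A
    have := mem_koszulChains.mp (hb i) A
    split_ifs at this with hA
    · obtain ⟨f, hf, hfb⟩ := this
      rw [show i + (e + 1) - (i + 1) = e by omega] at hf
      exact ⟨f, hf, hfb⟩
    · rw [Submodule.mem_bot] at this
      exact ⟨0, isHomogeneous_zero _ _ _, by rw [this, map_zero]⟩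
  choose f hf hfb using hlift
  refine ⟨fun A => f (A.card - 1) A, fun A => hf _ _, fun B => ?_⟩
  rw [← Ideal.Quotient.mk_eq_mk_iff_sub_mem, ← koszulDifferential_mk]
  have h1 : Ideal.Quotient.mk J (c B) = ci B.card B := (if_pos rfl).symm
  rw [h1, ← hbc, koszulDifferential_apply, koszulDifferential_apply]
  refine Finset.sum_congr rfl fun a ha => ?_
  rw [hfb, Finset.card_insert_of_notMem (Finset.mem_compl.mp ha), Nat.add_sub_cancel]

end KoszulHomology

end BettiPowers

end

noncomputable section

namespace BettiPowers

/-! ### Counting monomials: the derivative of the Hilbert numerator -/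

section Counting

variable {n : ℕ}

/-- The Hilbert series of a set of exponents. -/
def hilbSeries (Y : Set (Fin n →₀ ℕ)) : PowerSeries ℤ := PowerSeries.mk fun e => (hilb Y e : ℤ)

theorem one_sub_X_pow_eq_sum (m : ℕ) : (1 - PowerSeries.X : PowerSeries ℤ) ^ m =
    ∑ i ∈ Finset.range (m + 1), PowerSeries.C ((-1) ^ i * (m.choose i : ℤ)) * PowerSeries.X ^ i := by
  rw [sub_eq_neg_add, add_pow]
  refine Finset.sum_congr rfl fun i _ => ?_
  rw [one_pow, mul_one, neg_pow]
  simp only [map_mul, map_pow, map_neg, map_one, map_natCast]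
  ring

theorem coeff_one_sub_X_pow_mul (m j : ℕ) (f : PowerSeries ℤ) :
    PowerSeries.coeff j ((1 - PowerSeries.X) ^ m * f) = ∑ i ∈ Finset.range (m + 1),
      (-1) ^ i * (if i ≤ j then m.choose i * PowerSeries.coeff (j - i) f else 0) := by
  rw [one_sub_X_pow_eq_sum, Finset.sum_mul, map_sum]
  refine Finset.sum_congr rfl fun i _ => ?_
  rw [mul_assoc, PowerSeries.coeff_C_mul, PowerSeries.coeff_X_pow_mul']
  split_ifs <;> ring

theorem coeff_one_sub_X_pow (m i : ℕ) :
    PowerSeries.coeff i ((1 - PowerSeries.X : PowerSeries ℤ) ^ m) = (-1) ^ i * (m.choose i : ℤ) := by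
  rw [one_sub_X_pow_eq_sum, map_sum]
  simp only [PowerSeries.coeff_C_mul_X_pow]
  rw [Finset.sum_ite_eq]
  split_ifs with h
  · rfl
  · rw [Nat.choose_eq_zero_of_lt (by simpa using h)]; simp

/-- The exponents of degree `e`. -/
def degreeFinset (n e : ℕ) : Finset (Fin n →₀ ℕ) :=
  (Finsupp.finite_of_degree_eq (σ := Fin n) e).toFinset

theorem mem_degreeFinset {e : ℕ} {u : Fin n →₀ ℕ} : u ∈ degreeFinset n e ↔ u.degree = e := by
  simp [degreeFinset]

open Classical in
theorem hilb_eq_sum (Y : Set (Fin n →₀ ℕ)) (e : ℕ) :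
    (hilb Y e : ℤ) = ∑ u ∈ degreeFinset n e, if u ∈ Y then 1 else 0 := by
  rw [Finset.sum_boole, hilb, Set.ncard_eq_toFinset_card _ (exponentsOfDegree_finite Y e)]
  congr 2
  ext u
  simp [exponentsOfDegree, mem_degreeFinset, and_comm]

theorem sum_degreeFinset_shift (v : Fin n) (e : ℕ) (g : (Fin n →₀ ℕ) → ℤ) :
    ∑ u ∈ degreeFinset n e, g u = ∑ u ∈ degreeFinset n (e + 1),
      if 1 ≤ u v then g (u - Finsupp.single v 1) else 0 := by
  rw [← Finset.sum_filter]
  refine Finset.sum_bij (fun u _ => u + Finsupp.single v 1) ?_ ?_ ?_ ?_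
  · intro u hu
    rw [mem_degreeFinset] at hu
    simp [mem_degreeFinset, hu]
  · intro u _ u' _ h
    exact add_right_cancel h
  · intro u hu
    rw [Finset.mem_filter, mem_degreeFinset] at hu
    have hle : Finsupp.single v 1 ≤ u := Finsupp.single_le_iff.mpr hu.2
    refine ⟨u - Finsupp.single v 1, ?_, tsub_add_cancel_of_le hle⟩
    have := congrArg Finsupp.degree (tsub_add_cancel_of_le hle)
    rw [map_add, Finsupp.degree_single, hu.1] at this
    rw [mem_degreeFinset]
    omega
  · intro u _
    rw [add_tsub_cancel_right]

variable {U : Set (Fin n →₀ ℕ)} {D : ℕ}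

-- Compare u with u/x_v. Where u has degree at least c in x_v, both or neither lie in the ideal
-- generated below c, so only membership in `U` matters. Where the degree is smaller, neither u nor
-- u/x_v lies in the difference set.
open Classical in
theorem indicator_diff_generatedBelow (hU : IsUpperSet U) (v : Fin n) {c : ℕ} (hc : 1 ≤ c)
    (u : Fin n →₀ ℕ) :
    (if u ∈ U \ generatedBelow U v c then 1 else 0 : ℤ) -
        (if 1 ≤ u v then
          (if u - Finsupp.single v 1 ∈ U \ generatedBelow U v c then 1 else 0) else 0) =
      if c ≤ u v then (if u ∈ U then 1 else 0) -
        (if 1 ≤ u v then (if u - Finsupp.single v 1 ∈ U then 1 else 0) else 0) else 0 := by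
  by_cases hcu : c ≤ u v
  · have h1 : 1 ≤ u v := hc.trans hcu
    obtain ⟨w, rfl⟩ : ∃ w, u = Finsupp.single v 1 + w :=
      ⟨u - Finsupp.single v 1, (add_tsub_cancel_of_le (Finsupp.single_le_iff.mpr h1)).symm⟩
    have hiff : Finsupp.single v 1 + w ∈ generatedBelow U v c ↔ w ∈ generatedBelow U v c := by
      refine ⟨mem_generatedBelow_of_single_add ?_, isUpperSet_generatedBelow v c le_add_self⟩
      rw [Finsupp.add_apply, Finsupp.single_eq_same] at hcu
      omega
    rw [if_pos hcu, if_pos h1, if_pos h1, add_tsub_cancel_left]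
    simp only [Set.mem_sdiff, hiff]
    by_cases hw : w ∈ generatedBelow U v c
    · have hwU := generatedBelow_subset hU v c hw
      simp [hw, hwU, hU le_add_self hwU]
    · simp [hw]
  · have h1 : u ∉ U \ generatedBelow U v c := fun h =>
      hcu (le_apply_of_mem_diff_generatedBelow h)
    have h2 : u - Finsupp.single v 1 ∉ U \ generatedBelow U v c := fun h => by
      have := le_apply_of_mem_diff_generatedBelow h
      rw [Finsupp.tsub_apply] at this
      omega
    simp [h1, h2, hcu]

-- The number of c in [1, D] with c ≤ u v is u v, unless u v > D. In that case u and u/x_v are in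
-- `U` together, because the generators have degree D, and both sides are zero.
open Classical in
theorem sum_indicator_generatedBelow (hgen : ∀ u ∈ U, ∃ u₀ ∈ U, u₀ ≤ u ∧ u₀.degree = D)
    (hU : IsUpperSet U) (v : Fin n) (u : Fin n →₀ ℕ) :
    ∑ c ∈ Finset.Icc 1 D, (if c ≤ u v then (if u ∈ U then 1 else 0) -
        (if 1 ≤ u v then (if u - Finsupp.single v 1 ∈ U then 1 else 0) else 0) else 0 : ℤ) =
      u v * ((if u ∈ U then 1 else 0) -
        (if 1 ≤ u v then (if u - Finsupp.single v 1 ∈ U then 1 else 0) else 0)) := by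
  rw [← Finset.sum_filter, Finset.sum_const, nsmul_eq_mul]
  by_cases huD : u v ≤ D
  · congr 2
    have : (Finset.Icc 1 D).filter (fun c => c ≤ u v) = Finset.Icc 1 (u v) := by
      ext c; simp only [Finset.mem_filter, Finset.mem_Icc]; omega
    rw [this, Nat.card_Icc, Nat.add_sub_cancel]
  · have hiff : u ∈ U ↔ u - Finsupp.single v 1 ∈ U := by
      refine ⟨fun h => ?_, hU tsub_le_self⟩
      obtain ⟨u₀, h₀, hle, hdeg⟩ := hgen u h
      refine hU (fun w => ?_) h₀
      rw [Finsupp.tsub_apply]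
      rcases eq_or_ne v w with rfl | hvw
      · have := Finsupp.le_degree v u₀
        rw [Finsupp.single_eq_same]
        omega
      · rw [Finsupp.single_eq_of_ne hvw.symm, Nat.sub_zero]
        exact hle w
    have h1 : 1 ≤ u v := by omega
    simp [hiff, h1]

/-- The Hilbert series of the subquotients `U \ generatedBelow U v c` add up to the logarithmic
derivative of the Hilbert numerator of `U`. -/
theorem sum_hilbSeries_diff_generatedBelow
    (hgen : ∀ u ∈ U, ∃ u₀ ∈ U, u₀ ≤ u ∧ u₀.degree = D) (hU : IsUpperSet U) :
    (1 - PowerSeries.X) *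
        ∑ v : Fin n, ∑ c ∈ Finset.Icc 1 D, hilbSeries (U \ generatedBelow U v c) =
      (1 - PowerSeries.X) * (PowerSeries.X * PowerSeries.derivative ℤ (hilbSeries U)) -
        (n : PowerSeries ℤ) * (PowerSeries.X * hilbSeries U) := by
  classical
  have hC : (n : PowerSeries ℤ) = PowerSeries.C (n : ℤ) := by simp
  rw [hC, sub_mul, sub_mul, one_mul, one_mul]
  ext j
  simp only [map_sub, map_sum, PowerSeries.coeff_C_mul]
  match j with
  | 0 =>
    simp only [PowerSeries.coeff_zero_X_mul, mul_zero, sub_zero]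
    refine Finset.sum_eq_zero fun v _ => Finset.sum_eq_zero fun c hc => ?_
    rw [hilbSeries, PowerSeries.coeff_mk, hilb_eq_sum]
    refine Finset.sum_eq_zero fun u hu => if_neg fun huY => ?_
    have h1 := le_apply_of_mem_diff_generatedBelow huY
    have h2 := Finsupp.le_degree v u
    rw [mem_degreeFinset.mp hu] at h2
    have := (Finset.mem_Icc.mp hc).1
    omega
  | j + 1 =>
    simp only [PowerSeries.coeff_succ_X_mul, PowerSeries.coeff_derivative, map_sum]
    rw [← Finset.sum_sub_distrib]
    have hv : ∀ v : Fin n, (∑ c ∈ Finset.Icc 1 D,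
          PowerSeries.coeff (j + 1) (hilbSeries (U \ generatedBelow U v c)) -
        ∑ c ∈ Finset.Icc 1 D, PowerSeries.coeff j (hilbSeries (U \ generatedBelow U v c))) =
        ∑ u ∈ degreeFinset n (j + 1), (u v : ℤ) * (if u ∈ U then 1 else 0) -
          ∑ u ∈ degreeFinset n j, ((u v : ℤ) + 1) * (if u ∈ U then 1 else 0) := by
      intro v
      rw [← Finset.sum_sub_distrib]
      have hc : ∀ c ∈ Finset.Icc 1 D,
          PowerSeries.coeff (j + 1) (hilbSeries (U \ generatedBelow U v c)) -
            PowerSeries.coeff j (hilbSeries (U \ generatedBelow U v c)) =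
          ∑ u ∈ degreeFinset n (j + 1), (if c ≤ u v then (if u ∈ U then 1 else 0) -
            (if 1 ≤ u v then (if u - Finsupp.single v 1 ∈ U then 1 else 0) else 0) else 0 : ℤ) := by
        intro c hc
        rw [hilbSeries, PowerSeries.coeff_mk, PowerSeries.coeff_mk, hilb_eq_sum, hilb_eq_sum,
          sum_degreeFinset_shift v j, ← Finset.sum_sub_distrib]
        refine Finset.sum_congr rfl fun u _ => ?_
        rw [← indicator_diff_generatedBelow hU v (Finset.mem_Icc.mp hc).1 u]
        congr!
      rw [Finset.sum_congr rfl hc, Finset.sum_comm, sum_degreeFinset_shift v j,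
        ← Finset.sum_sub_distrib]
      refine Finset.sum_congr rfl fun u _ => ?_
      rw [sum_indicator_generatedBelow hgen hU, mul_sub]
      congr 1
      by_cases h1 : 1 ≤ u v
      · rw [if_pos h1, if_pos h1, Finsupp.tsub_apply, Finsupp.single_eq_same]
        congr 1
        push_cast [h1]
        ring
      · rw [if_neg h1, if_neg h1, mul_zero]
    -- Summing the exponents of u over all variables gives its degree; this turns the count into the
    -- derivative of the Hilbert series, and the shift by one in each variable contributes n.
    rw [Finset.sum_congr rfl fun v _ => hv v, Finset.sum_sub_distrib, Finset.sum_comm,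
      Finset.sum_comm (t := degreeFinset n j)]
    have h1 : ∀ u ∈ degreeFinset n (j + 1),
        ∑ v, (u v : ℤ) * (if u ∈ U then 1 else 0) = (j + 1) * (if u ∈ U then 1 else 0) := by
      intro u hu
      rw [← Finset.sum_mul, ← Nat.cast_sum, ← Finsupp.degree_eq_sum, mem_degreeFinset.mp hu]
      push_cast
      rfl
    have h2 : ∀ u ∈ degreeFinset n j,
        ∑ v, ((u v : ℤ) + 1) * (if u ∈ U then 1 else 0) = (j + n) * (if u ∈ U then 1 else 0) := by
      intro u hu
      rw [← Finset.sum_mul, Finset.sum_add_distrib, ← Nat.cast_sum, ← Finsupp.degree_eq_sum,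
        mem_degreeFinset.mp hu]
      simp
    rw [Finset.sum_congr rfl h1, Finset.sum_congr rfl h2, ← Finset.mul_sum, ← Finset.mul_sum,
      ← hilb_eq_sum, ← hilb_eq_sum]
    match j with
    | 0 =>
      simp only [PowerSeries.coeff_zero_X_mul, hilbSeries, PowerSeries.coeff_mk]
      push_cast
      ring
    | j + 1 =>
      simp only [PowerSeries.coeff_succ_X_mul, PowerSeries.coeff_derivative, hilbSeries,
        PowerSeries.coeff_mk]
      push_cast
      ring

/-- By the Leibniz rule, (1-t)·t·((1-t)^n H)' = (1-t)^n·((1-t)·t·H' - n·t·H); apply the previous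
count and cancel 1 - t. -/
theorem X_mul_derivative_hilbNumerator
    (hgen : ∀ u ∈ U, ∃ u₀ ∈ U, u₀ ≤ u ∧ u₀.degree = D) (hU : IsUpperSet U) :
    PowerSeries.X * PowerSeries.derivative ℤ ((1 - PowerSeries.X) ^ n * hilbSeries U) =
      (1 - PowerSeries.X) ^ n *
        ∑ v : Fin n, ∑ c ∈ Finset.Icc 1 D, hilbSeries (U \ generatedBelow U v c) := by
  have hne : (1 - PowerSeries.X : PowerSeries ℤ) ≠ 0 := by
    intro h
    simpa using congrArg PowerSeries.constantCoeff h
  apply mul_left_cancel₀ hne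
  have h := congrArg (fun f => (1 - PowerSeries.X) ^ n * f)
    (sum_hilbSeries_diff_generatedBelow hgen hU)
  rw [mul_left_comm (1 - PowerSeries.X) ((1 - PowerSeries.X) ^ n) (∑ v, _), h, Derivation.leibniz, PowerSeries.derivative_pow, map_sub,
    PowerSeries.derivative_one, PowerSeries.derivative_X, smul_eq_mul, smul_eq_mul]
  rcases n with _ | m
  · simp
  · rw [Nat.add_sub_cancel]
    push_cast
    ring

/-- The whole monoid is generated in degree D = 0, where the sum over c is empty. So the numerator
has derivative 0, and its constant term is 1. -/
theorem one_sub_X_pow_mul_hilbSeries_univ :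
    (1 - PowerSeries.X) ^ n * hilbSeries (Set.univ : Set (Fin n →₀ ℕ)) = 1 := by
  have h := X_mul_derivative_hilbNumerator (n := n) (U := Set.univ) (D := 0)
    (fun u _ => ⟨0, trivial, zero_le, map_zero _⟩) isUpperSet_univ
  simp only [Finset.Icc_eq_empty_of_lt Nat.zero_lt_one, Finset.sum_empty, Finset.sum_const_zero,
    mul_zero] at h
  have h' := (mul_eq_zero.mp h).resolve_left PowerSeries.X_ne_zero
  refine PowerSeries.derivative.ext (by rw [h', PowerSeries.derivative_one]) ?_
  have h0 : hilb (Set.univ : Set (Fin n →₀ ℕ)) 0 = 1 := by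
    rw [hilb, Set.ncard_eq_one]
    refine ⟨0, ?_⟩
    ext u
    simp [exponentsOfDegree, Finsupp.degree_eq_zero_iff]
  rw [map_mul, ← PowerSeries.coeff_zero_eq_constantCoeff_apply (hilbSeries _), hilbSeries,
    PowerSeries.coeff_mk, h0]
  simp

theorem hilb_add_hilb_compl (Y : Set (Fin n →₀ ℕ)) (e : ℕ) :
    hilb Y e + hilb Yᶜ e = hilb (Set.univ : Set (Fin n →₀ ℕ)) e := by
  rw [hilb, hilb, hilb, ← Set.ncard_union_eq _ (exponentsOfDegree_finite _ _)
    (exponentsOfDegree_finite _ _)]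
  · congr 1
    ext u
    by_cases h : u ∈ Y <;> simp [exponentsOfDegree, h]
  · exact Set.disjoint_left.mpr fun u h h' => h'.1 h.1

theorem hilbSeries_compl (Y : Set (Fin n →₀ ℕ)) :
    (1 - PowerSeries.X) ^ n * hilbSeries Yᶜ = 1 - (1 - PowerSeries.X) ^ n * hilbSeries Y := by
  rw [eq_sub_iff_add_eq, ← mul_add]
  refine Eq.trans ?_ (one_sub_X_pow_mul_hilbSeries_univ (n := n))
  congr 1
  ext e
  simp only [hilbSeries, map_add, PowerSeries.coeff_mk, ← hilb_add_hilb_compl Y e]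
  push_cast
  ring

theorem hilb_eq_zero_of_lt (hdeg : ∀ u ∈ U, D ≤ u.degree) {Y : Set (Fin n →₀ ℕ)} (hY : Y ⊆ U)
    {e : ℕ} (he : e < D) : hilb Y e = 0 := by
  rw [hilb, Set.ncard_eq_zero (exponentsOfDegree_finite Y e), Set.eq_empty_iff_forall_notMem]
  rintro u ⟨huY, hu⟩
  have := hdeg u (hY huY)
  omega

end Counting

end BettiPowers

end

noncomputable section

namespace BettiPowers

/-! ### Positivity of the Betti numbers of a linear resolution -/

section LinearBetti

universe u

variable {K : Type u} [Field K] {n : ℕ} {J : Ideal (MvPolynomial (Fin n) K)}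
  {U : Set (Fin n →₀ ℕ)} {D : ℕ}

theorem degree_le_of_generated (hgen : ∀ u ∈ U, ∃ u₀ ∈ U, u₀ ≤ u ∧ u₀.degree = D) :
    ∀ u ∈ U, D ≤ u.degree := by
  intro u hu
  obtain ⟨u₀, -, hle, hdeg⟩ := hgen u hu
  rw [← hdeg]
  exact Finsupp.degree_mono hle

theorem HasLinearResolution.betti_eq_zero (hlin : HasLinearResolution J D) {i j : ℕ}
    (h : j ≠ D + i) : betti J (i + 1) j = 0 := by
  by_contra hne
  have := hlin (i + 1) j (by omega) hne
  omega

theorem betti_zero_zero (hJ : IsMonomialIdealOf J U) (h0 : (0 : Fin n →₀ ℕ) ∉ U) :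
    betti J 0 0 = 1 := by
  have h := sum_betti hJ 0
  rw [Finset.sum_eq_single_of_mem 0 (by simp), Finset.sum_eq_single_of_mem 0 (by simp)] at h
  · have h1 : hilb Uᶜ 0 = 1 := by
      rw [hilb, Set.ncard_eq_one]
      refine ⟨0, ?_⟩
      ext u
      simp only [exponentsOfDegree, Set.mem_ofPred_eq, Set.mem_compl_iff, Set.mem_singleton_iff,
        Finsupp.degree_eq_zero_iff]
      exact ⟨fun h => h.2, fun h => ⟨h ▸ h0, h⟩⟩
    simpa [h1] using h
  · intro i _ hi
    rw [if_neg (by omega)]; simp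
  · intro i _ hi
    rw [betti_eq_zero_of_koszulChains_eq_bot (koszulChains_eq_bot_of_lt (by omega))]; simp

/-- The Euler characteristic of each strand; linearity leaves at most one positive homological
degree per internal degree. -/
theorem hilbNumerator_eq (hJ : IsMonomialIdealOf J U) (hdeg : ∀ u ∈ U, D ≤ u.degree) (hD : 1 ≤ D)
    (hlin : HasLinearResolution J D) :
    (1 - PowerSeries.X) ^ n * hilbSeries Uᶜ = 1 + ∑ i ∈ Finset.range n,
      PowerSeries.C ((-1) ^ (i + 1) * (betti J (i + 1) (D + i) : ℤ)) * PowerSeries.X ^ (D + i) := by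
  ext j
  rw [coeff_one_sub_X_pow_mul]
  have h := sum_betti hJ j
  have h1 : ∑ i ∈ Finset.range (n + 1), (-1 : ℤ) ^ i *
      (if i ≤ j then n.choose i * PowerSeries.coeff (j - i) (hilbSeries Uᶜ) else 0) =
      ∑ i ∈ Finset.range (n + 1),
        (-1 : ℤ) ^ i * (if i ≤ j then n.choose i * hilb Uᶜ (j - i) else 0 : ℕ) := by
    refine Finset.sum_congr rfl fun i _ => ?_
    split_ifs <;> simp [hilbSeries]
  rw [h1, ← h, Finset.sum_range_succ', map_add, map_sum, add_comm]
  have h0 : (0 : Fin n →₀ ℕ) ∉ U := fun h => by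
    have := hdeg 0 h
    rw [map_zero] at this
    omega
  congr 1
  · rw [PowerSeries.coeff_one]
    rcases Nat.eq_zero_or_pos j with rfl | hj
    · rw [betti_zero_zero hJ h0]; simp
    · rw [betti_zero_eq_zero hj, if_neg (by omega)]; simp
  · refine Finset.sum_congr rfl fun i _ => ?_
    rw [PowerSeries.coeff_C_mul_X_pow]
    split_ifs with hj
    · rw [hj]
    · rw [hlin.betti_eq_zero hj]; simp

theorem betti_eq_sum_hilb (hJ : IsMonomialIdealOf J U) (hdeg : ∀ u ∈ U, D ≤ u.degree) (hD : 1 ≤ D)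
    (hlin : HasLinearResolution J D) {i : ℕ} (hi : i ≤ n) :
    (-1) ^ i * (betti J (i + 1) (D + i) : ℤ) =
      PowerSeries.coeff (D + i) ((1 - PowerSeries.X) ^ n * hilbSeries U) := by
  have h1 : (1 - PowerSeries.X) ^ n * hilbSeries U =
      1 - (1 - PowerSeries.X) ^ n * hilbSeries Uᶜ := by
    rw [hilbSeries_compl]; ring
  rw [h1, hilbNumerator_eq hJ hdeg hD hlin, sub_add_cancel_left, map_neg, map_sum]
  simp only [PowerSeries.coeff_C_mul_X_pow, Nat.add_left_cancel_iff]
  rw [Finset.sum_ite_eq]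
  split_ifs with h
  · rw [pow_succ]; ring
  · rw [betti_eq_zero_of_koszulChains_eq_bot
      (koszulChains_eq_bot_of_card_lt (by rw [Finset.mem_range] at h; omega) _)]
    simp

theorem hilbSeries_eq_X_pow_mul {Y : Set (Fin n →₀ ℕ)} (h : ∀ e < D, hilb Y e = 0) :
    hilbSeries Y = PowerSeries.X ^ D * PowerSeries.mk fun e => (hilb Y (D + e) : ℤ) := by
  ext e
  rw [PowerSeries.coeff_X_pow_mul']
  split_ifs with he
  · obtain ⟨e, rfl⟩ := Nat.exists_eq_add_of_le he
    simp [hilbSeries]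
  · simp [hilbSeries, h e (by omega)]

/-- The Betti numbers of a linear resolution, multiplied by the degree, are non-negative
combinations of rows of Pascal's triangle. -/
theorem exists_betti_eq_sum_choose (hJ : IsMonomialIdealOf J U)
    (hgen : ∀ u ∈ U, ∃ u₀ ∈ U, u₀ ≤ u ∧ u₀.degree = D) (hD : 1 ≤ D)
    (hlin : HasLinearResolution J D) :
    ∃ Γ : ℕ → ℕ, ∀ i ≤ n, (D + i) * betti J (i + 1) (D + i) =
      ∑ j ∈ Finset.range (n + 1), Γ j * (n - j).choose i := by
  have hdeg := degree_le_of_generated hgen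
  have hexact := hlin.koszulExactFrom
  have hγ : ∀ (v : Fin n) (c : ℕ), ∃ γ : ℕ → ℕ, 1 ≤ c →
      (1 - PowerSeries.X) ^ n * hilbSeries (U \ generatedBelow U v c) =
        PowerSeries.X ^ D * ∑ j ∈ Finset.range (n + 1),
          (γ j : PowerSeries ℤ) * (1 - PowerSeries.X) ^ (n - j) := by
    intro v c
    by_cases hc : 1 ≤ c
    · obtain ⟨γ, hγ⟩ := IsLinear.exists_hilbertSeries n K
        (MonomialPart K (U \ generatedBelow U v c) D) Finset.univ
        (monomialOperator K (U \ generatedBelow U v c) D) (by simp)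
        (monomialOperator_comm (ordConnected_diff hJ.1 (isUpperSet_generatedBelow v c)) D)
        (hexact.isLinear_diff hJ hD v hc)
      refine ⟨γ, fun _ => ?_⟩
      simp only [finrank_restrictSupport_exponentsOfDegree] at hγ
      rw [hilbSeries_eq_X_pow_mul fun e he => hilb_eq_zero_of_lt hdeg Set.sdiff_subset he,
        mul_left_comm, hγ]
    · exact ⟨0, fun h => absurd h hc⟩
  choose γ hγ using hγ
  -- Γ adds the coefficients of all subquotients J/J_{v,c}. Comparing coefficients of t^(D+i), the
  -- derivative gives the factor D + i, and the sign (-1)^i occurs on both sides.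
  refine ⟨fun j => ∑ v : Fin n, ∑ c ∈ Finset.Icc 1 D, γ v c j, fun i hi => ?_⟩
  have hmain := X_mul_derivative_hilbNumerator hgen hJ.1
  have hsum : (1 - PowerSeries.X) ^ n *
      ∑ v : Fin n, ∑ c ∈ Finset.Icc 1 D, hilbSeries (U \ generatedBelow U v c) =
      PowerSeries.X ^ D * ∑ j ∈ Finset.range (n + 1),
        ((∑ v : Fin n, ∑ c ∈ Finset.Icc 1 D, γ v c j : ℕ) : PowerSeries ℤ) *
          (1 - PowerSeries.X) ^ (n - j) := by
    rw [Finset.mul_sum]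
    have : ∀ v : Fin n, (1 - PowerSeries.X) ^ n *
        ∑ c ∈ Finset.Icc 1 D, hilbSeries (U \ generatedBelow U v c) =
        ∑ c ∈ Finset.Icc 1 D, PowerSeries.X ^ D * ∑ j ∈ Finset.range (n + 1),
          (γ v c j : PowerSeries ℤ) * (1 - PowerSeries.X) ^ (n - j) := by
      intro v
      rw [Finset.mul_sum]
      exact Finset.sum_congr rfl fun c hc => hγ v c (Finset.mem_Icc.mp hc).1
    rw [Finset.sum_congr rfl fun v _ => this v]
    simp only [← Finset.mul_sum]
    congr 1
    simp only [Nat.cast_sum, Finset.sum_mul]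
    rw [Finset.sum_comm (s := Finset.range (n + 1))]
    exact Finset.sum_congr rfl fun v _ => Finset.sum_comm
  rw [hsum] at hmain
  have hcoeff := congrArg (PowerSeries.coeff (D + i)) hmain
  obtain ⟨E, hE⟩ : ∃ E, D + i = E + 1 := ⟨D + i - 1, by omega⟩
  have hL : PowerSeries.coeff (D + i) (PowerSeries.X *
      PowerSeries.derivative ℤ ((1 - PowerSeries.X) ^ n * hilbSeries U)) =
      ((D + i : ℕ) : ℤ) * PowerSeries.coeff (D + i) ((1 - PowerSeries.X) ^ n * hilbSeries U) := by
    rw [hE, PowerSeries.coeff_succ_X_mul, PowerSeries.coeff_derivative]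
    push_cast
    ring
  have hR : ∀ j : ℕ, PowerSeries.coeff i
      (((∑ v : Fin n, ∑ c ∈ Finset.Icc 1 D, γ v c j : ℕ) : PowerSeries ℤ) *
        (1 - PowerSeries.X : PowerSeries ℤ) ^ (n - j)) =
      (-1) ^ i * ((∑ v : Fin n, ∑ c ∈ Finset.Icc 1 D, γ v c j : ℕ) * (n - j).choose i : ℤ) := by
    intro j
    rw [← map_natCast (PowerSeries.C (R := ℤ)), PowerSeries.coeff_C_mul, coeff_one_sub_X_pow]
    ring
  rw [hL, ← betti_eq_sum_hilb hJ hdeg hD hlin hi, PowerSeries.coeff_X_pow_mul',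
    if_pos (Nat.le_add_right D i), Nat.add_sub_cancel_left, map_sum,
    Finset.sum_congr rfl fun j _ => hR j, ← Finset.mul_sum, mul_left_comm] at hcoeff
  have h2 := mul_left_cancel₀ (pow_ne_zero i (by norm_num : (-1 : ℤ) ≠ 0)) hcoeff
  exact_mod_cast h2

/-- The sum is the Hilbert numerator of S/J at t = 1. For n > 0 the part of S/J in degrees below D -
1 contributes nothing, since (1-t)^n vanishes, and the linear truncation contributes only its
coefficient γ_n. -/
theorem alternatingSum_betti_nonneg (hJ : IsMonomialIdealOf J U)
    (hdeg : ∀ u ∈ U, D ≤ u.degree) (hD : 1 ≤ D) (hlin : HasLinearResolution J D) :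
    0 ≤ 1 + ∑ i ∈ Finset.range n, (-1) ^ (i + 1) * (betti J (i + 1) (D + i) : ℤ) := by
  rcases Nat.eq_zero_or_pos n with rfl | hn
  · simp
  obtain ⟨E, rfl⟩ : ∃ E, D = E + 1 := ⟨D - 1, by omega⟩
  obtain ⟨γ, hγ⟩ := IsLinear.exists_hilbertSeries n K (MonomialPart K Uᶜ E) Finset.univ
    (monomialOperator K Uᶜ E) (by simp)
    (monomialOperator_comm (by
      have := ordConnected_diff (U := Set.univ) isUpperSet_univ hJ.1
      rwa [← Set.compl_eq_univ_sdiff] at this) E)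
    (hlin.koszulExactFrom.isLinear_quotient hJ)
  simp only [finrank_restrictSupport_exponentsOfDegree] at hγ
  have hsplit : hilbSeries Uᶜ = ((PowerSeries.trunc E (hilbSeries Uᶜ) : Polynomial ℤ) :
      PowerSeries ℤ) + PowerSeries.X ^ E * PowerSeries.mk fun e => (hilb Uᶜ (E + e) : ℤ) := by
    ext e
    rw [map_add, Polynomial.coeff_coe, PowerSeries.coeff_trunc, PowerSeries.coeff_X_pow_mul']
    by_cases he : e < E
    · rw [if_pos he, if_neg (by omega), add_zero]
    · obtain ⟨e, rfl⟩ := Nat.exists_eq_add_of_le (not_lt.mp he)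
      simp [hilbSeries]
  have hnum := hilbNumerator_eq hJ hdeg hD hlin
  rw [hsplit, mul_add, mul_left_comm, hγ] at hnum
  -- The power series identity is lifted to polynomials so that it can be evaluated at 1.
  have hpoly : (1 - Polynomial.X) ^ n * PowerSeries.trunc E (hilbSeries Uᶜ) +
      Polynomial.X ^ E * ∑ j ∈ Finset.range (n + 1),
        (γ j : Polynomial ℤ) * (1 - Polynomial.X) ^ (n - j) =
      1 + ∑ i ∈ Finset.range n, Polynomial.C ((-1) ^ (i + 1) *
        (betti J (i + 1) (E + 1 + i) : ℤ)) * Polynomial.X ^ (E + 1 + i) := by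
    apply Polynomial.coe_injective ℤ
    have hcoe : ∀ p : Polynomial ℤ, (p : PowerSeries ℤ) = Polynomial.coeToPowerSeries.ringHom p :=
      fun _ => rfl
    have hX : Polynomial.coeToPowerSeries.ringHom (Polynomial.X : Polynomial ℤ) =
      PowerSeries.X := Polynomial.coe_X
    rw [hcoe, hcoe]
    rw [hcoe] at hnum
    simp only [map_add, map_mul, map_pow, map_sub, map_sum, map_one, map_natCast, map_neg,
      hX] at hnum ⊢
    exact hnum
  have heval := congrArg (Polynomial.eval 1) hpoly
  simp only [Polynomial.eval_add, Polynomial.eval_mul, Polynomial.eval_pow, Polynomial.eval_sub,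
    Polynomial.eval_one, Polynomial.eval_X, sub_self, Polynomial.eval_finsetSum,
    Polynomial.eval_C, one_pow, mul_one, one_mul, zero_pow hn.ne', zero_mul, zero_add,
    Polynomial.eval_natCast] at heval
  rw [← heval]
  exact Finset.sum_nonneg fun j _ => mul_nonneg (by positivity) (by positivity)

end LinearBetti

end BettiPowers

end

noncomputable section

namespace BettiPowers

/-! ### Eventually polynomial functions -/

section EventuallyPolynomial

/-- `f` agrees with a polynomial for all large arguments. -/
def EventuallyPolynomial (f : ℕ → ℝ) : Prop :=
  ∃ (P : Polynomial ℝ) (N : ℕ), ∀ k, N ≤ k → f k = P.eval (k : ℝ)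

theorem EventuallyPolynomial.congr {f g : ℕ → ℝ} (hf : EventuallyPolynomial f) (N : ℕ)
    (h : ∀ k, N ≤ k → g k = f k) : EventuallyPolynomial g := by
  obtain ⟨P, M, hP⟩ := hf
  refine ⟨P, max M N, fun k hk => ?_⟩
  rw [h k (le_trans (le_max_right _ _) hk), hP k (le_trans (le_max_left _ _) hk)]

theorem eventuallyPolynomial_const (c : ℝ) : EventuallyPolynomial fun _ => c :=
  ⟨Polynomial.C c, 0, fun k _ => by simp⟩

theorem EventuallyPolynomial.add {f g : ℕ → ℝ} (hf : EventuallyPolynomial f)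
    (hg : EventuallyPolynomial g) : EventuallyPolynomial fun k => f k + g k := by
  obtain ⟨P, M, hP⟩ := hf
  obtain ⟨Q, N, hQ⟩ := hg
  refine ⟨P + Q, max M N, fun k hk => ?_⟩
  simp only [Polynomial.eval_add]
  rw [hP k (le_trans (le_max_left _ _) hk),
    hQ k (le_trans (le_max_right _ _) hk)]

theorem EventuallyPolynomial.const_mul {f : ℕ → ℝ} (hf : EventuallyPolynomial f) (c : ℝ) :
    EventuallyPolynomial fun k => c * f k := by
  obtain ⟨P, M, hP⟩ := hf
  refine ⟨Polynomial.C c * P, M, fun k hk => ?_⟩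
  simp only [Polynomial.eval_mul, Polynomial.eval_C, hP k hk]

theorem EventuallyPolynomial.mul {f g : ℕ → ℝ} (hf : EventuallyPolynomial f)
    (hg : EventuallyPolynomial g) : EventuallyPolynomial fun k => f k * g k := by
  obtain ⟨P, M, hP⟩ := hf
  obtain ⟨Q, N, hQ⟩ := hg
  refine ⟨P * Q, max M N, fun k hk => ?_⟩
  simp only [Polynomial.eval_mul]
  rw [hP k (le_trans (le_max_left _ _) hk), hQ k (le_trans (le_max_right _ _) hk)]

theorem EventuallyPolynomial.sub {f g : ℕ → ℝ} (hf : EventuallyPolynomial f)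
    (hg : EventuallyPolynomial g) : EventuallyPolynomial fun k => f k - g k :=
  (hf.add (hg.const_mul (-1))).congr 0 fun k _ => by ring

theorem EventuallyPolynomial.sum {ι : Type*} (s : Finset ι) {f : ι → ℕ → ℝ}
    (h : ∀ i ∈ s, EventuallyPolynomial (f i)) :
    EventuallyPolynomial fun k => ∑ i ∈ s, f i k := by
  classical
  induction s using Finset.induction_on with
  | empty => exact (eventuallyPolynomial_const 0).congr 0 fun k _ => by simp
  | insert a s ha ih =>
    refine ((h a (by simp)).add (ih fun i hi => h i (by simp [hi]))).congr 0 fun k _ => ?_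
    rw [Finset.sum_insert ha]

theorem EventuallyPolynomial.shift {f : ℕ → ℝ} (hf : EventuallyPolynomial f) (a : ℕ) :
    EventuallyPolynomial fun k => f (k - a) := by
  obtain ⟨P, M, hP⟩ := hf
  refine ⟨P.comp (Polynomial.X - Polynomial.C (a : ℝ)), M + a, fun k hk => ?_⟩
  simp only [Polynomial.eval_comp]
  rw [hP _ (by omega), Nat.cast_sub (by omega)]
  simp

end EventuallyPolynomial

/-! ### Hilbert functions of powers of a monomial ideal -/

section Khovanskii

variable {r : ℕ}

theorem eventuallyPolynomial_hilb_univ :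
    EventuallyPolynomial fun k => (hilb (Set.univ : Set (Fin r →₀ ℕ)) k : ℝ) := by
  have h := one_sub_X_pow_mul_hilbSeries_univ (n := r)
  rcases r with _ | d
  · refine (eventuallyPolynomial_const 0).congr 1 fun k hk => ?_
    rw [pow_zero, one_mul] at h
    have := congrArg (PowerSeries.coeff k) h
    rw [hilbSeries, PowerSeries.coeff_mk, PowerSeries.coeff_one, if_neg (by omega)] at this
    exact_mod_cast this
  · have h2 := PowerSeries.mk_add_choose_mul_one_sub_pow_eq_one ℤ d
    rw [mul_comm] at h
    have h3 : hilbSeries (Set.univ : Set (Fin (d + 1) →₀ ℕ)) = _ := left_inv_eq_right_inv h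
      ((mul_comm _ _).trans h2)
    refine ⟨Polynomial.preHilbertPoly ℝ d 0, 0, fun k _ => ?_⟩
    rw [Polynomial.preHilbertPoly_eq_choose_sub_add ℝ d (Nat.zero_le k)]
    have := congrArg (PowerSeries.coeff k) h3
    rw [hilbSeries, PowerSeries.coeff_mk, PowerSeries.coeff_mk] at this
    have h4 : hilb (Set.univ : Set (Fin (d + 1) →₀ ℕ)) k = (d + k).choose d := by
      exact_mod_cast this
    simp only [h4, Nat.sub_zero, add_comm]

/-- The exponents that lie above no element of `G`. -/
def avoiding (G : Finset (Fin r →₀ ℕ)) : Set (Fin r →₀ ℕ) := {h | ∀ g ∈ G, ¬ g ≤ h}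

/-- The exponents above g that avoid G become, after subtracting g, those that avoid all g' - g
(truncated). This set of generators is no larger than G, which drives the induction below. -/
theorem hilb_avoiding_insert (g : Fin r →₀ ℕ) (G : Finset (Fin r →₀ ℕ)) {k : ℕ}
    (hk : g.degree ≤ k) :
    hilb (avoiding (insert g G)) k + hilb (avoiding (G.image (· - g))) (k - g.degree) =
      hilb (avoiding G) k := by
  have hinj : Function.Injective (fun h : Fin r →₀ ℕ => g + h) := add_right_injective g
  rw [hilb, hilb, hilb,
    ← Set.ncard_image_of_injective (exponentsOfDegree (avoiding (G.image (· - g))) _) hinj, ← Set.ncard_union_eq _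
    (exponentsOfDegree_finite _ _) ((exponentsOfDegree_finite _ _).image _)]
  · congr 1
    ext h
    simp only [Set.mem_union, Set.mem_image, exponentsOfDegree, Set.mem_ofPred_eq, avoiding,
      Finset.mem_insert, Finset.mem_image, forall_eq_or_imp, forall_exists_index, and_imp,
      forall_apply_eq_imp_iff₂]
    constructor
    · rintro (⟨⟨-, h1⟩, h2⟩ | ⟨h', ⟨h1, h2⟩, rfl⟩)
      · exact ⟨h1, h2⟩
      · refine ⟨fun g' hg' hle => h1 g' hg' (tsub_le_iff_left.mpr hle), ?_⟩
        rw [map_add, h2]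
        omega
    · rintro ⟨h1, h2⟩
      by_cases hg : g ≤ h
      · refine Or.inr ⟨h - g, ⟨fun g' hg' hle => h1 g' hg' ?_, ?_⟩, add_tsub_cancel_of_le hg⟩
        · rw [← add_tsub_cancel_of_le hg]
          exact tsub_le_iff_left.mp hle
        · have := congrArg Finsupp.degree (add_tsub_cancel_of_le hg)
          rw [map_add] at this
          omega
      · exact Or.inl ⟨⟨hg, h1⟩, h2⟩
  · refine Set.disjoint_left.mpr ?_
    rintro _ ⟨h1, -⟩ ⟨h', -, rfl⟩
    exact h1 g (by simp) le_self_add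

theorem eventuallyPolynomial_hilb_avoiding (G : Finset (Fin r →₀ ℕ)) :
    EventuallyPolynomial fun k => (hilb (avoiding G) k : ℝ) := by
  induction hm : G.card using Nat.strong_induction_on generalizing G with
  | _ m ih =>
    rcases G.eq_empty_or_nonempty with rfl | ⟨g, hg⟩
    · refine (eventuallyPolynomial_hilb_univ (r := r)).congr 0 fun k _ => ?_
      have : avoiding (∅ : Finset (Fin r →₀ ℕ)) = Set.univ := by ext; simp [avoiding]
      rw [this]
    · obtain ⟨G', hgG', rfl⟩ : ∃ G', g ∉ G' ∧ insert g G' = G :=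
        ⟨G.erase g, by simp, Finset.insert_erase hg⟩
      rw [Finset.card_insert_of_notMem hgG'] at hm
      have hcard := Finset.card_image_le (s := G') (f := (· - g))
      refine ((ih G'.card (by omega) G' rfl).sub
        ((ih _ (by omega) (G'.image (· - g)) rfl).shift g.degree)).congr g.degree fun k hk => ?_
      rw [← hilb_avoiding_insert g G' hk]
      push_cast
      ring

/-- Dickson's lemma: an upper set has finitely many minimal elements. -/
theorem exists_finset_compl_eq_avoiding {B : Set (Fin r →₀ ℕ)} (hB : IsUpperSet B) :
    ∃ G : Finset (Fin r →₀ ℕ), Bᶜ = avoiding G := by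
  have hfin : {g | Minimal (· ∈ B) g}.Finite :=
    WellQuasiOrderedLE.finite_of_isAntichain (setOfPred_minimal_antichain _)
  refine ⟨hfin.toFinset, ?_⟩
  ext h
  simp only [Set.mem_compl_iff, avoiding, Set.mem_ofPred_eq, Set.Finite.mem_toFinset]
  constructor
  · intro hh g hg hle
    exact hh (hB hle hg.prop)
  · intro hh hhB
    obtain ⟨g, hle, hg⟩ := exists_minimal_le_of_wellFoundedLT (· ∈ B) h hhB
    exact hh g hg hle

theorem eventuallyPolynomial_hilb_compl {B : Set (Fin r →₀ ℕ)} (hB : IsUpperSet B) :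
    EventuallyPolynomial fun k => (hilb Bᶜ k : ℝ) := by
  obtain ⟨G, hG⟩ := exists_finset_compl_eq_avoiding hB
  rw [hG]
  exact eventuallyPolynomial_hilb_avoiding G

variable {n d : ℕ}

/-- The exponents of the monomials in the `k`-th power of the ideal generated by the monomials
with exponents `a i`. -/
def powerExponents (a : Fin r → (Fin n →₀ ℕ)) (k : ℕ) : Set (Fin n →₀ ℕ) :=
  {u | ∃ h : Fin r →₀ ℕ, h.degree = k ∧ Finsupp.linearCombination ℕ a h ≤ u}

theorem degree_linearCombination {a : Fin r → (Fin n →₀ ℕ)} (ha : ∀ i, (a i).degree = d)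
    (h : Fin r →₀ ℕ) : (Finsupp.linearCombination ℕ a h).degree = d * h.degree := by
  rw [Finsupp.linearCombination_apply, Finsupp.sum_fintype _ _ (by simp), map_sum,
    Finsupp.degree_eq_sum, Finset.mul_sum]
  refine Finset.sum_congr rfl fun i _ => ?_
  rw [map_nsmul, ha, smul_eq_mul, mul_comm]

/-- The factorisations `h` such that the exponent `∑ h i • a i + b` has a factorisation of the same
degree that is smaller in the lexicographic order. -/
def reducible (a : Fin r → (Fin n →₀ ℕ)) (b : Fin n →₀ ℕ) : Set (Fin r →₀ ℕ) :=
  {h | ∃ (h' : Fin r →₀ ℕ) (b' : Fin n →₀ ℕ), h'.degree = h.degree ∧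
    Finsupp.linearCombination ℕ a h' + b' = Finsupp.linearCombination ℕ a h + b ∧
    toLex h' < toLex h}

/-- Adding the same c to a factorisation and to a smaller one keeps the comparison, because the
lexicographic order is translation invariant. -/
theorem isUpperSet_reducible (a : Fin r → (Fin n →₀ ℕ)) (b : Fin n →₀ ℕ) :
    IsUpperSet (reducible a b) := by
  rintro h g hle ⟨h', b', hdeg, heq, hlt⟩
  obtain ⟨c, rfl⟩ := exists_add_of_le hle
  refine ⟨h' + c, b', by rw [map_add, map_add, hdeg], ?_, ?_⟩
  · rw [map_add, map_add, add_right_comm, heq, add_right_comm]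
  · rw [toLex_add, toLex_add]
    exact add_lt_add_left hlt _

/-- Each monomial of the power is counted once, by its lexicographically least factorisation. The
cofactor b has fixed degree e, so its range does not depend on k. -/
theorem hilb_powerExponents {a : Fin r → (Fin n →₀ ℕ)} (ha : ∀ i, (a i).degree = d) (k e : ℕ) :
    hilb (powerExponents a k) (d * k + e) =
      ∑ b ∈ degreeFinset n e, hilb (reducible a b)ᶜ k := by
  classical
  have hcard : ∀ b, hilb (reducible a b)ᶜ k =
      (exponentsOfDegree_finite (reducible a b)ᶜ k).toFinset.card := fun b =>
    Set.ncard_eq_toFinset_card _ _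
  rw [Finset.sum_congr rfl fun b _ => hcard b, ← Finset.card_sigma, hilb,
    Set.ncard_eq_toFinset_card _ (exponentsOfDegree_finite _ _)]
  symm
  refine Finset.card_bij (fun x _ => Finsupp.linearCombination ℕ a x.2 + x.1) ?_ ?_ ?_
  · rintro ⟨b, h⟩ hx
    simp only [Finset.mem_sigma, mem_degreeFinset, Set.Finite.mem_toFinset, exponentsOfDegree,
      Set.mem_ofPred_eq] at hx ⊢
    refine ⟨⟨h, hx.2.2, le_self_add⟩, ?_⟩
    rw [map_add, degree_linearCombination ha, hx.1, hx.2.2]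
  · rintro ⟨b, h⟩ hx ⟨b', h'⟩ hx' heq
    simp only [Finset.mem_sigma, mem_degreeFinset, Set.Finite.mem_toFinset, exponentsOfDegree,
      Set.mem_ofPred_eq] at hx hx' heq
    rcases lt_trichotomy (toLex h) (toLex h') with hlt | hlt | hlt
    · exact absurd ⟨h, b, by rw [hx.2.2, hx'.2.2], heq, hlt⟩ hx'.2.1
    · obtain rfl : h = h' := toLex.injective hlt
      rw [add_left_cancel heq]
    · exact absurd ⟨h', b', by rw [hx.2.2, hx'.2.2], heq.symm, hlt⟩ hx.2.1
  · intro u hu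
    simp only [Set.Finite.mem_toFinset, exponentsOfDegree, Set.mem_ofPred_eq] at hu
    obtain ⟨⟨h₀, hk₀, hle₀⟩, hdeg⟩ := hu
    let F := (degreeFinset r k).filter fun h => Finsupp.linearCombination ℕ a h ≤ u
    obtain ⟨h, hF, hmin⟩ := Finset.exists_min_image F toLex
      ⟨h₀, by simp [F, mem_degreeFinset, hk₀, hle₀]⟩
    simp only [F, Finset.mem_filter, mem_degreeFinset, and_imp] at hF hmin
    have hadd := add_tsub_cancel_of_le hF.2
    refine ⟨⟨u - Finsupp.linearCombination ℕ a h, h⟩, ?_, hadd⟩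
    simp only [Finset.mem_sigma, mem_degreeFinset, Set.Finite.mem_toFinset, exponentsOfDegree,
      Set.mem_ofPred_eq]
    refine ⟨?_, ?_, hF.1⟩
    · have := congrArg Finsupp.degree hadd
      rw [map_add, degree_linearCombination ha, hF.1] at this
      omega
    · rintro ⟨h', b', hdeg', heq, hlt⟩
      rw [hadd] at heq
      exact absurd hlt (not_lt.mpr (hmin h' (hdeg'.trans hF.1) (heq ▸ le_self_add)))

theorem eventuallyPolynomial_hilb_powerExponents {a : Fin r → (Fin n →₀ ℕ)}
    (ha : ∀ i, (a i).degree = d) (e : ℕ) :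
    EventuallyPolynomial fun k => (hilb (powerExponents a k) (d * k + e) : ℝ) := by
  refine (EventuallyPolynomial.sum (degreeFinset n e) fun b _ =>
    eventuallyPolynomial_hilb_compl (isUpperSet_reducible a b)).congr 0 fun k _ => ?_
  rw [hilb_powerExponents ha]
  push_cast
  rfl

end Khovanskii

/-! ### Betti numbers of powers are eventually polynomial -/

section PowersOfMonomialIdeals

open MvPolynomial

universe u

variable {K : Type u} [Field K] {n d r : ℕ}

theorem isMonomialIdealOf_span (B : Set (Fin n →₀ ℕ)) :
    IsMonomialIdealOf (Ideal.span ((fun b => monomial b (1 : K)) '' B)) {u | ∃ b ∈ B, b ≤ u} := by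
  refine ⟨fun u v huv ⟨b, hb, hbu⟩ => ⟨b, hb, hbu.trans huv⟩, fun p => ?_⟩
  rw [mem_ideal_span_monomial_image]
  simp only [mem_support_iff, Set.mem_ofPred_eq]

theorem span_monomial_range_pow (a : Fin r → (Fin n →₀ ℕ)) (k : ℕ) :
    Ideal.span ((fun b => monomial b (1 : K)) '' Set.range a) ^ k =
      Ideal.span ((fun b => monomial b (1 : K)) ''
        (Finsupp.linearCombination ℕ a '' {h | h.degree = k})) := by
  induction k with
  | zero =>
    have : {h : Fin r →₀ ℕ | h.degree = 0} = {0} := by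
      ext h; simp [Finsupp.degree_eq_zero_iff]
    rw [this, pow_zero, Set.image_singleton, Set.image_singleton, map_zero, Ideal.one_eq_top,
      eq_comm, Ideal.eq_top_iff_one]
    exact Ideal.subset_span rfl
  | succ k ih =>
    rw [pow_succ, ih, Ideal.span_mul_span']
    congr 1
    ext p
    simp only [Set.mem_mul, Set.mem_image, Set.mem_range, Set.mem_ofPred_eq]
    constructor
    · rintro ⟨_, ⟨_, ⟨h, hk, rfl⟩, rfl⟩, _, ⟨_, ⟨i, rfl⟩, rfl⟩, rfl⟩
      refine ⟨_, ⟨h + Finsupp.single i 1, ?_, rfl⟩, ?_⟩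
      · rw [map_add, hk, Finsupp.degree_single]
      · rw [map_add, Finsupp.linearCombination_single, one_smul, monomial_mul, one_mul]
    · rintro ⟨_, ⟨h, hk, rfl⟩, rfl⟩
      obtain ⟨i, hi⟩ : ∃ i, h i ≠ 0 := by
        by_contra hall
        push Not at hall
        obtain rfl : h = 0 := Finsupp.ext hall
        simp at hk
      have hle : Finsupp.single i 1 ≤ h := Finsupp.single_le_iff.mpr (Nat.one_le_iff_ne_zero.mpr hi)
      have hadd := tsub_add_cancel_of_le hle
      refine ⟨_, ⟨_, ⟨h - Finsupp.single i 1, ?_, rfl⟩, rfl⟩, _, ⟨_, ⟨i, rfl⟩, rfl⟩, ?_⟩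
      · have := congrArg Finsupp.degree hadd
        rw [map_add, Finsupp.degree_single, hk] at this
        omega
      · rw [monomial_mul, one_mul]
        conv_rhs => rw [← hadd]
        rw [map_add, Finsupp.linearCombination_single, one_smul]

theorem isMonomialIdealOf_pow (a : Fin r → (Fin n →₀ ℕ)) (k : ℕ) :
    IsMonomialIdealOf (Ideal.span ((fun b => monomial b (1 : K)) '' Set.range a) ^ k)
      (powerExponents a k) := by
  rw [span_monomial_range_pow]
  convert isMonomialIdealOf_span (K := K) (Finsupp.linearCombination ℕ a '' {h | h.degree = k})
    using 1
  ext u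
  simp [powerExponents]

theorem powerExponents_generated {a : Fin r → (Fin n →₀ ℕ)} (ha : ∀ i, (a i).degree = d) (k : ℕ) :
    ∀ u ∈ powerExponents a k, ∃ u₀ ∈ powerExponents a k, u₀ ≤ u ∧ u₀.degree = d * k := by
  rintro u ⟨h, hk, hle⟩
  exact ⟨_, ⟨h, hk, le_rfl⟩, hle, by rw [degree_linearCombination ha, hk]⟩

theorem exists_range_eq_of_isMonomialGeneratedInDegree {I : Ideal (MvPolynomial (Fin n) K)}
    (hI : IsMonomialGeneratedInDegree I d) : ∃ (r : ℕ) (a : Fin r → (Fin n →₀ ℕ)),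
      (∀ i, (a i).degree = d) ∧ I = Ideal.span ((fun b => monomial b (1 : K)) '' Set.range a) := by
  obtain ⟨A, hA, rfl⟩ := hI
  have hfin : A.Finite := (Finsupp.finite_of_degree_eq (σ := Fin n) d).subset hA
  obtain ⟨r, a, -, rfl⟩ := hfin.fin_param
  exact ⟨r, a, fun i => hA _ ⟨i, rfl⟩, rfl⟩

/-- The linear strand of the powers of a monomial ideal is eventually polynomial. -/
theorem eventuallyPolynomial_betti {a : Fin r → (Fin n →₀ ℕ)} (ha : ∀ i, (a i).degree = d)
    (hd : 1 ≤ d) {k₁ : ℕ} (hlin : ∀ k, k₁ < k → HasLinearResolution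
      (Ideal.span ((fun b => monomial b (1 : K)) '' Set.range a) ^ k) (d * k))
    {i : ℕ} (hi : i ≤ n) : EventuallyPolynomial fun k =>
      (betti (Ideal.span ((fun b => monomial b (1 : K)) '' Set.range a) ^ k) (i + 1) (d * k + i)
        : ℝ) := by
  refine (EventuallyPolynomial.sum (Finset.range (n + 1)) (f := fun l k => if l ≤ i then
    ((-1) ^ i * (-1) ^ l * (n.choose l : ℝ)) *
      (hilb (powerExponents a k) (d * k + (i - l)) : ℝ) else 0) ?_).congr (k₁ + 1) ?_
  · intro l _
    split_ifs
    · exact (eventuallyPolynomial_hilb_powerExponents ha _).const_mul _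
    · exact eventuallyPolynomial_const 0
  · intro k hk
    have hdeg := degree_le_of_generated (powerExponents_generated ha k)
    have h := betti_eq_sum_hilb (isMonomialIdealOf_pow a k) hdeg
      (Nat.mul_pos hd (by omega)) (hlin k (by omega)) hi
    rw [coeff_one_sub_X_pow_mul] at h
    have hsq : ((-1 : ℝ) ^ i) * (-1) ^ i = 1 := by rw [← mul_pow]; simp
    have h' : (betti (Ideal.span ((fun b => monomial b (1 : K)) '' Set.range a) ^ k) (i + 1)
        (d * k + i) : ℝ) = (-1) ^ i * (((-1) ^ i * (betti (Ideal.span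
          ((fun b => monomial b (1 : K)) '' Set.range a) ^ k) (i + 1) (d * k + i) : ℤ) : ℤ) : ℝ) := by
      push_cast
      rw [← mul_assoc, hsq, one_mul]
    rw [h', h]
    push_cast
    rw [Finset.mul_sum]
    refine Finset.sum_congr rfl fun l _ => ?_
    by_cases hl : l ≤ i
    · rw [if_pos hl, if_pos (by omega), hilbSeries, PowerSeries.coeff_mk,
        show d * k + i - l = d * k + (i - l) by omega]
      push_cast
      ring
    -- For l > i the degree dk + i - l lies below the generators of the power, so the Hilbert
    -- function vanishes there.
    · rw [if_neg hl]
      split_ifs with hl'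
      · rw [hilbSeries, PowerSeries.coeff_mk, hilb_eq_zero_of_lt hdeg subset_rfl (by omega)]
        simp
      · simp

end PowersOfMonomialIdeals

end BettiPowers

end

noncomputable section

namespace BettiPowers

/-! ### Pure diagrams of linear shape and uniqueness of decompositions -/

section PureDiagrams

theorem DegreeSequence.pureDiagram_eq_zero_of_length_lt (δ : DegreeSequence) {i : ℕ}
    (h : δ.length < i) (j : ℕ) : δ.pureDiagram i j = 0 := by
  rw [DegreeSequence.pureDiagram, dif_neg (by omega)]

theorem DegreeSequence.pureDiagram_eq_zero_of_ne (δ : DegreeSequence)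
    (i : Fin (δ.length + 1)) {j : ℕ} (h : j ≠ δ.deg i) : δ.pureDiagram i j = 0 := by
  rw [DegreeSequence.pureDiagram, dif_pos i.2, if_neg h]

theorem DegreeSequence.pureDiagram_deg (δ : DegreeSequence) (i : Fin (δ.length + 1)) :
    δ.pureDiagram i (δ.deg i) = ∏ r ∈ Finset.univ.filter (fun r => r ≠ 0 ∧ r ≠ i),
      (δ.deg r : ℝ) / |(δ.deg r : ℝ) - (δ.deg i : ℝ)| := by
  rw [DegreeSequence.pureDiagram, dif_pos i.2, if_pos rfl]

theorem DegreeSequence.deg_pos (δ : DegreeSequence) {r : Fin (δ.length + 1)} (hr : r ≠ 0) :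
    0 < δ.deg r := by
  rw [← δ.deg_zero]
  exact δ.strictMono (Fin.pos_iff_ne_zero.mpr hr)

theorem DegreeSequence.pureDiagram_deg_pos (δ : DegreeSequence) (i : Fin (δ.length + 1)) :
    0 < δ.pureDiagram i (δ.deg i) := by
  rw [δ.pureDiagram_deg]
  refine Finset.prod_pos fun r hr => ?_
  obtain ⟨hr0, hri⟩ := (Finset.mem_filter.mp hr).2
  refine div_pos (Nat.cast_pos.mpr (δ.deg_pos hr0)) (abs_pos.mpr (sub_ne_zero.mpr ?_))
  exact Nat.cast_injective.ne (δ.strictMono.injective.ne hri)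

theorem DegreeSequence.pureDiagram_nonneg (δ : DegreeSequence) (i j : ℕ) :
    0 ≤ δ.pureDiagram i j := by
  rcases lt_or_ge δ.length i with hi | hi
  · rw [δ.pureDiagram_eq_zero_of_length_lt hi]
  · rcases eq_or_ne j (δ.deg ⟨i, by omega⟩) with rfl | hj
    · exact (δ.pureDiagram_deg_pos ⟨i, by omega⟩).le
    · exact (δ.pureDiagram_eq_zero_of_ne ⟨i, by omega⟩ hj).ge

theorem DegreeSequence.pureDiagram_zero_zero (δ : DegreeSequence) : δ.pureDiagram 0 0 = 1 := by
  have h := δ.pureDiagram_deg 0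
  rw [δ.deg_zero] at h
  refine Eq.trans h (Finset.prod_eq_one fun r hr => ?_)
  have hr0 := (Finset.mem_filter.mp hr).2.1
  have hpos : (0 : ℝ) < δ.deg r := Nat.cast_pos.mpr (δ.deg_pos hr0)
  rw [Nat.cast_zero, sub_zero, abs_of_pos hpos, div_self hpos.ne']

theorem DegreeSequence.pureDiagram_zero_of_ne (δ : DegreeSequence) {j : ℕ} (hj : j ≠ 0) :
    δ.pureDiagram 0 j = 0 :=
  δ.pureDiagram_eq_zero_of_ne 0 (by rwa [δ.deg_zero])

/-- Weights and entries are non-negative, so no cancellation can hide a diagram of positive weight.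
This confines the shape of every diagram that occurs. -/
theorem pos_of_mem_decompositions {β : ℕ → ℕ → ℝ} {w : DegreeSequence →₀ ℝ}
    (hw : w ∈ decompositions β) {δ : DegreeSequence} (hδ : 0 < w δ) (i : Fin (δ.length + 1)) :
    0 < β i (δ.deg i) := by
  rw [← hw.2]
  refine Finset.sum_pos' (fun ε _ => mul_nonneg (hw.1 ε) (ε.pureDiagram_nonneg _ _))
    ⟨δ, Finsupp.mem_support_iff.mpr hδ.ne', mul_pos hδ (δ.pureDiagram_deg_pos i)⟩

/-- The degree sequence `0 < c + 1 < c + 2 < ⋯ < c + p` of a linear resolution. -/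
def linearSequence (c p : ℕ) : DegreeSequence where
  length := p
  deg i := if i = 0 then 0 else c + i
  strictMono := by
    intro i j hij
    have hij' : (i : ℕ) < j := hij
    have hj : j ≠ 0 := by rintro rfl; exact absurd hij (Fin.not_lt_zero i)
    dsimp only
    rw [if_neg hj]
    split_ifs <;> omega
  deg_zero := if_pos rfl

theorem linearSequence_injective (c : ℕ) : Function.Injective (linearSequence c) :=
  fun _ _ h => congrArg DegreeSequence.length h

theorem linearSequence_pureDiagram_of_lt (c : ℕ) {p i : ℕ} (h : p < i) (j : ℕ) :
    (linearSequence c p).pureDiagram i j = 0 :=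
  (linearSequence c p).pureDiagram_eq_zero_of_length_lt h j

theorem linearSequence_pureDiagram_succ_of_ne (c p : ℕ) {s j : ℕ} (h : j ≠ c + (s + 1)) :
    (linearSequence c p).pureDiagram (s + 1) j = 0 := by
  rcases lt_or_ge p (s + 1) with hp | hp
  · exact linearSequence_pureDiagram_of_lt c hp j
  · refine (linearSequence c p).pureDiagram_eq_zero_of_ne
      (⟨s + 1, by omega⟩ : Fin (p + 1)) ?_
    simpa [linearSequence] using h

theorem prod_range_abs_sub (s t : ℕ) :
    ∏ r ∈ Finset.range (s + 1 + t), (if r = s then 1 else |(r : ℝ) - s|) =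
      (s.factorial : ℝ) * t.factorial := by
  rw [Finset.prod_range_add, Finset.prod_range_succ, if_pos rfl, mul_one]
  congr 1
  · rw [← Finset.prod_range_add_one_eq_factorial, Nat.cast_prod, ← Finset.prod_range_reflect]
    refine Finset.prod_congr rfl fun r hr => ?_
    have hr' := Finset.mem_range.mp hr
    rw [if_neg (by omega), Nat.sub_sub, Nat.cast_sub (by omega), sub_sub_cancel_left, abs_neg,
      Nat.abs_cast, add_comm]
  · rw [← Finset.prod_range_add_one_eq_factorial, Nat.cast_prod]
    refine Finset.prod_congr rfl fun r _ => ?_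
    rw [if_neg (by omega)]
    push_cast
    rw [show (s : ℝ) + 1 + r - s = r + 1 by ring, abs_of_nonneg (by positivity)]

/-- The factor by which the binomial coefficients are multiplied in the pure diagram with the
degree sequence `0 < c + 1 < ⋯ < c + 1 + q`. -/
def linearFactor (c q : ℕ) : ℝ :=
  (∏ r ∈ Finset.range (q + 1), ((c : ℝ) + 1 + r)) / q.factorial

theorem linearFactor_pos (c q : ℕ) : 0 < linearFactor c q :=
  div_pos (Finset.prod_pos fun r _ => by positivity) (by positivity)

/-- The numerators are all the degrees except c + 1 + s, and the distances to that degree multiply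
to s!(q-s)!. After multiplication by the degree only a binomial coefficient depends on the column.
-/
theorem linearSequence_pureDiagram_succ (c q s : ℕ) :
    (linearSequence c (q + 1)).pureDiagram (s + 1) (c + (s + 1)) =
      linearFactor c q * q.choose s / ((c : ℝ) + 1 + s) := by
  rcases lt_or_ge q s with hs | hs
  · rw [linearSequence_pureDiagram_of_lt c (by omega), Nat.choose_eq_zero_of_lt hs]
    simp
  obtain ⟨t, rfl⟩ := Nat.exists_eq_add_of_le hs
  have h := (linearSequence c (s + t + 1)).pureDiagram_deg
    (⟨s + 1, by omega⟩ : Fin (s + t + 1 + 1))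
  have hdeg : (linearSequence c (s + t + 1)).deg (⟨s + 1, by omega⟩ : Fin (s + t + 1 + 1)) =
      c + (s + 1) := by simp [linearSequence]
  rw [hdeg] at h
  refine Eq.trans h ?_
  have hprod : ∏ r ∈ Finset.univ.filter (fun r : Fin (s + t + 1 + 1) =>
        r ≠ 0 ∧ r ≠ ⟨s + 1, by omega⟩),
      ((linearSequence c (s + t + 1)).deg r : ℝ) /
        |((linearSequence c (s + t + 1)).deg r : ℝ) - ((c + (s + 1) : ℕ) : ℝ)| =
      ∏ r ∈ Finset.range (s + 1 + t), if r = s then 1 else ((c : ℝ) + 1 + r) / |(r : ℝ) - s| := by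
    rw [Finset.prod_filter, Fin.prod_univ_succ, if_neg (by simp), one_mul,
      show s + 1 + t = s + t + 1 by ring, ← Fin.prod_univ_eq_prod_range
        (fun r => if r = s then 1 else ((c : ℝ) + 1 + r) / |(r : ℝ) - s|)]
    refine Finset.prod_congr rfl fun r _ => ?_
    by_cases hr : (r : ℕ) = s
    · rw [if_pos hr, if_neg]
      simp [Fin.ext_iff, hr]
    · rw [if_neg hr, if_pos ⟨Fin.succ_ne_zero r, by simpa [Fin.ext_iff] using hr⟩]
      have : (linearSequence c (s + t + 1)).deg r.succ = c + (r + 1) := by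
        simp [linearSequence]
      rw [this]
      push_cast
      rw [show (c : ℝ) + (r + 1) - (c + (s + 1)) = r - s by ring,
        show (c : ℝ) + (r + 1) = c + 1 + r by ring]
  refine Eq.trans hprod ?_
  have hne : ((c : ℝ) + 1 + s) ≠ 0 := by positivity
  have hsplit : (∏ r ∈ Finset.range (s + 1 + t),
        if r = s then 1 else ((c : ℝ) + 1 + r) / |(r : ℝ) - s|) * ((c : ℝ) + 1 + s) *
      ∏ r ∈ Finset.range (s + 1 + t), (if r = s then 1 else |(r : ℝ) - s|) =
      ∏ r ∈ Finset.range (s + 1 + t), ((c : ℝ) + 1 + r) := by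
    have hs' : ((c : ℝ) + 1 + s) =
        ∏ r ∈ Finset.range (s + 1 + t), if r = s then ((c : ℝ) + 1 + r) else 1 := by
      rw [Finset.prod_ite_eq', if_pos (Finset.mem_range.mpr (by omega))]
    rw [hs', ← Finset.prod_mul_distrib, ← Finset.prod_mul_distrib]
    refine Finset.prod_congr rfl fun r _ => ?_
    by_cases hr : r = s
    · simp [hr]
    · have : |(r : ℝ) - s| ≠ 0 := abs_ne_zero.mpr (sub_ne_zero.mpr (Nat.cast_injective.ne hr))
      rw [if_neg hr, if_neg hr, if_neg hr, mul_one, div_mul_cancel₀ _ this]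
  rw [prod_range_abs_sub] at hsplit
  rw [linearFactor, show s + t + 1 = s + 1 + t by ring, ← hsplit, Nat.cast_add_choose]
  have h1 : (s.factorial : ℝ) ≠ 0 := by positivity
  have h2 : (t.factorial : ℝ) ≠ 0 := by positivity
  have h3 : ((s + t).factorial : ℝ) ≠ 0 := by positivity
  field_simp

/-- The pure diagrams of the linear degree sequences are linearly independent. -/
theorem eq_zero_of_sum_linearSequence (c N : ℕ) (z : ℕ → ℝ)
    (h : ∀ i j, ∑ p ∈ Finset.range (N + 1), z p * (linearSequence c p).pureDiagram i j = 0) :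
    ∀ p ≤ N, z p = 0 := by
  induction N with
  | zero =>
    intro p hp
    obtain rfl : p = 0 := by omega
    simpa [DegreeSequence.pureDiagram_zero_zero] using h 0 0
  | succ N ih =>
    -- Only the longest diagram reaches column N + 1.
    have hN : z (N + 1) = 0 := by
      have h1 := h (N + 1) (c + (N + 1))
      rw [Finset.sum_range_succ, Finset.sum_eq_zero, zero_add,
        linearSequence_pureDiagram_succ] at h1
      · refine (mul_eq_zero.mp h1).resolve_right (ne_of_gt ?_)
        have := linearFactor_pos c N
        rw [Nat.choose_self]
        positivity
      · intro p hp
        rw [linearSequence_pureDiagram_of_lt c (Finset.mem_range.mp hp), mul_zero]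
    intro p hp
    rcases Nat.lt_or_ge N p with hlt | hle
    · obtain rfl : p = N + 1 := by omega
      exact hN
    · refine ih (fun i j => ?_) p hle
      have := h i j
      rwa [Finset.sum_range_succ, hN, zero_mul, add_zero] at this

theorem sum_linearSequence_unique {c N : ℕ} {y z : ℕ → ℝ}
    (h : ∀ i j, ∑ p ∈ Finset.range (N + 1), y p * (linearSequence c p).pureDiagram i j =
      ∑ p ∈ Finset.range (N + 1), z p * (linearSequence c p).pureDiagram i j) :
    ∀ p ≤ N, y p = z p := by
  intro p hp
  refine sub_eq_zero.mp (eq_zero_of_sum_linearSequence c N (fun p => y p - z p)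
    (fun i j => ?_) p hp)
  simp only [sub_mul, Finset.sum_sub_distrib, h i j, sub_self]

variable {β : ℕ → ℕ → ℝ} {c N : ℕ} {v : ℕ → ℝ}

theorem eq_linearSequence_of_mem_decompositions
    (hsupp : ∀ i j, β i j ≠ 0 → i ≤ N ∧ (i ≠ 0 → j = c + i)) {w : DegreeSequence →₀ ℝ}
    (hw : w ∈ decompositions β) {δ : DegreeSequence} (hδ : w δ ≠ 0) :
    δ.length ≤ N ∧ δ = linearSequence c δ.length := by
  have hpos := pos_of_mem_decompositions hw (lt_of_le_of_ne (hw.1 δ) hδ.symm)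
  refine ⟨(hsupp _ _ (hpos (Fin.last _)).ne').1, ?_⟩
  refine DegreeSequence.ext rfl (heq_of_eq (funext fun i => ?_))
  change δ.deg i = if i = 0 then 0 else c + (i : ℕ)
  split_ifs with hi
  · rw [hi, δ.deg_zero]
  · exact (hsupp _ _ (hpos i).ne').2 fun h => hi (Fin.ext h)

/-- All decompositions of a diagram with a linear shape have the same weights. -/
theorem apply_linearSequence_of_mem_decompositions
    (hsupp : ∀ i j, β i j ≠ 0 → i ≤ N ∧ (i ≠ 0 → j = c + i))
    (hβ : ∀ i j, ∑ p ∈ Finset.range (N + 1), v p * (linearSequence c p).pureDiagram i j = β i j)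
    {w : DegreeSequence →₀ ℝ} (hw : w ∈ decompositions β) :
    ∀ p ≤ N, w (linearSequence c p) = v p := by
  classical
  refine sum_linearSequence_unique (c := c) fun i j => ?_
  rw [hβ, ← hw.2 i j, Finsupp.sum_of_support_subset (s := (Finset.range (N + 1)).image
    (linearSequence c)) _ ?_ _ (by simp), Finset.sum_image (linearSequence_injective c).injOn]
  intro δ hδ
  obtain ⟨h1, h2⟩ := eq_linearSequence_of_mem_decompositions hsupp hw
    (Finsupp.mem_support_iff.mp hδ)
  exact Finset.mem_image.mpr ⟨δ.length, Finset.mem_range.mpr (by omega), h2.symm⟩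

theorem occurringPure_eq
    (hsupp : ∀ i j, β i j ≠ 0 → i ≤ N ∧ (i ≠ 0 → j = c + i))
    (hβ : ∀ i j, ∑ p ∈ Finset.range (N + 1), v p * (linearSequence c p).pureDiagram i j = β i j)
    (hv : ∀ p ≤ N, 0 ≤ v p) :
    occurringPure β = linearSequence c '' {p | p ≤ N ∧ v p ≠ 0} := by
  classical
  ext δ
  constructor
  · rintro ⟨w, hw, hδ⟩
    obtain ⟨h1, h2⟩ := eq_linearSequence_of_mem_decompositions hsupp hw hδ.ne'
    refine ⟨δ.length, ⟨h1, ?_⟩, h2.symm⟩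
    rw [← apply_linearSequence_of_mem_decompositions hsupp hβ hw _ h1, ← h2]
    exact hδ.ne'
  · rintro ⟨p, ⟨hp, hvp⟩, rfl⟩
    let w : DegreeSequence →₀ ℝ :=
      ∑ q ∈ Finset.range (N + 1), Finsupp.single (linearSequence c q) (v q)
    have happ : ∀ δ, w δ = ∑ q ∈ Finset.range (N + 1),
        if linearSequence c q = δ then v q else 0 := fun δ => by
      simp only [w, Finsupp.finsetSum_apply, Finsupp.single_apply]
    refine ⟨w, ⟨fun δ => ?_, fun i j => ?_⟩, ?_⟩
    · rw [happ]
      refine Finset.sum_nonneg fun q hq => ?_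
      split_ifs
      · exact hv q (Nat.lt_succ_iff.mp (Finset.mem_range.mp hq))
      · exact le_rfl
    · rw [← hβ]
      simp only [w]
      rw [← Finsupp.sum_finsetSum_index (by simp) (by intros; ring)]
      refine Finset.sum_congr rfl fun q _ => ?_
      rw [Finsupp.sum_single_index (by simp)]
    · rw [happ, Finset.sum_eq_single_of_mem p (Finset.mem_range.mpr (by omega)), if_pos rfl]
      · exact lt_of_le_of_ne (hv p hp) hvp.symm
      · intro q _ hq
        exact if_neg ((linearSequence_injective c).ne hq)

theorem decompositionPolytope_eq
    (hβ : ∀ i j, ∑ p ∈ Finset.range (N + 1), v p * (linearSequence c p).pureDiagram i j = β i j)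
    (hv : ∀ p ≤ N, 0 ≤ v p) {m : ℕ} {e : Fin m → ℕ} (he : Function.Injective e)
    (hrange : ∀ p, p ∈ Set.range e ↔ p ≤ N ∧ v p ≠ 0) :
    decompositionPolytope β (fun s => linearSequence c (e s)) = {fun s => v (e s)} := by
  classical
  have hsum : ∀ (y : ℕ → ℝ) i j, (∀ p ≤ N, p ∉ Set.range e → y p = 0) →
      ∑ s, y (e s) * (linearSequence c (e s)).pureDiagram i j =
        ∑ p ∈ Finset.range (N + 1), y p * (linearSequence c p).pureDiagram i j := by
    intro y i j hy
    rw [← Finset.sum_image (s := Finset.univ) (g := e)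
      (f := fun p => y p * (linearSequence c p).pureDiagram i j) he.injOn]
    refine Finset.sum_subset (fun p hp => ?_) fun p hp hpe => ?_
    · obtain ⟨s, -, rfl⟩ := Finset.mem_image.mp hp
      exact Finset.mem_range.mpr (Nat.lt_succ_iff.mpr ((hrange _).mp ⟨s, rfl⟩).1)
    · rw [hy p (Nat.lt_succ_iff.mp (Finset.mem_range.mp hp)) (by simpa using hpe), zero_mul]
  have hv0 : ∀ p ≤ N, p ∉ Set.range e → v p = 0 := fun p hp hpe => by
    by_contra hne
    exact hpe ((hrange p).mpr ⟨hp, hne⟩)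
  ext x
  rw [Set.mem_singleton_iff]
  constructor
  · rintro ⟨-, hx⟩
    have hext : ∀ s, Function.extend e x 0 (e s) = x s := he.extend_apply x 0
    funext s
    rw [← hext]
    -- The weight vector is extended by zero to all lengths, so that linear independence applies.
    refine sum_linearSequence_unique (c := c) (fun i j => ?_) (e s) ((hrange _).mp ⟨s, rfl⟩).1
    rw [hβ, ← hx i j, ← hsum (Function.extend e x 0) i j fun p _ hpe =>
      Function.extend_apply' _ _ _ hpe]
    simp only [hext]
  · rintro rfl
    refine ⟨fun s => hv _ ((hrange _).mp ⟨s, rfl⟩).1, fun i j => ?_⟩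
    rw [hsum v i j hv0, hβ]

end PureDiagrams

/-! ### Binomial inversion and partial fractions -/

section BinomialIdentities

/-- Binomial inversion. -/
theorem eq_sum_of_eq_sum_choose {n : ℕ} {b y : ℕ → ℝ}
    (h : ∀ s ≤ n, b s = ∑ q ∈ Finset.range (n + 1), y q * q.choose s) :
    ∀ q ≤ n, y q = ∑ s ∈ Finset.range (n + 1), (-1) ^ (s - q) * (s.choose q : ℝ) * b s := by
  intro q hq
  let Y : Polynomial ℝ := ∑ q ∈ Finset.range (n + 1), Polynomial.C (y q) * Polynomial.X ^ q
  let B : Polynomial ℝ := ∑ s ∈ Finset.range (n + 1), Polynomial.C (b s) * Polynomial.X ^ s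
  -- With generating polynomials the hypothesis says Y(x+1) = B(x), so the inverse is Y(x) = B(x-1).
  have hYB : Y.comp (Polynomial.X + Polynomial.C 1) = B := by
    ext s
    simp only [Y, B, Polynomial.sum_comp, Polynomial.mul_comp, Polynomial.C_comp,
      Polynomial.X_pow_comp, Polynomial.finsetSum_coeff, Polynomial.coeff_C_mul,
      Polynomial.coeff_X_add_C_pow, one_pow, one_mul, Polynomial.coeff_X_pow, mul_ite, mul_one,
      mul_zero, Finset.sum_ite_eq, Finset.mem_range]
    split_ifs with hs
    · exact (h s (by omega)).symm
    · refine Finset.sum_eq_zero fun q hq => ?_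
      have := Finset.mem_range.mp hq
      rw [Nat.choose_eq_zero_of_lt (by omega)]
      simp
  have hBY : Y = B.comp (Polynomial.X + Polynomial.C (-1)) := by
    rw [← hYB, Polynomial.comp_assoc]
    simp
  have hcoeff := congrArg (fun P => Polynomial.coeff P q) hBY
  simp only [Y, B, Polynomial.sum_comp, Polynomial.mul_comp, Polynomial.C_comp,
    Polynomial.X_pow_comp, Polynomial.finsetSum_coeff, Polynomial.coeff_C_mul,
    Polynomial.coeff_X_add_C_pow, Polynomial.coeff_X_pow, mul_ite, mul_one, mul_zero,
    Finset.sum_ite_eq, Finset.mem_range] at hcoeff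
  rw [if_pos (by omega)] at hcoeff
  rw [hcoeff]
  exact Finset.sum_congr rfl fun s _ => by ring

/-- The partial fraction expansion of q!/(x(x+1)⋯(x+q)). By Pascal's rule the sum for q + 1 at x is
the difference of the sums for q at x and at x + 1. -/
theorem sum_neg_one_pow_choose_div (q : ℕ) : ∀ x : ℝ, 0 < x →
    ∑ s ∈ Finset.range (q + 1), (-1) ^ s * (q.choose s : ℝ) / (x + s) =
      q.factorial / ∏ r ∈ Finset.range (q + 1), (x + r) := by
  induction q with
  | zero => intro x _; simp
  | succ q ih =>
    intro x hx
    have hsplit : ∑ s ∈ Finset.range (q + 1 + 1), (-1) ^ s * ((q + 1).choose s : ℝ) / (x + s) =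
        (∑ s ∈ Finset.range (q + 1), (-1) ^ s * (q.choose s : ℝ) / (x + s)) -
          ∑ s ∈ Finset.range (q + 1), (-1) ^ s * (q.choose s : ℝ) / (x + 1 + s) := by
      have h1 : ∑ s ∈ Finset.range (q + 1), (-1) ^ s * (q.choose s : ℝ) / (x + s) =
          ∑ s ∈ Finset.range (q + 1 + 1), (-1) ^ s * (q.choose s : ℝ) / (x + s) := by
        rw [Finset.sum_range_succ _ (q + 1), Nat.choose_succ_self]
        simp
      rw [h1, Finset.sum_range_succ', Finset.sum_range_succ' _ (q + 1), add_sub_right_comm,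
        ← Finset.sum_sub_distrib]
      congr 1
      · refine Finset.sum_congr rfl fun s _ => ?_
        rw [Nat.choose_succ_succ]
        push_cast
        rw [show x + 1 + (s : ℝ) = x + (s + 1) by ring]
        ring
      · simp
    rw [hsplit, ih x hx, ih (x + 1) (by linarith)]
    have hP : ∏ r ∈ Finset.range (q + 1), (x + r) =
        x * ∏ r ∈ Finset.range q, (x + 1 + r) := by
      rw [Finset.prod_range_succ', mul_comm]
      congr 1
      · simp
      · exact Finset.prod_congr rfl fun r _ => by push_cast; ring
    have hP' : ∏ r ∈ Finset.range (q + 1 + 1), (x + r) =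
        x * (∏ r ∈ Finset.range q, (x + 1 + r)) * (x + 1 + q) := by
      rw [Finset.prod_range_succ, hP]
      push_cast
      ring
    rw [hP, hP', Finset.prod_range_succ]
    have hpos : 0 < ∏ r ∈ Finset.range q, (x + 1 + r) :=
      Finset.prod_pos fun r _ => by positivity
    have h2 : 0 < x + 1 + q := by positivity
    rw [Nat.factorial_succ]
    push_cast
    field_simp
    ring

theorem sum_neg_one_pow_choose_div_linearFactor {n q : ℕ} (hq : q ≤ n) (c : ℕ) :
    ∑ s ∈ Finset.range (n + 1), (-1) ^ s * (q.choose s : ℝ) / ((c : ℝ) + 1 + s) =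
      (linearFactor c q)⁻¹ := by
  rw [linearFactor, inv_div, ← sum_neg_one_pow_choose_div q _ (by positivity)]
  symm
  refine Finset.sum_subset (Finset.range_mono (by omega)) fun s _ hs => ?_
  rw [Nat.choose_eq_zero_of_lt (by simpa using hs)]
  simp

end BinomialIdentities

end BettiPowers

end

noncomputable section

namespace BettiPowers

/-! ### The decomposition of a linear Betti diagram -/

section LinearDecomposition

universe u

variable {K : Type u} [Field K] {n : ℕ} {J : Ideal (MvPolynomial (Fin n) K)}
  {U : Set (Fin n →₀ ℕ)} {c : ℕ}

theorem betti_eq_zero_of_card_lt {i : ℕ} (h : n < i) (j : ℕ) : betti J i j = 0 :=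
  betti_eq_zero_of_koszulChains_eq_bot (koszulChains_eq_bot_of_card_lt h j)

theorem bettiDiagram_support (hlin : HasLinearResolution J (c + 1)) (i j : ℕ)
    (h : bettiDiagram J i j ≠ 0) : i ≤ n + 1 ∧ (i ≠ 0 → j = c + i) := by
  have hne : betti J i j ≠ 0 := fun h0 => h (by rw [bettiDiagram, h0, Nat.cast_zero])
  refine ⟨?_, fun hi => ?_⟩
  · by_contra hlt
    exact hne (betti_eq_zero_of_card_lt (by omega) j)
  · have := hlin i j (by omega) hne
    omega

/-- The weight of the pure diagram of length `p` in the decomposition of a Betti diagram with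
linear strand `B`. -/
def linearWeight (n c : ℕ) (B : ℕ → ℝ) : ℕ → ℝ
  | 0 => 1 + ∑ s ∈ Finset.range (n + 1), (-1) ^ (s + 1) * B s
  | q + 1 => (∑ s ∈ Finset.range (n + 1), (-1) ^ (s - q) * (s.choose q : ℝ) *
      (((c : ℝ) + 1 + s) * B s)) / linearFactor c q

/-- Binomial inversion recovers the non-negative integers Γ, reindexed by q = n - j, from the Betti
numbers. -/
theorem exists_linearWeight_succ (hJ : IsMonomialIdealOf J U)
    (hgen : ∀ u ∈ U, ∃ u₀ ∈ U, u₀ ≤ u ∧ u₀.degree = c + 1)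
    (hlin : HasLinearResolution J (c + 1)) : ∃ Γ : ℕ → ℕ,
      (∀ s ≤ n, ((c : ℝ) + 1 + s) * betti J (s + 1) (c + 1 + s) =
        ∑ q ∈ Finset.range (n + 1), (Γ q : ℝ) * q.choose s) ∧
      ∀ q ≤ n, linearWeight n c (fun s => betti J (s + 1) (c + 1 + s)) (q + 1) =
        Γ q / linearFactor c q := by
  obtain ⟨Γ, hΓ⟩ := exists_betti_eq_sum_choose hJ hgen (Nat.succ_pos c) hlin
  have h : ∀ s ≤ n, ((c : ℝ) + 1 + s) * betti J (s + 1) (c + 1 + s) =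
      ∑ q ∈ Finset.range (n + 1), (Γ (n - q) : ℝ) * q.choose s := by
    intro s hs
    rw [← Finset.sum_range_reflect]
    have := congrArg (Nat.cast : ℕ → ℝ) (hΓ s hs)
    push_cast at this
    rw [this]
    refine Finset.sum_congr rfl fun j hj => ?_
    have := Finset.mem_range.mp hj
    rw [show n + 1 - 1 - j = n - j by omega, Nat.sub_sub_self (by omega)]
  refine ⟨fun q => Γ (n - q), h, fun q hq => ?_⟩
  rw [linearWeight, ← eq_sum_of_eq_sum_choose h q hq]

/-- The weights must add up to 1, the entry in the top left corner. Inserting the expansion of the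
Betti numbers, the alternating sum over the columns is evaluated by the partial fraction identity.
-/
theorem linearWeight_zero_eq (hJ : IsMonomialIdealOf J U)
    (hgen : ∀ u ∈ U, ∃ u₀ ∈ U, u₀ ≤ u ∧ u₀.degree = c + 1)
    (hlin : HasLinearResolution J (c + 1)) :
    linearWeight n c (fun s => betti J (s + 1) (c + 1 + s)) 0 = 1 - ∑ q ∈ Finset.range (n + 1),
      linearWeight n c (fun s => betti J (s + 1) (c + 1 + s)) (q + 1) := by
  obtain ⟨Γ, hΓ, hw⟩ := exists_linearWeight_succ hJ hgen hlin
  rw [Finset.sum_congr rfl fun q hq => hw q (Nat.lt_succ_iff.mp (Finset.mem_range.mp hq)),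
    linearWeight, sub_eq_add_neg, ← Finset.sum_neg_distrib]
  congr 1
  have hB : ∀ s ∈ Finset.range (n + 1), (-1 : ℝ) ^ (s + 1) * betti J (s + 1) (c + 1 + s) =
      ∑ q ∈ Finset.range (n + 1),
        -(Γ q * ((-1) ^ s * (q.choose s : ℝ) / ((c : ℝ) + 1 + s))) := by
    intro s hs
    have hpos : ((c : ℝ) + 1 + s) ≠ 0 := by positivity
    have h := hΓ s (Nat.lt_succ_iff.mp (Finset.mem_range.mp hs))
    rw [eq_div_of_mul_eq hpos (((mul_comm _ _).trans h)), ← mul_div_assoc, Finset.mul_sum,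
      Finset.sum_div]
    refine Finset.sum_congr rfl fun q _ => ?_
    ring
  rw [Finset.sum_congr rfl hB, Finset.sum_comm]
  refine Finset.sum_congr rfl fun q hq => ?_
  rw [Finset.sum_neg_distrib, ← Finset.mul_sum, sum_neg_one_pow_choose_div_linearFactor
    (Nat.lt_succ_iff.mp (Finset.mem_range.mp hq)), div_eq_mul_inv]

theorem linearWeight_nonneg (hJ : IsMonomialIdealOf J U)
    (hgen : ∀ u ∈ U, ∃ u₀ ∈ U, u₀ ≤ u ∧ u₀.degree = c + 1)
    (hlin : HasLinearResolution J (c + 1)) (p : ℕ) (hp : p ≤ n + 1) :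
    0 ≤ linearWeight n c (fun s => betti J (s + 1) (c + 1 + s)) p := by
  rcases p with _ | q
  · have h := alternatingSum_betti_nonneg hJ (degree_le_of_generated hgen) (Nat.succ_pos c) hlin
    rw [linearWeight, Finset.sum_range_succ, betti_eq_zero_of_card_lt (Nat.lt_succ_self n),
      Nat.cast_zero, mul_zero, add_zero]
    exact_mod_cast h
  · obtain ⟨Γ, -, hw⟩ := exists_linearWeight_succ hJ hgen hlin
    rw [hw q (by omega)]
    have := linearFactor_pos c q
    positivity

theorem sum_linearWeight (hJ : IsMonomialIdealOf J U)
    (hgen : ∀ u ∈ U, ∃ u₀ ∈ U, u₀ ≤ u ∧ u₀.degree = c + 1)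
    (hlin : HasLinearResolution J (c + 1)) (i j : ℕ) :
    ∑ p ∈ Finset.range (n + 1 + 1), linearWeight n c (fun s => betti J (s + 1) (c + 1 + s)) p *
      (linearSequence c p).pureDiagram i j = bettiDiagram J i j := by
  rcases i with _ | s
  · rcases eq_or_ne j 0 with rfl | hj
    · have h0 : (0 : Fin n →₀ ℕ) ∉ U := fun h => by
        have := degree_le_of_generated hgen 0 h
        simp at this
      simp only [DegreeSequence.pureDiagram_zero_zero, mul_one]
      rw [Finset.sum_range_succ', linearWeight_zero_eq hJ hgen hlin, add_sub_cancel, bettiDiagram,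
        betti_zero_zero hJ h0, Nat.cast_one]
    · simp only [DegreeSequence.pureDiagram_zero_of_ne _ hj, mul_zero, Finset.sum_const_zero]
      rw [bettiDiagram, betti_zero_eq_zero (by omega), Nat.cast_zero]
  · rcases eq_or_ne j (c + (s + 1)) with rfl | hj
    · rcases Nat.lt_or_ge n s with hs | hs
      · rw [bettiDiagram, betti_eq_zero_of_card_lt (by omega), Nat.cast_zero]
        refine Finset.sum_eq_zero fun p hp => ?_
        have := Finset.mem_range.mp hp
        rw [linearSequence_pureDiagram_of_lt c (by omega), mul_zero]
      · obtain ⟨Γ, hΓ, hw⟩ := exists_linearWeight_succ hJ hgen hlin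
        have hpos : ((c : ℝ) + 1 + s) ≠ 0 := by positivity
        rw [Finset.sum_range_succ', linearSequence_pureDiagram_of_lt c (by omega), mul_zero,
          add_zero, bettiDiagram, show c + (s + 1) = c + 1 + s by ring,
          eq_div_of_mul_eq hpos (((mul_comm _ _).trans (hΓ s hs))), Finset.sum_div]
        refine Finset.sum_congr rfl fun q hq => ?_
        have hM := (linearFactor_pos c q).ne'
        rw [hw q (Nat.lt_succ_iff.mp (Finset.mem_range.mp hq)),
          show c + 1 + s = c + (s + 1) by ring, linearSequence_pureDiagram_succ]
        field_simp
    · simp only [linearSequence_pureDiagram_succ_of_ne c _ hj, mul_zero, Finset.sum_const_zero]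
      rw [bettiDiagram, hlin.betti_eq_zero (by omega), Nat.cast_zero]

end LinearDecomposition

/-! ### Weights as rational functions of the exponent -/

section Powers

universe u

variable {K : Type u} [Field K] {n d r : ℕ}

theorem isTranslation_linearSequence (hd : 1 ≤ d) (p : ℕ) :
    IsTranslation fun k => linearSequence (d * k - 1) p := by
  -- A linear resolution occupies the single row dk - 1.
  refine ⟨p, d, -1, fun _ => 0, fun k hk => ⟨rfl, fun i hi => ?_⟩⟩
  have hdk : 1 ≤ d * k := Nat.mul_pos hd hk
  change ((if i = 0 then 0 else d * k - 1 + (i : ℕ) : ℕ) : ℤ) - (i : ℕ) = _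
  rw [if_neg hi]
  push_cast [hdk]
  ring

/-- The weights of a family of linear strands that is eventually polynomial are eventually given
by rational functions. -/
theorem exists_linearWeight_eq_div (hd : 1 ≤ d) {B : ℕ → ℕ → ℝ}
    (hB : ∀ s ≤ n, EventuallyPolynomial fun k => B k s) (p : ℕ) :
    ∃ (P Q : Polynomial ℝ) (N : ℕ), ∀ k, N ≤ k → Q.eval (k : ℝ) ≠ 0 ∧
      linearWeight n (d * k - 1) (B k) p = P.eval (k : ℝ) / Q.eval (k : ℝ) := by
  have hcast : ∀ k, 1 ≤ k → ((d * k - 1 : ℕ) : ℝ) + 1 = d * k := fun k hk => by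
    rw [Nat.cast_sub (Nat.mul_pos hd hk)]
    push_cast
    ring
  rcases p with _ | q
  · obtain ⟨P, N, hP⟩ := (eventuallyPolynomial_const 1).add
      (EventuallyPolynomial.sum (Finset.range (n + 1)) fun s hs =>
        (hB s (Nat.lt_succ_iff.mp (Finset.mem_range.mp hs))).const_mul ((-1) ^ (s + 1)))
    refine ⟨P, 1, N, fun k hk => ⟨by simp, ?_⟩⟩
    rw [Polynomial.eval_one, div_one, ← hP k hk, linearWeight]
  · have hlinear : ∀ s : ℕ, EventuallyPolynomial fun k => (d : ℝ) * k + s := fun s =>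
      ⟨Polynomial.C (d : ℝ) * Polynomial.X + Polynomial.C (s : ℝ), 0, fun k _ => by simp⟩
    obtain ⟨P, N, hP⟩ := EventuallyPolynomial.sum (Finset.range (n + 1)) fun s hs =>
        ((hlinear s).mul (hB s (Nat.lt_succ_iff.mp (Finset.mem_range.mp hs)))).const_mul
          ((-1) ^ (s - q) * (s.choose q : ℝ))
    -- Since c + 1 = dk, dividing by `linearFactor` means multiplying by q! and dividing by the
    -- product of the dk + r, which is positive for k ≥ 1.
    refine ⟨P * Polynomial.C (q.factorial : ℝ), ∏ r ∈ Finset.range (q + 1),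
      (Polynomial.C (d : ℝ) * Polynomial.X + Polynomial.C (r : ℝ)), max N 1, fun k hk => ?_⟩
    have hk1 : 1 ≤ k := le_trans (le_max_right _ _) hk
    have hkN : N ≤ k := le_trans (le_max_left _ _) hk
    have heval : (∏ r ∈ Finset.range (q + 1), (Polynomial.C (d : ℝ) * Polynomial.X +
        Polynomial.C (r : ℝ))).eval (k : ℝ) = ∏ r ∈ Finset.range (q + 1), ((d : ℝ) * k + r) := by
      rw [Polynomial.eval_prod]
      simp
    have hpos : 0 < ∏ r ∈ Finset.range (q + 1), ((d : ℝ) * k + r) :=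
      Finset.prod_pos fun r _ => by
        have : (0 : ℝ) < d := Nat.cast_pos.mpr hd
        have : (0 : ℝ) < k := Nat.cast_pos.mpr hk1
        positivity
    rw [heval]
    refine ⟨hpos.ne', ?_⟩
    rw [Polynomial.eval_mul, Polynomial.eval_C, ← hP k hkN, linearWeight, linearFactor]
    simp only [hcast k hk1]
    rw [div_div_eq_mul_div]

theorem occurringPure_zero : occurringPure (0 : ℕ → ℕ → ℝ) = ∅ := by
  refine Set.eq_empty_of_forall_notMem ?_
  rintro δ ⟨w, hw, hδ⟩
  exact (pos_of_mem_decompositions hw hδ 0).ne rfl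

theorem bettiDiagram_top : bettiDiagram (⊤ : Ideal (MvPolynomial (Fin n) K)) = 0 := by
  have : Subsingleton (MvPolynomial (Fin n) K ⧸ (⊤ : Ideal (MvPolynomial (Fin n) K))) :=
    Ideal.Quotient.subsingleton_iff.mpr rfl
  funext i j
  have hbot : koszulChains (⊤ : Ideal (MvPolynomial (Fin n) K)) i j = ⊥ :=
    Subsingleton.elim _ _
  rw [bettiDiagram, betti_eq_zero_of_koszulChains_eq_bot hbot, Nat.cast_zero]
  rfl

/-- For D = 0 a Betti number with i ≥ 1 could sit only at j = i - 1, where there are no Koszul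
chains; so all of them vanish. -/
theorem HasLinearResolution.of_zero {J : Ideal (MvPolynomial (Fin n) K)}
    (h : HasLinearResolution J 0) (D : ℕ) : HasLinearResolution J D := by
  intro i j hi hne
  have := h i j hi hne
  exact absurd (betti_eq_zero_of_koszulChains_eq_bot (koszulChains_eq_bot_of_lt (by omega))) hne

theorem exists_decomposition_of_pos (I : Ideal (MvPolynomial (Fin n) K))
    (hI : IsMonomialGeneratedInDegree I d) (hd : 1 ≤ d)
    (hlin : ∃ k₁ : ℕ, ∀ k : ℕ, k₁ < k → HasLinearResolution (I ^ k) (d * k)) :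
    ∃ (k₀ m : ℕ) (π : Fin m → ℕ → DegreeSequence) (p q : Fin m → Polynomial ℝ),
      (∀ s, IsTranslation (π s)) ∧
      ∀ k : ℕ, k₀ < k →
        Function.Injective (fun s => π s k) ∧
        occurringPure (bettiDiagram (I ^ k)) = Set.range (fun s => π s k) ∧
        (∀ s, (q s).eval (k : ℝ) ≠ 0) ∧
        decompositionPolytope (bettiDiagram (I ^ k)) (fun s => π s k) =
          {fun s => (p s).eval (k : ℝ) / (q s).eval (k : ℝ)} := by
  obtain ⟨r, a, ha, rfl⟩ := exists_range_eq_of_isMonomialGeneratedInDegree hI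
  obtain ⟨k₁, hlin⟩ := hlin
  set I := Ideal.span ((fun b => MvPolynomial.monomial b (1 : K)) '' Set.range a)
  choose P Q N hPQ using exists_linearWeight_eq_div (n := n) hd
    (B := fun k s => (betti (I ^ k) (s + 1) (d * k + s) : ℝ))
    (fun s hs => eventuallyPolynomial_betti ha hd hlin hs)
  -- A numerator is the zero polynomial or has no large roots, so the set `T` of occurring lengths
  -- does not depend on k.
  have hroots : ∀ p, ∃ M : ℕ, P p ≠ 0 → ∀ k, M ≤ k → (P p).eval (k : ℝ) ≠ 0 := by
    intro p
    by_cases hP : P p = 0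
    · exact ⟨0, fun h => absurd hP h⟩
    · obtain ⟨M, hM⟩ := Filter.eventually_atTop.mp
        (tendsto_natCast_atTop_atTop.eventually (Polynomial.eventually_atTop_not_isRoot (P p) hP))
      exact ⟨M, fun _ k hk => hM k hk⟩
  choose M hM using hroots
  let T := (Finset.range (n + 1 + 1)).filter fun p => P p ≠ 0
  let e : Fin T.card → ℕ := T.orderEmbOfFin rfl
  have he : Function.Injective e := (T.orderEmbOfFin rfl).injective
  have hrange : ∀ p, p ∈ Set.range e ↔ p ∈ T := fun p => by
    simp only [e, Finset.range_orderEmbOfFin, Finset.mem_coe]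
  -- The sum dominates all the finitely many bounds at once.
  let k₀ := k₁ + ∑ p ∈ Finset.range (n + 1 + 1), (N p + M p)
  refine ⟨k₀, T.card, fun s k => linearSequence (d * k - 1) (e s), fun s => P (e s),
    fun s => Q (e s), fun s => isTranslation_linearSequence hd _, fun k hk => ?_⟩
  have hkNM : ∀ p ≤ n + 1, N p + M p ≤ k := fun p hp =>
    (Finset.single_le_sum (f := fun p => N p + M p) (fun _ _ => Nat.zero_le _)
      (Finset.mem_range.mpr (show p < n + 1 + 1 by omega))).trans (by omega)
  have hdk : 1 ≤ d * k := Nat.mul_pos hd (by omega)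
  have hc : d * k - 1 + 1 = d * k := Nat.sub_add_cancel hdk
  have hJ : IsMonomialIdealOf (I ^ k) (powerExponents a k) := isMonomialIdealOf_pow a k
  have hgen := powerExponents_generated ha k
  have hlink := hlin k (by omega)
  rw [← hc] at hgen hlink
  have hsupp := bettiDiagram_support hlink
  have hβ := sum_linearWeight hJ hgen hlink
  have hv := linearWeight_nonneg hJ hgen hlink
  rw [hc] at hβ hv
  have heT : ∀ p, p ∈ Set.range e ↔ p ≤ n + 1 ∧
      linearWeight n (d * k - 1) (fun s => (betti (I ^ k) (s + 1) (d * k + s) : ℝ)) p ≠ 0 := by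
    intro p
    rw [hrange, Finset.mem_filter, Finset.mem_range, Nat.lt_succ_iff]
    refine and_congr_right fun hp => ?_
    obtain ⟨hQ, hw⟩ := hPQ p k (by have := hkNM p hp; omega)
    rw [hw]
    constructor
    · intro hP
      exact div_ne_zero (hM p hP k (by have := hkNM p hp; omega)) hQ
    · intro h hP
      exact h (by rw [hP, Polynomial.eval_zero, zero_div])
  have hePQ : ∀ s, (Q (e s)).eval (k : ℝ) ≠ 0 ∧
      linearWeight n (d * k - 1) (fun s => (betti (I ^ k) (s + 1) (d * k + s) : ℝ)) (e s) =
        (P (e s)).eval (k : ℝ) / (Q (e s)).eval (k : ℝ) := fun s =>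
    hPQ (e s) k (by have := hkNM (e s) ((heT _).mp ⟨s, rfl⟩).1; omega)
  refine ⟨fun s t h => he (linearSequence_injective _ h), ?_, fun s => (hePQ s).1, ?_⟩
  · rw [occurringPure_eq hsupp hβ hv]
    ext δ
    constructor
    · rintro ⟨p, hp, rfl⟩
      obtain ⟨s, rfl⟩ := (heT p).mpr hp
      exact ⟨s, rfl⟩
    · rintro ⟨s, rfl⟩
      exact ⟨_, (heT _).mp ⟨s, rfl⟩, rfl⟩
  · rw [decompositionPolytope_eq hβ hv he heT]
    congr 1
    funext s
    exact (hePQ s).2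

end Powers

end BettiPowers

end

open BettiPowers
theorem mainTheorem1 {K : Type*} [Field K] (n d : ℕ)
    (I : Ideal (MvPolynomial (Fin n) K))
    (hI : IsMonomialGeneratedInDegree I d)
    (hlin : ∃ k₁ : ℕ, ∀ k : ℕ, k₁ < k → HasLinearResolution (I ^ k) (d * k)) :
    ∃ (k₀ m : ℕ) (π : Fin m → ℕ → DegreeSequence) (p q : Fin m → Polynomial ℝ),
      (∀ s, IsTranslation (π s)) ∧
      ∀ k : ℕ, k₀ < k →
        Function.Injective (fun s => π s k) ∧
        occurringPure (bettiDiagram (I ^ k)) = Set.range (fun s => π s k) ∧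
        (∀ s, (q s).eval (k : ℝ) ≠ 0) ∧
        decompositionPolytope (bettiDiagram (I ^ k)) (fun s => π s k) =
          {fun s => (p s).eval (k : ℝ) / (q s).eval (k : ℝ)} := by
  rcases Nat.eq_zero_or_pos d with rfl | hd
  · obtain ⟨A, hA, rfl⟩ := hI
    rcases A.eq_empty_or_nonempty with rfl | ⟨a, ha⟩
    · refine exists_decomposition_of_pos (d := 1) _ ⟨∅, by simp, rfl⟩ le_rfl ?_
      obtain ⟨k₁, hlin⟩ := hlin
      refine ⟨k₁, fun k hk => HasLinearResolution.of_zero ?_ _⟩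
      simpa using hlin k hk
    · have htop : Ideal.span ((fun a => MvPolynomial.monomial a (1 : K)) '' A) = ⊤ := by
        rw [Ideal.eq_top_iff_one]
        refine Ideal.subset_span ⟨a, ha, ?_⟩
        rw [(Finsupp.degree_eq_zero_iff a).mp (hA a ha)]
        rfl
      -- The unit ideal has the zero diagram, whose only decomposition is empty: m = 0.
      refine ⟨0, 0, finZeroElim, finZeroElim, finZeroElim, finZeroElim, fun k hk =>
        ⟨Function.injective_of_subsingleton _, ?_, finZeroElim, ?_⟩⟩
      · rw [htop, Ideal.top_pow, bettiDiagram_top, occurringPure_zero, Set.range_eq_empty]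
      · rw [htop, Ideal.top_pow, bettiDiagram_top]
        refine Set.eq_singleton_iff_unique_mem.mpr
          ⟨⟨finZeroElim, fun i j => by simp⟩, fun x _ => Subsingleton.elim _ _⟩
  · exact exists_decomposition_of_pos I hI hd hlin
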